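/- Let $A$ be a $\mathbb{C}$-algebra with an idempotent $e$, put $A_{\mathrm{con}} := A/AeA$, and let $i^* = -\otimes_A A_{\mathrm{con}}$ be the extension of scalars from right $A$-modules to right $A_{\mathrm{con}}$-modules. Let $S$ be a simple right $A$-module, finite dimensional over $\mathbb{C}$, with $i^*S\neq 0$ (so that $S$ is an $A_{\mathrm{con}}$-module and $i^*S=S$). Let $n\ge 1$ and suppose that there is a complex of finitely generated projective right $A$-modules \[ \mathcal{Q} \colon\quad 0\to Q_{n-1}\to Q_{n-2}\to\dots\to Q_1\to Q_0\to 0, \] with $Q_j$ in cohomological degree $-j$, which gives an $A$-projective resolution $\mathcal{Q}\to S$, such that $P := i^*\mathcal{Q}$ satisfies $\mathrm{H}^{-j}(P)\cong i^*S$ if $j\in\{0,n-1\}$ and $\mathrm{H}^{-j}(P)=0$ otherwise. Let $\mathcal{E}nd_A(\mathcal{Q})$ and $\mathcal{E}nd_{A_{\mathrm{con}}}(P)$ be the endomorphism DG-algebras (with product the composition and differential $\delta(f)=d\circ f-(-1)^{|f|}f\circ d$). A strictly unital minimal model of a unital DG-algebra $\mathcal{B}$ is an $A_\infty$-structure on $\mathrm{H}^*(\mathcal{B})$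 with $m_1=0$ and strict unit $\mathsf{1}=[1_{\mathcal{B}}]$, together with strictly unital $A_\infty$-morphisms $\mathrm{H}^*(\mathcal{B})\rightsquigarrow\mathcal{B}$ and $\mathcal{B}\rightsquigarrow\mathrm{H}^*(\mathcal{B})$ whose linear components induce the identity in cohomology. Then both DG-algebras have strictly unital minimal models, and for any strictly unital minimal models of $\mathcal{E}nd_A(\mathcal{Q})$ and of $\mathcal{E}nd_{A_{\mathrm{con}}}(P)$ there is an $A_\infty$-isomorphism (an $A_\infty$-morphism whose linear component is an isomorphism) \[ \mathrm{H}^*\big(\mathcal{E}nd_A(\mathcal{Q})\big)\rightsquigarrow \mathcal{N}:=\mathbb{C}\mathsf{1}\oplus \mathrm{H}^{>0}\big(\mathcal{E}nd_{A_{\mathrm{con}}}(P)\big) \] from the first minimal model to the unitally positive $A_\infty$-algebra $\mathcal{N}$, that is, $\mathbb{C}\mathsf{1}\oplus \mathrm{H}^{>0}(\mathcal{E}nd_{A_{\mathrm{con}}}(P))$ with $\mathsf{1}=[\mathrm{Id}_P]$ and with the operations restricted from the second minimal model. -/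

import Mathlib

open CategoryTheory MulOpposite DirectSum

noncomputable section

/-! ## Idempotents and extension of scalars for right modules -/

section Idempotent

universe u v

variable {A : Type u} [Ring A]

/-- The quotient algebra `A_con = A / AeA` by the two-sided ideal generated by `e`. -/
abbrev Acon (e : A) : Type u := (TwoSidedIdeal.span {e}).ringCon.Quotient

/-- The submodule `M · AeA` of a right `A`-module `M`. -/
def traceSubmodule (e : A) (M : Type v) [AddCommGroup M] [Module Aᵐᵒᵖ M] : Submodule Aᵐᵒᵖ M :=
  Submodule.span Aᵐᵒᵖ {y | ∃ x ∈ TwoSidedIdeal.span {e}, ∃ m : M, y = op x • m}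

/-- The underlying type of `M ⊗_A A_con`, namely `M / (M · AeA)`. -/
def IStar (e : A) (M : Type v) [AddCommGroup M] [Module Aᵐᵒᵖ M] : Type v :=
  M ⧸ traceSubmodule e M

namespace IStar

variable (e : A) (M : Type v) [AddCommGroup M] [Module Aᵐᵒᵖ M]

instance : AddCommGroup (IStar e M) :=
  inferInstanceAs (AddCommGroup (M ⧸ traceSubmodule e M))

/-- The quotient map `M → M / (M · AeA)`. -/
def mk : M →+ IStar e M := (traceSubmodule e M).mkQ.toAddMonoidHom

variable {M} in
lemma mk_surjective : Function.Surjective (mk e M) :=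
  (traceSubmodule e M).mkQ_surjective

variable {M} in
lemma mk_eq_zero_iff (m : M) : mk e M m = 0 ↔ m ∈ traceSubmodule e M :=
  Submodule.Quotient.mk_eq_zero _

/-- The action of `a : A` on `M / (M · AeA)` from the right. -/
def act (a : A) : IStar e M →+ IStar e M :=
  QuotientAddGroup.lift _ ((mk e M).comp (DistribSMul.toAddMonoidHom M (op a)))
    (fun _ hm => (mk_eq_zero_iff e _).2 ((traceSubmodule e M).smul_mem (op a) hm))

variable {M} in
lemma act_mk (a : A) (m : M) : act e M a (mk e M m) = mk e M (op a • m) := rfl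

/-- The right action of `A` on `M / (M · AeA)`, as a ring homomorphism. -/
def actHom : A →+* (AddMonoid.End (IStar e M))ᵐᵒᵖ where
  toFun a := op (act e M a)
  map_one' := by
    apply unop_injective; ext x
    obtain ⟨m, rfl⟩ := mk_surjective e x
    change mk e M (op (1 : A) • m) = mk e M m
    rw [op_one, one_smul]
  map_mul' a b := by
    apply unop_injective; ext x
    obtain ⟨m, rfl⟩ := mk_surjective e x
    change mk e M (op (a * b) • m) = mk e M (op b • op a • m)
    rw [op_mul, mul_smul]
  map_zero' := by
    apply unop_injective; ext x
    obtain ⟨m, rfl⟩ := mk_surjective e x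
    change mk e M (op (0 : A) • m) = 0
    rw [op_zero, zero_smul, map_zero]
  map_add' a b := by
    apply unop_injective; ext x
    obtain ⟨m, rfl⟩ := mk_surjective e x
    change mk e M (op (a + b) • m) = mk e M (op a • m) + mk e M (op b • m)
    rw [MulOpposite.op_add, add_smul, map_add]

/-- The induced right action of `A_con` on `M / (M · AeA)`, as a ring homomorphism. -/
def actConHom : Acon e →+* (AddMonoid.End (IStar e M))ᵐᵒᵖ :=
  RingCon.lift _ (actHom e M) (by
    intro a b hab
    rw [TwoSidedIdeal.rel_iff] at hab
    change actHom e M a = actHom e M b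
    rw [← sub_eq_zero, ← map_sub]
    apply unop_injective; ext x
    obtain ⟨m, rfl⟩ := mk_surjective e x
    exact (mk_eq_zero_iff e _).2 (Submodule.subset_span ⟨_, hab, m, rfl⟩))

instance : Module (Acon e)ᵐᵒᵖ (IStar e M) where
  smul x y := (actConHom e M x.unop).unop y
  one_smul y := by
    change (actConHom e M 1).unop y = y
    simp
  mul_smul a b y := by
    change (actConHom e M (b.unop * a.unop)).unop y = _
    rw [map_mul]; rfl
  smul_zero a := map_zero (actConHom e M a.unop).unop
  smul_add a := map_add (actConHom e M a.unop).unop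
  add_smul a b y := by
    change (actConHom e M (a.unop + b.unop)).unop y = _
    rw [map_add]; rfl
  zero_smul y := by
    change (actConHom e M 0).unop y = 0
    rw [map_zero]; rfl

variable {M} in
lemma op_mk_smul_mk (a : A) (m : M) :
    (op (a : Acon e) : (Acon e)ᵐᵒᵖ) • mk e M m = mk e M (op a • m) := rfl

variable {M} {N : Type v} [AddCommGroup N] [Module Aᵐᵒᵖ N]

/-- The map `M / (M · AeA) → N / (N · AeA)` induced by `f : M → N`. -/
def map (f : M →ₗ[Aᵐᵒᵖ] N) : IStar e M →ₗ[(Acon e)ᵐᵒᵖ] IStar e N where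
  toFun := (traceSubmodule e M).mapQ (traceSubmodule e N) f (by
    refine Submodule.span_le.2 ?_
    rintro _ ⟨x, hx, m, rfl⟩
    exact Submodule.subset_span ⟨x, hx, f m, map_smul f _ _⟩)
  map_add' x y := map_add _ x y
  map_smul' a x := by
    obtain ⟨m, rfl⟩ := mk_surjective e x
    obtain ⟨a⟩ := a
    obtain ⟨a, rfl⟩ := RingCon.mk'_surjective _ a
    change mk e N (f (op a • m)) = mk e N (op a • f m)
    rw [map_smul]

lemma map_mk (f : M →ₗ[Aᵐᵒᵖ] N) (m : M) : map e f (mk e M m) = mk e N (f m) := rfl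

end IStar

/-- The extension of scalars functor `i^* = - ⊗_A A_con` from right `A`-modules to right
`A_con`-modules. -/
@[simps]
def iStar (e : A) : ModuleCat.{v} Aᵐᵒᵖ ⥤ ModuleCat.{v} (Acon e)ᵐᵒᵖ where
  obj M := ModuleCat.of _ (IStar e M)
  map f := ModuleCat.ofHom (IStar.map e f.hom)
  map_id M := by
    ext x
    obtain ⟨m, rfl⟩ := IStar.mk_surjective e x
    rfl
  map_comp f g := by
    ext x
    obtain ⟨m, rfl⟩ := IStar.mk_surjective e x
    rfl

instance (e : A) : (iStar.{u, v} e).Additive where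
  map_add {M N f g} := by
    ext x
    obtain ⟨m, rfl⟩ := IStar.mk_surjective e x
    rfl

/-- The complex `i^* Q` of right `A_con`-modules. -/
abbrev iStarComplex (e : A) (Q : CochainComplex (ModuleCat.{v} Aᵐᵒᵖ) ℤ) :
    CochainComplex (ModuleCat.{v} (Acon e)ᵐᵒᵖ) ℤ :=
  ((iStar e).mapHomologicalComplex (ComplexShape.up ℤ)).obj Q

end Idempotent
/-! ## A∞-algebras -/

section AInfinity

/-- Given a sequence `a`, replace the `s` consecutive terms `a r, …, a (r + s - 1)` by the single
term `y`. -/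
def insertBlock {V : Type*} (a : ℕ → V) (r s : ℕ) (y : V) : ℕ → V := fun i =>
  if i < r then a i else if i = r then y else a (i + s - 1)

/-- `(φ (1^{⊗ r} ⊗ m_s ⊗ 1^{⊗ t}))(a_0, …, a_{r+s+t-1})`, up to the Koszul sign, where `φ` is a
map with `r + 1 + t` arguments. -/
def nest {V W : Type*} [AddCommGroup V] [Module ℂ V] [AddCommGroup W] [Module ℂ W]
    (φ : ∀ n : ℕ, MultilinearMap ℂ (fun _ : Fin n => V) W)
    (m : ∀ n : ℕ, MultilinearMap ℂ (fun _ : Fin n => V) V)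
    (a : ℕ → V) (r s t : ℕ) : W :=
  φ (r + 1 + t) (fun i => insertBlock a r s (m s (fun j => a (r + j))) i)

/-- The value at `a_0 ⊗ ⋯ ⊗ a_{n-1}`, with `a_i` homogeneous of degree `d i`, of
`∑ (-1)^{r + st} φ_{r+1+t} (1^{⊗ r} ⊗ m_s ⊗ 1^{⊗ t})`, the sum being over `r + s + t = n` with
`s ≥ 1`. The last summand of the exponent is the Koszul sign. -/
def nestSum {V W : Type*} [AddCommGroup V] [Module ℂ V] [AddCommGroup W] [Module ℂ W]
    (φ : ∀ n : ℕ, MultilinearMap ℂ (fun _ : Fin n => V) W)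
    (m : ∀ n : ℕ, MultilinearMap ℂ (fun _ : Fin n => V) V)
    (n : ℕ) (d : ℕ → ℤ) (a : ℕ → V) : W :=
  ∑ r ∈ Finset.range n, ∑ s ∈ Finset.Icc 1 (n - r),
    Int.negOnePow ((r : ℤ) + s * (n - r - s) + (2 - s) * ∑ i ∈ Finset.range r, d i) •
      nest φ m a r s (n - r - s)

/-- An A∞-algebra structure on a complex vector space `V` with grading `gr`: operations
`m_n : V^{⊗ n} → V` of degree `2 - n`, for `n ≥ 1`, such that
`∑_{r + s + t = n} (-1)^{r + st} m_{r+1+t} (1^{⊗ r} ⊗ m_s ⊗ 1^{⊗ t}) = 0` for `n ≥ 1`. -/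
structure AInfAlgebra {V : Type*} [AddCommGroup V] [Module ℂ V] (gr : ℤ → Submodule ℂ V) where
  /-- `V` is the direct sum of its homogeneous components -/
  internal : DirectSum.IsInternal gr
  /-- the operations; the one with no argument is not used, and set to zero -/
  m : ∀ n : ℕ, MultilinearMap ℂ (fun _ : Fin n => V) V
  m_zero : m 0 = 0
  m_mem : ∀ (n : ℕ) (d : Fin n → ℤ) (a : Fin n → V), (∀ i, a i ∈ gr (d i)) →
    m n a ∈ gr (∑ i, d i + 2 - n)
  rel : ∀ n : ℕ, 1 ≤ n → ∀ (d : ℕ → ℤ) (a : ℕ → V), (∀ i, a i ∈ gr (d i)) →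
    nestSum m m n d a = 0

/-- `(m_k (f_{i_1} ⊗ ⋯ ⊗ f_{i_k}))(a_0, …, a_{n-1})`, up to the Koszul sign, where
`n = i_1 + ⋯ + i_k` is the composition `c`. -/
def compTerm {V W : Type*} [AddCommGroup V] [Module ℂ V] [AddCommGroup W] [Module ℂ W]
    (m : ∀ n : ℕ, MultilinearMap ℂ (fun _ : Fin n => W) W)
    (f : ∀ n : ℕ, MultilinearMap ℂ (fun _ : Fin n => V) W)
    {n : ℕ} (c : Composition n) (a : ℕ → V) : W :=
  m c.length (fun j => f (c.blocksFun j) (fun l => a (c.sizeUpTo j + l)))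

/-- The exponent of the sign of `m_k (f_{i_1} ⊗ ⋯ ⊗ f_{i_k})` in the equations of an
A∞-morphism, namely `∑_j (k - j) (i_j - 1)`, plus the exponent of the Koszul sign for moving each
`f_{i_j}`, of degree `1 - i_j`, past the arguments of the previous blocks. -/
def compSign {n : ℕ} (c : Composition n) (d : ℕ → ℤ) : ℤ :=
  ∑ j : Fin c.length,
    (((c.length : ℤ) - (j + 1)) * (c.blocksFun j - 1) +
      (1 - (c.blocksFun j : ℤ)) * ∑ l ∈ Finset.range (c.sizeUpTo j), d l)

/-- An A∞-morphism `X ⇝ Y`: components `f_n : V^{⊗ n} → W` of degree `1 - n`, for `n ≥ 1`, with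
`∑_{r + s + t = n} (-1)^{r + st} f_{r+1+t} (1^{⊗ r} ⊗ m_s ⊗ 1^{⊗ t})
  = ∑_{i_1 + ⋯ + i_k = n} (-1)^{∑_j (k - j) (i_j - 1)} m_k (f_{i_1} ⊗ ⋯ ⊗ f_{i_k})`. -/
structure AInfHom {V W : Type*} [AddCommGroup V] [Module ℂ V] [AddCommGroup W] [Module ℂ W]
    {grV : ℤ → Submodule ℂ V} {grW : ℤ → Submodule ℂ W}
    (X : AInfAlgebra grV) (Y : AInfAlgebra grW) where
  /-- the components; the one with no argument is not used, and set to zero -/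
  f : ∀ n : ℕ, MultilinearMap ℂ (fun _ : Fin n => V) W
  f_zero : f 0 = 0
  f_mem : ∀ (n : ℕ) (d : Fin n → ℤ) (a : Fin n → V), (∀ i, a i ∈ grV (d i)) →
    f n a ∈ grW (∑ i, d i + 1 - n)
  rel : ∀ n : ℕ, 1 ≤ n → ∀ (d : ℕ → ℤ) (a : ℕ → V), (∀ i, a i ∈ grV (d i)) →
    nestSum f X.m n d a = ∑ c : Composition n, Int.negOnePow (compSign c d) • compTerm Y.m f c a

/-- `η` is a strict unit of the A∞-algebra `X`. -/
structure AInfAlgebra.IsStrictUnit {V : Type*} [AddCommGroup V] [Module ℂ V]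
    {gr : ℤ → Submodule ℂ V} (X : AInfAlgebra gr) (η : V) : Prop where
  mem : η ∈ gr 0
  mul_unit : ∀ a, X.m 2 ![a, η] = a
  unit_mul : ∀ a, X.m 2 ![η, a] = a
  eq_zero : ∀ n : ℕ, n ≠ 2 → ∀ a : Fin n → V, (∃ j, a j = η) → X.m n a = 0

namespace AInfHom

variable {V W : Type*} [AddCommGroup V] [Module ℂ V] [AddCommGroup W] [Module ℂ W]
  {grV : ℤ → Submodule ℂ V} {grW : ℤ → Submodule ℂ W}
  {X : AInfAlgebra grV} {Y : AInfAlgebra grW}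

/-- The linear component of an A∞-morphism. -/
def linear (F : AInfHom X Y) (x : V) : W := F.f 1 (fun _ => x)

/-- An A∞-morphism is strictly unital (for the strict units `ηV` and `ηW`). -/
structure IsStrictlyUnital (F : AInfHom X Y) (ηV : V) (ηW : W) : Prop where
  unit : F.linear ηV = ηW
  eq_zero : ∀ n : ℕ, n ≠ 1 → ∀ a : Fin n → V, (∃ j, a j = ηV) → F.f n a = 0

/-- An A∞-morphism is an A∞-isomorphism if its linear component is an isomorphism. -/
def IsIso (F : AInfHom X Y) : Prop := Function.Bijective F.linear

end AInfHom

/-! ### The unitally positive subalgebra -/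

section UnitallyPositive

variable {V : Type*} [AddCommGroup V] [Module ℂ V]

/-- The subspace `ℂ η ⊕ V^{>0}`. -/
def unitPosSubmodule (gr : ℤ → Submodule ℂ V) (η : V) : Submodule ℂ V :=
  Submodule.span ℂ {η} ⊔ ⨆ k : {k : ℤ // 0 < k}, gr k

/-- The grading of `ℂ η ⊕ V^{>0}` induced by the grading of `V`. -/
def unitPosGr (gr : ℤ → Submodule ℂ V) (η : V) (k : ℤ) : Submodule ℂ (unitPosSubmodule gr η) :=
  (gr k).comap (unitPosSubmodule gr η).subtype

lemma unitPosSubmodule_eq_span (gr : ℤ → Submodule ℂ V) (η : V) :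
    unitPosSubmodule gr η = Submodule.span ℂ {x | x = η ∨ ∃ k : ℤ, 0 < k ∧ x ∈ gr k} := by
  apply le_antisymm
  · refine sup_le (Submodule.span_mono ?_) (iSup_le fun k => ?_)
    · rintro x rfl; exact Or.inl rfl
    · intro x hx; exact Submodule.subset_span (Or.inr ⟨k, k.2, hx⟩)
  · rw [Submodule.span_le]
    rintro x (rfl | ⟨k, hk, hx⟩)
    · exact Submodule.mem_sup_left (Submodule.mem_span_singleton_self _)
    · exact Submodule.mem_sup_right (Submodule.mem_iSup_of_mem (⟨k, hk⟩ : {k : ℤ // 0 < k}) hx)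

lemma unitPosGr_internal {gr : ℤ → Submodule ℂ V} (h : DirectSum.IsInternal gr) {η : V}
    (hη : η ∈ gr 0) : DirectSum.IsInternal (unitPosGr gr η) := by
  apply DirectSum.isInternal_submodule_of_iSupIndep_of_iSup_eq_top
  · intro k
    have hk := h.submodule_iSupIndep k
    rw [Submodule.disjoint_def] at hk ⊢
    intro x hx hx'
    apply Subtype.ext
    refine hk x.1 hx ?_
    have := Submodule.mem_map_of_mem (f := (unitPosSubmodule gr η).subtype) hx'
    rw [Submodule.map_iSup] at this
    have hle : ⨆ j, Submodule.map (unitPosSubmodule gr η).subtype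
        (⨆ (_ : j ≠ k), unitPosGr gr η j) ≤ ⨆ j, ⨆ (_ : j ≠ k), gr j := by
      refine iSup_mono fun j => ?_
      rw [Submodule.map_iSup]
      exact iSup_mono fun _ => Submodule.map_comap_le _ _
    exact hle this
  · rw [eq_top_iff]
    rintro ⟨x, hx⟩ -
    have hx' := hx
    rw [unitPosSubmodule_eq_span] at hx'
    have key : x ∈ (⨆ k, unitPosGr gr η k).map (unitPosSubmodule gr η).subtype := by
      refine (Submodule.span_le.2 ?_) hx'
      rintro y hy
      have hyU : y ∈ unitPosSubmodule gr η := by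
        rw [unitPosSubmodule_eq_span]; exact Submodule.subset_span hy
      have : ∃ k, y ∈ gr k := by
        rcases hy with rfl | ⟨k, -, hk⟩
        exacts [⟨0, hη⟩, ⟨k, hk⟩]
      obtain ⟨k, hk⟩ := this
      exact ⟨⟨y, hyU⟩, Submodule.mem_iSup_of_mem k hk, rfl⟩
    obtain ⟨z, hz, rfl⟩ := key
    exact hz

/-- A multilinear map that sends tuples of generators into `U` sends tuples of elements of
their span into `U`. -/
lemma multilinear_mem_of_span {W : Type*} [AddCommGroup W] [Module ℂ W] {n : ℕ}
    (φ : MultilinearMap ℂ (fun _ : Fin n => V) W) (T : Set V) (U : Submodule ℂ W)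
    (h : ∀ a : Fin n → V, (∀ i, a i ∈ T) → φ a ∈ U)
    (a : Fin n → V) (ha : ∀ i, a i ∈ Submodule.span ℂ T) : φ a ∈ U := by
  classical
  have key : ∀ (s : Finset (Fin n)) (a : Fin n → V),
      (∀ i, a i ∈ Submodule.span ℂ T) → (∀ i, i ∉ s → a i ∈ T) → φ a ∈ U := by
    intro s
    induction s using Finset.induction_on with
    | empty => exact fun a _ h' => h a (fun i => h' i (by simp))
    | insert j s hj ih =>
      intro a ha h'
      have : ∀ x ∈ Submodule.span ℂ T, φ (Function.update a j x) ∈ U := by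
        intro x hx
        induction hx using Submodule.span_induction with
        | mem x hx =>
          apply ih
          · intro i
            by_cases hij : i = j
            · subst hij; simpa using Submodule.subset_span hx
            · simpa [hij] using ha i
          · intro i hi
            by_cases hij : i = j
            · subst hij; simpa using hx
            · simpa [hij] using h' i (by simp [hij, hi])
        | zero => simp
        | add x y _ _ hx hy => rw [φ.map_update_add]; exact U.add_mem hx hy
        | smul c x _ hx => rw [φ.map_update_smul]; exact U.smul_mem c hx
      simpa using this (a j) (ha j)
  exact key Finset.univ a ha (by simp)

namespace AInfAlgebra

variable {gr : ℤ → Submodule ℂ V} (X : AInfAlgebra gr) {η : V}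

lemma m_mem_unitPos (hη : X.IsStrictUnit η) (n : ℕ) (a : Fin n → V)
    (ha : ∀ i, a i ∈ unitPosSubmodule gr η) : X.m n a ∈ unitPosSubmodule gr η := by
  rw [unitPosSubmodule_eq_span] at ha ⊢
  refine multilinear_mem_of_span _ _ _ (fun a ha => ?_) a ha
  by_cases hu : ∃ j, a j = η
  · by_cases hn : n = 2
    · subst hn
      obtain ⟨j, hj⟩ := hu
      fin_cases j
      · have : a = ![η, a 1] := by ext i; fin_cases i; exacts [hj, rfl]
        rw [this, hη.unit_mul]
        exact Submodule.subset_span (ha 1)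
      · have : a = ![a 0, η] := by ext i; fin_cases i; exacts [rfl, hj]
        rw [this, hη.mul_unit]
        exact Submodule.subset_span (ha 0)
    · rw [hη.eq_zero n hn a hu]
      exact Submodule.zero_mem _
  · rcases Nat.eq_zero_or_pos n with rfl | hn
    · rw [X.m_zero]; exact Submodule.zero_mem _
    have : ∀ i, ∃ k : ℤ, 0 < k ∧ a i ∈ gr k := fun i =>
      (ha i).resolve_left (fun h => hu ⟨i, h⟩)
    choose d hd hmem using this
    refine Submodule.subset_span (Or.inr ⟨_, ?_, X.m_mem n d a hmem⟩)
    have : ∑ _i : Fin n, (1 : ℤ) ≤ ∑ i, d i := Finset.sum_le_sum fun i _ => hd i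
    simp at this
    omega

/-- The operations of `X` restricted to `ℂ η ⊕ V^{>0}`. -/
def unitPosM (hη : X.IsStrictUnit η) (n : ℕ) :
    MultilinearMap ℂ (fun _ : Fin n => unitPosSubmodule gr η) (unitPosSubmodule gr η) :=
  ((X.m n).compLinearMap (fun _ => (unitPosSubmodule gr η).subtype)).codRestrict _
    (fun a => X.m_mem_unitPos hη n _ (fun i => (a i).2))

lemma coe_unitPosM (hη : X.IsStrictUnit η) (n : ℕ) (a : Fin n → unitPosSubmodule gr η) :
    (X.unitPosM hη n a : V) = X.m n (fun i => a i) := rfl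

/-- The unitally positive A∞-algebra `ℂ η ⊕ V^{>0}` of a strictly unital A∞-algebra, with the
restricted operations. -/
def unitallyPositive (hη : X.IsStrictUnit η) : AInfAlgebra (unitPosGr gr η) where
  internal := unitPosGr_internal X.internal hη.mem
  m := X.unitPosM hη
  m_zero := by
    ext a
    rw [coe_unitPosM, X.m_zero]; rfl
  m_mem n d a ha := X.m_mem n d (fun i => a i) ha
  rel n hn d a ha := by
    apply Subtype.ext
    rw [ZeroMemClass.coe_zero, ← X.rel n hn d (fun i => a i) ha]
    simp only [nestSum, AddSubmonoidClass.coe_finsetSum]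
    refine Finset.sum_congr rfl fun r _ => Finset.sum_congr rfl fun s _ => ?_
    rw [Units.smul_def, Units.smul_def, Submodule.coe_smul_of_tower]
    congr 1
    simp only [nest, coe_unitPosM]
    congr 1
    ext i
    simp only [insertBlock]
    split_ifs <;> rfl

end AInfAlgebra

end UnitallyPositive

end AInfinity

/-! ## DG-algebras and their strictly unital minimal models -/

section DGAlgebras

/-- A unital DG-algebra structure on a complex algebra `B`. -/
structure DGAlgebra (B : Type*) [Ring B] [Algebra ℂ B] where
  /-- the homogeneous components -/
  gr : ℤ → Submodule ℂ B
  internal : DirectSum.IsInternal gr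
  one_mem : (1 : B) ∈ gr 0
  mul_mem : ∀ {i j : ℤ} {x y : B}, x ∈ gr i → y ∈ gr j → x * y ∈ gr (i + j)
  /-- the differential -/
  d : B →ₗ[ℂ] B
  d_mem : ∀ {i : ℤ} {x : B}, x ∈ gr i → d x ∈ gr (i + 1)
  d_d : ∀ x : B, d (d x) = 0
  leibniz : ∀ {i : ℤ} {x : B} (y : B), x ∈ gr i → d (x * y) = d x * y + i.negOnePow • (x * d y)

namespace DGAlgebra

variable {B : Type*} [Ring B] [Algebra ℂ B] (D : DGAlgebra B)

lemma d_one : D.d 1 = 0 := by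
  have h := D.leibniz 1 D.one_mem
  simpa using h

/-- The operations of a DG-algebra seen as an A∞-algebra: `m_1 = d`, `m_2` is the product, and
`m_n = 0` for `n ≥ 3`. -/
def m : ∀ n : ℕ, MultilinearMap ℂ (fun _ : Fin n => B) B
  | 1 => D.d.compMultilinearMap (MultilinearMap.mkPiAlgebraFin ℂ 1 B)
  | 2 => MultilinearMap.mkPiAlgebraFin ℂ 2 B
  | _ => 0

lemma m_one (a : Fin 1 → B) : D.m 1 a = D.d (a 0) := by
  simp [m]

lemma m_two (a : Fin 2 → B) : D.m 2 a = a 0 * a 1 := by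
  simp [m]

lemma m_of_three_le {n : ℕ} (hn : 3 ≤ n) : D.m n = 0 := by
  obtain ⟨k, rfl⟩ := Nat.exists_eq_add_of_le' hn
  rfl

lemma m_apply_one {N : ℕ} (h : N = 1) (b : ℕ → B) : D.m N (fun i => b i) = D.d (b 0) := by
  subst h; exact D.m_one _

lemma m_apply_two {N : ℕ} (h : N = 2) (b : ℕ → B) : D.m N (fun i => b i) = b 0 * b 1 := by
  subst h; exact D.m_two _

/-- A DG-algebra seen as an A∞-algebra. -/
def toAInf : AInfAlgebra D.gr where
  internal := D.internal
  m := D.m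
  m_zero := rfl
  m_mem n d a ha := by
    rcases n with _ | _ | _ | n
    · exact Submodule.zero_mem _
    · rw [m_one]
      have := D.d_mem (ha 0)
      convert this using 2
      simp; ring
    · rw [m_two]
      have := D.mul_mem (ha 0) (ha 1)
      convert this using 2
      simp
    · exact Submodule.zero_mem _
  rel n hn d a ha := by
    by_cases h4 : 4 ≤ n
    · refine Finset.sum_eq_zero fun r hr => Finset.sum_eq_zero fun s hs => ?_
      rw [Finset.mem_range] at hr
      rw [Finset.mem_Icc] at hs
      by_cases hs3 : 3 ≤ s
      · rw [nest, D.m_of_three_le hs3, _root_.zero_apply]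
        rw [MultilinearMap.map_coord_zero _ (⟨r, by omega⟩ : Fin (r + 1 + (n - r - s)))
          (by simp [insertBlock]), smul_zero]
      · rw [nest, D.m_of_three_le (show 3 ≤ r + 1 + (n - r - s) by omega),
          _root_.zero_apply, smul_zero]
    · have hI1 : Finset.Icc 1 1 = {1} := by decide
      have hI2 : Finset.Icc 1 2 = {1, 2} := by decide
      have hI3 : Finset.Icc 1 3 = {1, 2, 3} := by decide
      interval_cases n
      · simp only [nestSum, nest, Finset.sum_range_one, Nat.sub_zero, hI1, Finset.sum_singleton]
        rw [D.m_apply_one rfl, D.m_apply_one rfl (fun j => a (0 + j))]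
        simp [insertBlock, D.d_d]
      · have hl := D.leibniz (a 1) (ha 0)
        simp only [nestSum, nest, Finset.sum_range_succ, Finset.sum_range_zero, Nat.sub_zero,
          Nat.add_one_sub_one, hI1, hI2, Finset.sum_singleton,
          Finset.sum_pair (show (1 : ℕ) ≠ 2 by decide), zero_add]
        rw [D.m_apply_two rfl, D.m_apply_one rfl, D.m_apply_one rfl, D.m_apply_two rfl,
          D.m_apply_two rfl, D.m_apply_one rfl (fun j => a (1 + j))]
        simp [insertBlock, hl, Int.negOnePow_add, Int.negOnePow_one, Units.neg_smul]
      · simp only [nestSum, nest, Finset.sum_range_succ, Finset.sum_range_zero, Nat.sub_zero,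
          Nat.reduceSub, hI1, hI2, hI3, Finset.sum_singleton,
          Finset.sum_pair (show (1 : ℕ) ≠ 2 by decide), zero_add,
          Finset.sum_insert (show (1 : ℕ) ∉ ({2, 3} : Finset ℕ) by decide),
          Finset.sum_pair (show (2 : ℕ) ≠ 3 by decide)]
        rw [D.m_of_three_le (n := 1 + 2) le_rfl, D.m_apply_two rfl, D.m_apply_two rfl,
          D.m_apply_one rfl, D.m_apply_one rfl, D.m_apply_two rfl,
          D.m_apply_two rfl (fun j => a (1 + j))]
        simp [Int.negOnePow_even 2 even_two, insertBlock, mul_assoc, Int.negOnePow_add, Int.negOnePow_one]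

/-- The cohomology `H^*(B) = ker d / im d`. -/
abbrev Cohomology : Type _ :=
  LinearMap.ker D.d ⧸ (LinearMap.range D.d).submoduleOf (LinearMap.ker D.d)

/-- The cohomology class of a cocycle. -/
def cls (z : B) (hz : D.d z = 0) : D.Cohomology := Submodule.Quotient.mk ⟨z, hz⟩

/-- The component `H^k(B)`: the classes of cocycles of degree `k`. -/
def cohGr (k : ℤ) : Submodule ℂ D.Cohomology :=
  ((D.gr k).submoduleOf (LinearMap.ker D.d)).map (Submodule.mkQ _)

/-- The class of the unit. -/
def cohOne : D.Cohomology := D.cls 1 D.d_one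

/-- A strictly unital minimal model of a unital DG-algebra `B`: an A∞-structure on `H^*(B)` with
zero differential and with strict unit the class of `1`, and two strictly unital A∞-morphisms
`i : H^*(B) ⇝ B` and `p : B ⇝ H^*(B)` whose linear components induce the identity in cohomology
(so that `i` and `p` are A∞-quasi-isomorphisms). -/
structure MinimalModel where
  /-- the A∞-structure on the cohomology -/
  alg : AInfAlgebra D.cohGr
  minimal : alg.m 1 = 0
  isStrictUnit : alg.IsStrictUnit D.cohOne
  /-- the A∞-quasi-isomorphism that chooses representatives -/
  i : AInfHom alg D.toAInf
  i_unital : i.IsStrictlyUnital D.cohOne 1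
  i_linear : ∀ x, ∃ hx : D.d (i.linear x) = 0, D.cls (i.linear x) hx = x
  /-- the A∞-quasi-isomorphism in the other direction -/
  p : AInfHom D.toAInf alg
  p_unital : p.IsStrictlyUnital 1 D.cohOne
  p_linear : ∀ (z : B) (hz : D.d z = 0), p.linear z = D.cls z hz

/-- The unitally positive A∞-algebra `ℂ 1 ⊕ H^{>0}(B)` of a unital DG-algebra `B`, with the
A∞-structure induced by a strictly unital minimal model of `B`. -/
def MinimalModel.unitallyPositive {D : DGAlgebra B} (M : D.MinimalModel) :
    AInfAlgebra (unitPosGr D.cohGr D.cohOne) :=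
  M.alg.unitallyPositive M.isStrictUnit

end DGAlgebra

end DGAlgebras

/-! ## The endomorphism DG-algebra of a complex -/

section EndDG

open CochainComplex CochainComplex.HomComplex

universe w u

variable {C : Type u} [Category.{w} C] [Preadditive C] [Linear ℂ C]

/-- Endomorphisms of degree `k` of the complex `K`: families of maps `K^p → K^{p+k}`. -/
abbrev EndDeg (K : CochainComplex C ℤ) (k : ℤ) : Type w := Cochain K K k

variable (K : CochainComplex C ℤ)

set_option linter.unusedSectionVars false

lemma EndDeg.sigma_ext {i j : ℤ} (h : i = j) (x : EndDeg K i) (y : EndDeg K j)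
    (hv : ∀ p q (hp : p + i = q) (hq : p + j = q), x.v p q hp = y.v p q hq) :
    (⟨i, x⟩ : GradedMonoid (EndDeg K)) = ⟨j, y⟩ := by
  subst h
  congr 1
  ext p q hpq
  rw [hv p q hpq hpq]

/-- The product of endomorphisms is the composition `(x, y) ↦ x ∘ y`. -/
instance : GradedMonoid.GMul (EndDeg K) where
  mul {i j} x y := Cochain.comp y x (add_comm j i)

instance : GradedMonoid.GOne (EndDeg K) where
  one := Cochain.ofHom (𝟙 K)

lemma EndDeg.mul_def {i j : ℤ} (x : EndDeg K i) (y : EndDeg K j) :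
    (GradedMonoid.GMul.mul x y : EndDeg K (i + j)) = Cochain.comp y x (add_comm j i) := rfl

lemma EndDeg.mul_v {i j k : ℤ} (hk : j + i = k) (x : EndDeg K i) (y : EndDeg K j) (p q r : ℤ)
    (hp : p + j = q) (hq : q + i = r) :
    (Cochain.comp y x hk).v p r (by lia) = y.v p q hp ≫ x.v q r hq :=
  Cochain.comp_v _ _ _ p q r hp hq

instance : DirectSum.GRing (EndDeg K) where
  one_mul := by
    rintro ⟨i, x⟩
    refine EndDeg.sigma_ext K (zero_add i) (Cochain.comp x (Cochain.ofHom (𝟙 K)) _) x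
      fun p q hp hq => ?_
    rw [EndDeg.mul_v K _ _ _ p q q hq (add_zero q)]
    simp
  mul_one := by
    rintro ⟨i, x⟩
    refine EndDeg.sigma_ext K (add_zero i) (Cochain.comp (Cochain.ofHom (𝟙 K)) x _) x
      fun p q hp hq => ?_
    rw [EndDeg.mul_v K _ _ _ p p q (add_zero p) hq]
    simp
  mul_assoc := by
    rintro ⟨i, x⟩ ⟨j, y⟩ ⟨k, z⟩
    refine EndDeg.sigma_ext K (add_assoc i j k)
      (Cochain.comp z (Cochain.comp y x (add_comm j i)) (add_comm k (i + j)))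
      (Cochain.comp (Cochain.comp z y (add_comm k j)) x (add_comm (j + k) i))
      fun p q hp hq => ?_
    rw [EndDeg.mul_v K _ _ _ p (p + k) q rfl (by lia),
      EndDeg.mul_v K _ _ _ (p + k) (p + k + j) q rfl (by lia),
      EndDeg.mul_v K _ _ _ p (p + k + j) q (by lia) (by lia),
      EndDeg.mul_v K _ _ _ p (p + k) (p + k + j) rfl rfl, Category.assoc]
  mul_zero _ := Cochain.zero_comp _ _
  zero_mul _ := Cochain.comp_zero _ _
  mul_add _ _ _ := Cochain.add_comp _ _ _ _
  add_mul _ _ _ := Cochain.comp_add _ _ _ _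
  natCast n := n • Cochain.ofHom (𝟙 K)
  natCast_zero := zero_smul _ _
  natCast_succ n := succ_nsmul _ n
  intCast n := n • Cochain.ofHom (𝟙 K)
  intCast_ofNat n := natCast_zsmul _ n
  intCast_negSucc_ofNat n := negSucc_zsmul _ n

instance : DirectSum.GAlgebra ℂ (EndDeg K) where
  toFun := (LinearMap.toSpanSingleton ℂ (EndDeg K 0) (Cochain.ofHom (𝟙 K))).toAddMonoidHom
  map_one := one_smul ℂ (Cochain.ofHom (𝟙 K))
  map_mul a b := by
    refine EndDeg.sigma_ext K (add_zero 0).symm ((a * b) • Cochain.ofHom (𝟙 K))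
      (Cochain.comp (b • Cochain.ofHom (𝟙 K)) (a • Cochain.ofHom (𝟙 K)) _) fun p q hp hq => ?_
    obtain rfl : p = q := by lia
    rw [EndDeg.mul_v K _ _ _ p p p (add_zero p) (add_zero p)]
    simp [smul_smul]
  commutes a := by
    rintro ⟨i, x⟩
    have key : (⟨0 + i, Cochain.comp x (a • Cochain.ofHom (𝟙 K)) (add_comm i 0)⟩ :
        GradedMonoid (EndDeg K)) =
          ⟨i + 0, Cochain.comp (a • Cochain.ofHom (𝟙 K)) x (add_comm 0 i)⟩ := by
      refine EndDeg.sigma_ext K (add_comm 0 i) _ _ fun p q hp hq => ?_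
      rw [EndDeg.mul_v K _ _ _ p q q (by lia) (add_zero q),
        EndDeg.mul_v K _ _ _ p p q (add_zero p) (by lia)]
      simp
    exact key
  smul_def a := by
    rintro ⟨i, x⟩
    have key : (⟨i, a • x⟩ : GradedMonoid (EndDeg K)) =
        ⟨0 + i, Cochain.comp x (a • Cochain.ofHom (𝟙 K)) (add_comm i 0)⟩ := by
      refine EndDeg.sigma_ext K (zero_add i).symm _ _ fun p q hp hq => ?_
      rw [EndDeg.mul_v K _ _ _ p q q (by lia) (add_zero q)]
      simp
    exact key

/-- The underlying algebra of the endomorphism DG-algebra of `K`. -/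
abbrev EndAlg : Type w := ⨁ k, EndDeg K k

/-- The differential `x ↦ d ∘ x - (-1)^{|x|} x ∘ d` of the endomorphism DG-algebra of `K`. -/
def endD : EndAlg K →ₗ[ℂ] EndAlg K :=
  DirectSum.toModule ℂ ℤ _ (fun k =>
    (DirectSum.lof ℂ ℤ (EndDeg K) (k + 1)).comp (δ_hom ℂ K K k (k + 1)))

lemma endD_of (k : ℤ) (x : EndDeg K k) :
    endD K (DirectSum.of (EndDeg K) k x) = DirectSum.of (EndDeg K) (k + 1) (δ k (k + 1) x) := by
  exact DirectSum.toModule_lof ℂ k x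

/-- The elements of degree `k` of the endomorphism DG-algebra of `K`. -/
def endGr (k : ℤ) : Submodule ℂ (EndAlg K) := LinearMap.range (DirectSum.lof ℂ ℤ (EndDeg K) k)

lemma endGr_internal : DirectSum.IsInternal (endGr K) := by
  apply DirectSum.isInternal_submodule_of_iSupIndep_of_iSup_eq_top
  · intro k
    rw [Submodule.disjoint_def]
    rintro _ ⟨x, rfl⟩ hx'
    have hle : ⨆ j, ⨆ (_ : j ≠ k), endGr K j ≤
        LinearMap.ker (DirectSum.component ℂ ℤ (EndDeg K) k) := by
      refine iSup_le fun j => iSup_le fun hj => ?_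
      rintro _ ⟨y, rfl⟩
      rw [LinearMap.mem_ker, DirectSum.component.of, dif_neg hj]
    have h := hle hx'
    rw [LinearMap.mem_ker, DirectSum.component.lof_self] at h
    rw [h, map_zero]
  · rw [eq_top_iff]
    rintro x -
    induction x using DirectSum.induction_on with
    | zero => exact Submodule.zero_mem _
    | of k x => exact Submodule.mem_iSup_of_mem k ⟨x, rfl⟩
    | add x y hx hy => exact Submodule.add_mem _ hx hy

lemma EndAlg.of_eq {i j : ℤ} (h : i = j) (x : EndDeg K i) (y : EndDeg K j)
    (hv : ∀ p q (hp : p + i = q) (hq : p + j = q), x.v p q hp = y.v p q hq) :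
    DirectSum.of (EndDeg K) i x = DirectSum.of (EndDeg K) j y :=
  DirectSum.of_eq_of_gradedMonoid_eq (EndDeg.sigma_ext K h x y hv)

/-- The endomorphism DG-algebra of the complex `K`: its elements of degree `k` are the families of
maps `K^p → K^{p+k}`, the product is the composition, and the differential is
`x ↦ d ∘ x - (-1)^{|x|} x ∘ d`. -/
def endDG : DGAlgebra (EndAlg K) where
  gr := endGr K
  internal := endGr_internal K
  one_mem := ⟨GradedMonoid.GOne.one, rfl⟩
  mul_mem := by
    rintro i j _ _ ⟨x, rfl⟩ ⟨y, rfl⟩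
    exact ⟨GradedMonoid.GMul.mul x y, (DirectSum.of_mul_of x y).symm⟩
  d := endD K
  d_mem := by
    rintro i _ ⟨x, rfl⟩
    exact ⟨_, (endD_of K i x).symm⟩
  d_d x := by
    induction x using DirectSum.induction_on with
    | zero => simp
    | of k x => rw [endD_of, endD_of, δ_δ, map_zero]
    | add x y hx hy => rw [map_add, map_add, hx, hy, add_zero]
  leibniz := by
    rintro i _ y ⟨x, rfl⟩
    change endD K (DirectSum.of (EndDeg K) i x * y) =
      endD K (DirectSum.of (EndDeg K) i x) * y +
        i.negOnePow • (DirectSum.of (EndDeg K) i x * endD K y)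
    induction y using DirectSum.induction_on with
    | zero => simp
    | of j y =>
      rw [DirectSum.of_mul_of, endD_of, endD_of, endD_of, DirectSum.of_mul_of,
        DirectSum.of_mul_of, EndDeg.mul_def, EndDeg.mul_def, EndDeg.mul_def,
        δ_comp y x (add_comm j i) (j + 1) (i + 1) (i + j + 1) rfl rfl rfl, map_add]
      congr 1
      · exact EndAlg.of_eq K (by lia) _ _ fun p q hp hq => by
          rw [Cochain.comp_v _ _ _ p (p + j) q rfl (by lia),
            Cochain.comp_v _ _ _ p (p + j) q rfl (by lia)]
      · rw [Units.smul_def, Units.smul_def, ← map_zsmul]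
        exact EndAlg.of_eq K (by lia) _ _ fun p q hp hq => by
          rw [← Units.smul_def, ← Units.smul_def, Cochain.units_smul_v, Cochain.units_smul_v,
            Cochain.comp_v _ _ _ p (p + j + 1) q (by lia) (by lia),
            Cochain.comp_v _ _ _ p (p + j + 1) q (by lia) (by lia)]
    | add y z hy hz =>
      rw [mul_add, map_add, hy, hz, map_add, mul_add, mul_add, smul_add]
      abel

end EndDG

end

universe u

/-! The functor `i^*` induces a morphism of DG-algebras `φ : End_A(Q) → End_{A_con}(P)`, and the
theorem rests on three facts about it.

(1) The cohomology of `End_A(Q)` is `Ext_A(S, S)`: it vanishes in negative degrees, and in degree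
zero it is `ℂ 1` by Schur's lemma (`unitPosSubmodule_endDG`).

(2) `φ` is injective in cohomology. As `S` is simple and `i^*S ≠ 0`, the submodule `S · AeA` is
zero, so the augmentation `Q_0 → S` factors through `i^*Q_0`. If `i^*z` is a coboundary, then so is
the composite of `z` with the augmentation. Composition with the augmentation is injective in
cohomology because `Q` is a bounded projective resolution, so `z` is itself a coboundary
(`exists_δ_eq_of_map_iStar`).

(3) Every cocycle `z` of degree `k > 0` is the image of a cocycle (`exists_map_iStar_eq`). Lift `z`
degree by degree to a cochain `t`, by projectivity. Then `δ t` has values in the subcomplex `Q ·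
AeA`, and it remains to write `δ t = δ u` with `u` having values there too. The obstructions lie in
the cohomology of `Q · AeA`, which the exactness of `Q` reduces to that of `P` one degree lower.
Since `k > 0`, only degrees of `P` strictly between `1 - n` and `0` matter, and there the cohomology
vanishes.

The rest is A∞-algebra. After a shift, A∞-structures and A∞-morphisms become functions `b`, `f` on
words, with equations `coder σ b b = 0` and `coder σ b f = pull f b'`. Here `coder` is
precomposition with a coderivation of the tensor coalgebra, and `pull` with a coalgebra morphism.
The translation (`coder_shifted_seg`, `pull_shifted_seg`) settles all the signs, and composition of
morphisms becomes formal.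

Minimal models come from a contraction of the DG-algebra onto its cohomology whose homotopy `h`
kills `1`. In the convolution algebra of functions on words, the inclusion of the cohomology is the
solution of `i = L + h((-1)^{|i|} i i)`, and it is a twisting function (`cohDer_inclWord`). For the
morphism in the other direction, a gauge transformation turns the tautological twisting function
into one, `t`, with `h t = 0`. Such a `t` solves the same fixed point equation, so it factors
through `i` (`straight_eq_pull`), and the factor is the projection. The side conditions on `h` make
both morphisms strictly unital.

For arbitrary minimal models, compose: inclusion of the first, then `φ`, then projection to the
second (`Hom.exists_isIso`). This is a strictly unital A∞-morphism with linear component `H(φ)`. Its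
components `f_n` have degree `1 - n`, so they send `n` arguments of positive degree to positive
degree. By (1) the source is `ℂ 1 ⊕ H^{>0}`, so all components have values in `𝒩`, and by (2) and
(3) the linear component is a bijection onto `𝒩`. -/

noncomputable section

/-! ## Functions on words -/

namespace Word

variable {V W U M N : Type*}

/-! ### Deconcatenation of words. -/

section SplitSum

variable [AddCommMonoid M] [AddCommMonoid N]

/-- The sum of `Φ u v` over all the ways to write `w = u ++ v`. -/
def splitSum : (List V → List V → M) → List V → M
  | Φ, [] => Φ [] []
  | Φ, a :: w => Φ [] (a :: w) + splitSum (fun u v => Φ (a :: u) v) w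

@[simp] lemma splitSum_nil (Φ : List V → List V → M) : splitSum Φ [] = Φ [] [] := rfl

lemma splitSum_cons (Φ : List V → List V → M) (a : V) (w : List V) :
    splitSum Φ (a :: w) = Φ [] (a :: w) + splitSum (fun u v => Φ (a :: u) v) w := rfl

lemma splitSum_congr {Φ Ψ : List V → List V → M} {w : List V}
    (h : ∀ u v, u ++ v = w → Φ u v = Ψ u v) : splitSum Φ w = splitSum Ψ w := by
  induction w generalizing Φ Ψ with
  | nil => exact h _ _ rfl
  | cons a w ih =>
    rw [splitSum_cons, splitSum_cons, h [] (a :: w) rfl,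
      ih (fun u v huv => h (a :: u) v (by simp [huv]))]

lemma splitSum_add (Φ Ψ : List V → List V → M) (w : List V) :
    splitSum (fun u v => Φ u v + Ψ u v) w = splitSum Φ w + splitSum Ψ w := by
  induction w generalizing Φ Ψ with
  | nil => rfl
  | cons a w ih => rw [splitSum_cons, splitSum_cons, splitSum_cons, ih, add_add_add_comm]

lemma map_splitSum {F : Type*} [FunLike F M N] [AddMonoidHomClass F M N] (L : F)
    (Φ : List V → List V → M) (w : List V) :
    L (splitSum Φ w) = splitSum (fun u v => L (Φ u v)) w := by
  induction w generalizing Φ with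
  | nil => rfl
  | cons a w ih => rw [splitSum_cons, splitSum_cons, map_add, ih]

@[simp] lemma splitSum_zero (w : List V) : splitSum (fun _ _ => (0 : M)) w = 0 := by
  induction w with
  | nil => rfl
  | cons a w ih => rw [splitSum_cons, ih, add_zero]

lemma splitSum_eq_zero {Φ : List V → List V → M} {w : List V}
    (h : ∀ u v, u ++ v = w → Φ u v = 0) : splitSum Φ w = 0 := by
  rw [splitSum_congr (Ψ := fun _ _ => 0) h, splitSum_zero]

lemma splitSum_eq_left {Φ : List V → List V → M} {w : List V}
    (h : ∀ u v, u ++ v = w → u ≠ [] → Φ u v = 0) : splitSum Φ w = Φ [] w := by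
  cases w with
  | nil => rfl
  | cons a w =>
    rw [splitSum_cons, splitSum_eq_zero, add_zero]
    exact fun u v huv => h _ _ (by simp [huv]) (by simp)

/-- Coassociativity of deconcatenation: both sides run over the factorizations `w = x ++ y ++ z`. -/
lemma splitSum_assoc (Φ : List V → List V → List V → M) (w : List V) :
    splitSum (fun u v => splitSum (fun x y => Φ x y v) u) w =
      splitSum (fun u v => splitSum (fun y z => Φ u y z) v) w := by
  induction w generalizing Φ with
  | nil => rfl
  | cons a w ih =>
    simp only [splitSum_cons, splitSum_nil, splitSum_add]
    rw [ih (fun x y z => Φ (a :: x) y z), add_assoc]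

/-- A bilinear expression supported on pairs whose second entry is a single letter. -/
lemma splitSum_append_singleton {Φ : List V → List V → M} {w : List V} {a : V}
    (h : ∀ u v, u ++ v = w ++ [a] → v.length ≠ 1 → Φ u v = 0) :
    splitSum Φ (w ++ [a]) = Φ w [a] := by
  induction w generalizing Φ with
  | nil =>
    rw [List.nil_append, splitSum_cons, splitSum_nil, h [a] [] rfl (by simp), add_zero]
  | cons b w ih =>
    rw [List.cons_append, splitSum_cons, h [] (b :: (w ++ [a])) rfl (by simp), zero_add,
      ih (fun u v huv hv => h (b :: u) v (by simp [huv]) hv)]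

end SplitSum

/-! ### Precomposition with coderivations. -/

section Coder

variable [AddCommMonoid M] [AddCommMonoid N]

/-- The sum of `φ (σ x ++ [b y] ++ z)` over all the ways to write `w = x ++ y ++ z` with `y ≠ []`,
that is, the composite of `φ` with the coderivation generated by `b`. -/
def coder (σ : V → V) (b : List V → V) : (List V → M) → List V → M
  | _, [] => 0
  | φ, a :: w => coder σ b (fun t => φ (σ a :: t)) w + splitSum (fun u v => φ (b (a :: u) :: v)) w

variable (σ : V → V) (b : List V → V)

@[simp] lemma coder_nil (φ : List V → M) : coder σ b φ [] = 0 := rfl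

lemma coder_cons (φ : List V → M) (a : V) (w : List V) :
    coder σ b φ (a :: w) =
      coder σ b (fun t => φ (σ a :: t)) w + splitSum (fun u v => φ (b (a :: u) :: v)) w := rfl

lemma coder_congr {φ ψ : List V → M} {w : List V}
    (h : ∀ t : List V, t ≠ [] → t.length ≤ w.length → φ t = ψ t) :
    coder σ b φ w = coder σ b ψ w := by
  induction w generalizing φ ψ with
  | nil => rfl
  | cons a w ih =>
    rw [coder_cons, coder_cons, ih (φ := fun t => φ (σ a :: t)) (ψ := fun t => ψ (σ a :: t))]
    · congr 1
      refine splitSum_congr fun u v huv => h _ (by simp) ?_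
      simp [← huv]
    · exact fun t _ ht => h _ (by simp) (by simpa using ht)

lemma coder_add (φ ψ : List V → M) (w : List V) :
    coder σ b (fun t => φ t + ψ t) w = coder σ b φ w + coder σ b ψ w := by
  induction w generalizing φ ψ with
  | nil => simp
  | cons a w ih => rw [coder_cons, coder_cons, coder_cons, ih, splitSum_add, add_add_add_comm]

lemma map_coder {F : Type*} [FunLike F M N] [AddMonoidHomClass F M N] (L : F)
    (φ : List V → M) (w : List V) :
    L (coder σ b φ w) = coder σ b (fun t => L (φ t)) w := by
  induction w generalizing φ with
  | nil => simp
  | cons a w ih => rw [coder_cons, coder_cons, map_add, ih, map_splitSum]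

@[simp] lemma coder_zero (w : List V) : coder σ b (fun _ => (0 : M)) w = 0 := by
  induction w with
  | nil => rfl
  | cons a w ih => rw [coder_cons, ih, splitSum_zero, add_zero]

/-- The composite of a coderivation with the deconcatenation. -/
lemma coder_splitSum (Φ : List V → List V → M) (w : List V) :
    coder σ b (splitSum Φ) w = splitSum (fun u v => coder σ b (fun x => Φ x v) u +
      coder σ b (fun y => Φ (u.map σ) y) v) w := by
  induction w generalizing Φ with
  | nil => simp
  | cons a w ih =>
    simp only [coder_cons, splitSum_cons, coder_nil, coder_add, ih, splitSum_add, zero_add,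
      List.map_nil, List.map_cons]
    rw [← splitSum_assoc (fun x y z => Φ (b (a :: x) :: y) z)]
    abel

end Coder

/-! ### Precomposition with coalgebra morphisms. -/

section Pull

variable [AddCommMonoid M] [AddCommMonoid N]

/-- Auxiliary recursion for `pull`, where `u` is the beginning of the current block. -/
def pullAux (g : List V → W) : (List W → M) → List V → List V → M
  | φ, u, [] => φ [g u]
  | φ, u, a :: w => pullAux g φ (u ++ [a]) w + pullAux g (fun t => φ (g u :: t)) [a] w

/-- The sum of `φ [g w_1, …, g w_k]` over all the ways to write `w = w_1 ++ ⋯ ++ w_k` with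
nonempty `w_i`, that is, the composite of `φ` with the coalgebra morphism generated by `g`. -/
def pull (g : List V → W) (φ : List W → M) : List V → M
  | [] => φ []
  | a :: w => pullAux g φ [a] w

variable (g : List V → W)

@[simp] lemma pull_nil (φ : List W → M) : pull g φ [] = φ [] := rfl

/-- A letter read after the open block `u` either extends it or starts a new block. Summing over the
place where the block closes removes the accumulator. -/
lemma pullAux_eq (φ : List W → M) (u w : List V) :
    pullAux g φ u w = splitSum (fun x y => pull g (fun t => φ (g (u ++ x) :: t)) y) w := by
  induction w generalizing φ u with
  | nil => simp [pullAux]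
  | cons a w ih =>
    rw [pullAux, splitSum_cons, ih (u := u ++ [a]), List.append_nil, add_comm]
    simp [pull]

lemma pull_cons (φ : List W → M) (a : V) (w : List V) :
    pull g φ (a :: w) = splitSum (fun x y => pull g (fun t => φ (g (a :: x) :: t)) y) w := by
  rw [pull, pullAux_eq]; rfl

-- Splitting off a first block may shorten a word by several letters, so recursion along `pull`
-- needs strong induction on the length.
@[elab_as_elim]
lemma length_induction {P : List V → Prop}
    (h : ∀ w : List V, (∀ v : List V, v.length < w.length → P v) → P w) (w : List V) : P w := by
  induction hn : w.length using Nat.strong_induction_on generalizing w with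
  | _ n ih => exact h w fun v hv => ih _ (hn ▸ hv) v rfl

lemma length_le_of_append {u v w : List V} (h : u ++ v = w) : v.length ≤ w.length := by
  simp [← h]

lemma pull_congr {φ ψ : List W → M} {g g' : List V → W} {w : List V}
    (hg : ∀ u : List V, u.length ≤ w.length → g u = g' u)
    (h : ∀ t : List W, t.length ≤ w.length → φ t = ψ t) :
    pull g φ w = pull g' ψ w := by
  induction w using length_induction generalizing φ ψ with
  | h w ih =>
    cases w with
    | nil => exact h _ le_rfl
    | cons a w =>
      rw [pull_cons, pull_cons]
      refine splitSum_congr fun u v huv => ?_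
      have hl : u.length + v.length = w.length := by simp [← huv]
      rw [hg (a :: u) (by simp; omega)]
      refine ih v (by simp; omega) (fun x hx => hg x (by simp; omega))
        fun t ht => h _ (by simp; omega)

lemma pull_add (φ ψ : List W → M) (w : List V) :
    pull g (fun t => φ t + ψ t) w = pull g φ w + pull g ψ w := by
  induction w using length_induction generalizing φ ψ with
  | h w ih =>
    cases w with
    | nil => rfl
    | cons a w =>
      rw [pull_cons, pull_cons, pull_cons, ← splitSum_add]
      refine splitSum_congr fun u v huv => ih _ ?_ _ _
      simpa [Nat.lt_succ_iff] using length_le_of_append huv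

lemma map_pull {F : Type*} [FunLike F M N] [AddMonoidHomClass F M N] (L : F)
    (φ : List W → M) (w : List V) :
    L (pull g φ w) = pull g (fun t => L (φ t)) w := by
  induction w using length_induction generalizing φ with
  | h w ih =>
    cases w with
    | nil => rfl
    | cons a w =>
      rw [pull_cons, pull_cons, map_splitSum]
      refine splitSum_congr fun u v huv => ih _ ?_ _
      simpa [Nat.lt_succ_iff] using length_le_of_append huv

@[simp] lemma pull_zero (w : List V) : pull g (fun _ => (0 : M)) w = 0 := by
  induction w using length_induction with
  | h w ih =>
    cases w with
    | nil => rfl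
    | cons a w =>
      rw [pull_cons]
      refine splitSum_eq_zero fun u v huv => ih _ ?_
      simpa [Nat.lt_succ_iff] using length_le_of_append huv

/-- The composite of a coalgebra morphism with the deconcatenation. -/
lemma pull_splitSum (Φ : List W → List W → M) (w : List V) :
    pull g (splitSum Φ) w =
      splitSum (fun u v => pull g (fun x => pull g (fun y => Φ x y) v) u) w := by
  induction w using length_induction generalizing Φ with
  | h w ih =>
    cases w with
    | nil => rfl
    | cons a w =>
      rw [splitSum_cons, pull_nil, pull_cons, pull_cons]
      simp only [splitSum_cons, pull_add, splitSum_add]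
      congr 1
      rw [splitSum_congr (w := w) (fun u v huv => ih v (by
        simpa [Nat.lt_succ_iff] using length_le_of_append huv)
          (fun x y => Φ (g (a :: u) :: x) y)), ← splitSum_assoc]
      refine splitSum_congr fun u v huv => ?_
      rw [pull_cons]

/-- The composite with `pull` as a sum over the first block, which may be empty if `φ` kills the
words that begin with `g []`. -/
lemma pull_eq_add (φ : List W → M) (hφ : ∀ t, φ (g [] :: t) = 0) (w : List V) :
    pull g φ w = pull g (fun t => if t = [] then φ [] else 0) w +
      splitSum (fun x y => pull g (fun t => φ (g x :: t)) y) w := by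
  cases w with
  | nil => simp [hφ]
  | cons a w =>
    rw [splitSum_cons, pull_cons, pull_cons]
    simp [hφ]

end Pull

end Word

namespace Word

/-! ### Multilinear functions on words -/

section Multilinear

variable {V W U M N : Type*} [AddCommGroup V] [Module ℂ V] [AddCommGroup W] [Module ℂ W]
  [AddCommGroup M] [Module ℂ M] [AddCommGroup N] [Module ℂ N]

/-- `φ (x ++ a :: y)` is linear in the letter `a`. -/
def LinAt (φ : List V → M) (x y : List V) : Prop := IsLinearMap ℂ fun a => φ (x ++ a :: y)

/-- `φ` is linear in each letter. -/
def Multilin (φ : List V → M) : Prop := ∀ x y, LinAt φ x y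

lemma isLinearMap_add {f g : V → M} (hf : IsLinearMap ℂ f) (hg : IsLinearMap ℂ g) :
    IsLinearMap ℂ fun a => f a + g a :=
  (hf.mk' f + hg.mk' g).isLinear

lemma isLinearMap_zero : IsLinearMap ℂ fun _ : V => (0 : M) := (0 : V →ₗ[ℂ] M).isLinear

lemma isLinearMap_comp {g : W → M} {f : V → W} (hg : IsLinearMap ℂ g) (hf : IsLinearMap ℂ f) :
    IsLinearMap ℂ fun a => g (f a) :=
  ((hg.mk' g).comp (hf.mk' f)).isLinear

lemma isLinearMap_splitSum {Ψ : V → List U → List U → M} {w : List U}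
    (h : ∀ u v, u ++ v = w → IsLinearMap ℂ fun a => Ψ a u v) :
    IsLinearMap ℂ fun a => splitSum (Ψ a) w := by
  induction w generalizing Ψ with
  | nil => exact h _ _ rfl
  | cons c w ih =>
    exact isLinearMap_add (h _ _ rfl)
      (ih (Ψ := fun a u v => Ψ a (c :: u) v) fun u v huv => h _ _ (by simp [huv]))

lemma isLinearMap_coder {σ : U → U} {b : List U → U} {Ψ : V → List U → M} {w : List U}
    (h : ∀ t, IsLinearMap ℂ fun a => Ψ a t) : IsLinearMap ℂ fun a => coder σ b (Ψ a) w where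
  map_add x y := by rw [← coder_add]; exact coder_congr _ _ fun t _ _ => (h t).map_add x y
  map_smul c x := by
    refine Eq.trans ?_ (map_coder σ b (DistribSMul.toAddMonoidHom M c) (Ψ x) w).symm
    exact coder_congr _ _ fun t _ _ => (h t).map_smul c x

lemma isLinearMap_pull {X : Type*} {g : List U → X} {Ψ : V → List X → M} {w : List U}
    (h : ∀ t, IsLinearMap ℂ fun a => Ψ a t) : IsLinearMap ℂ fun a => pull g (Ψ a) w where
  map_add x y := by
    rw [← pull_add]; exact pull_congr (fun _ _ => rfl) fun t _ => (h t).map_add x y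
  map_smul c x := by
    refine Eq.trans ?_ (map_pull g (DistribSMul.toAddMonoidHom M c) (Ψ x) w).symm
    exact pull_congr (fun _ _ => rfl) fun t _ => (h t).map_smul c x

lemma Multilin.cons {φ : List V → M} (h : Multilin φ) (c : V) : Multilin fun t => φ (c :: t) :=
  fun x y => h (c :: x) y

lemma Multilin.head {φ : List V → M} (h : Multilin φ) (t : List V) :
    IsLinearMap ℂ fun a => φ (a :: t) := h [] t

lemma Multilin.zero_cons {φ : List V → M} (h : Multilin φ) (t : List V) : φ (0 :: t) = 0 :=
  (h.head t).map_zero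

lemma LinAt.add {φ ψ : List V → M} {x y : List V} (hφ : LinAt φ x y) (hψ : LinAt ψ x y) :
    LinAt (fun t => φ t + ψ t) x y := isLinearMap_add hφ hψ

lemma Multilin.add {φ ψ : List V → M} (hφ : Multilin φ) (hψ : Multilin ψ) :
    Multilin fun t => φ t + ψ t := fun x y => (hφ x y).add (hψ x y)

lemma Multilin.comp {φ : List V → M} (hφ : Multilin φ) (L : M →ₗ[ℂ] N) :
    Multilin fun t => L (φ t) := fun x y => isLinearMap_comp L.isLinear (hφ x y)

lemma Multilin.zero : Multilin fun _ : List V => (0 : M) := fun _ _ => isLinearMap_zero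

lemma Multilin.neg {φ : List V → M} (hφ : Multilin φ) : Multilin fun t => - φ t := by
  simpa using hφ.comp (-LinearMap.id)

lemma Multilin.sub {φ ψ : List V → M} (hφ : Multilin φ) (hψ : Multilin ψ) :
    Multilin fun t => φ t - ψ t := by
  simpa [sub_eq_add_neg] using hφ.add hψ.neg

lemma Multilin.map {φ : List W → M} (hφ : Multilin φ) (L : V →ₗ[ℂ] W) :
    Multilin fun t => φ (t.map L) := fun x y => by
  simpa [LinAt] using isLinearMap_comp (hφ (x.map L) (y.map L)) L.isLinear

lemma linAt_splitSum {Φ : List V → List V → M} {x y : List V}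
    (h₁ : ∀ u v, u ++ v = x → LinAt (Φ u) v y)
    (h₂ : ∀ u v, u ++ v = y → LinAt (fun t => Φ t v) x u) : LinAt (splitSum Φ) x y := by
  induction x generalizing Φ with
  | nil =>
    exact isLinearMap_add (h₁ [] [] rfl) (isLinearMap_splitSum fun u v huv => h₂ u v huv)
  | cons c x ih =>
    exact isLinearMap_add (h₁ [] (c :: x) rfl) (ih (Φ := fun u v => Φ (c :: u) v)
      (fun u v huv => h₁ (c :: u) v (by simp [huv])) fun u v huv => h₂ u v huv)

lemma Multilin.coder {φ : List V → M} {σ : V →ₗ[ℂ] V} {b : List V → V} (hφ : Multilin φ)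
    (hb : Multilin b) : Multilin (coder σ b φ) := by
  intro x
  induction x generalizing φ with
  | nil =>
    intro y
    exact isLinearMap_add
      (isLinearMap_coder fun t =>
        isLinearMap_comp (g := fun a => φ (a :: t)) (hφ.head t) σ.isLinear)
      (isLinearMap_splitSum fun u v _ =>
        isLinearMap_comp (g := fun a => φ (a :: v)) (hφ.head v) (hb.head u))
  | cons c x ih =>
    intro y
    exact isLinearMap_add (ih (hφ.cons (σ c)) y) (linAt_splitSum
      (Φ := fun u v => φ (b (c :: u) :: v)) (fun u v _ => hφ (b (c :: u) :: v) y)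
      fun u v _ => isLinearMap_comp (g := fun a => φ (a :: v)) (hφ.head v) (hb (c :: x) u))

lemma Multilin.pull {φ : List W → M} {g : List V → W} (hφ : Multilin φ)
    (hg : Multilin g) : Multilin (pull g φ) := by
  suffices ∀ (w x y : List V), w.length = x.length + y.length → LinAt (Word.pull g φ) x y from
    fun x y => this (x ++ y) x y (by simp)
  intro w
  induction w using length_induction generalizing φ with
  | h w ih =>
    intro x y hw
    cases x with
    | nil =>
      simp only [LinAt, List.nil_append, pull_cons]
      exact isLinearMap_splitSum fun u v huv =>
        isLinearMap_pull fun t =>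
          isLinearMap_comp (g := fun a => φ (a :: t)) (hφ.head t) (hg.head u)
    | cons c x =>
      simp only [LinAt, List.cons_append, pull_cons]
      refine linAt_splitSum (Φ := fun u v => Word.pull g (fun t => φ (g (c :: u) :: t)) v)
        (fun u v huv => ?_) (fun u v huv => ?_)
      · exact ih (v ++ y) (by simp [hw, ← huv]) (hφ.cons _) v y (by simp)
      · exact isLinearMap_pull fun t =>
          isLinearMap_comp (g := fun a => φ (a :: t)) (hφ.head t) (hg (c :: x) u)

lemma pull_eq_zero_of_ne_nil {X M : Type*} [AddCommMonoid M] {g : List U → X}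
    {φ : List X → M} (hφ : ∀ t, t ≠ [] → φ t = 0)
    {w : List U} (hw : w ≠ []) : Word.pull g φ w = 0 := by
  cases w with
  | nil => exact absurd rfl hw
  | cons a w =>
    rw [pull_cons]
    refine splitSum_eq_zero fun u v _ => ?_
    rw [← pull_zero g v]
    exact pull_congr (fun _ _ => rfl) fun t _ => hφ _ (by simp)

/-- An empty first block contributes `φ (0 :: _) = 0`, so it may be admitted. The sum then runs over
all splittings of the whole word and has the form that `coder_splitSum` and `pull_splitSum` accept.
-/
lemma Multilin.pull_eq {g : List U → W} {φ : List W → M} (hφ : Multilin φ) (hg : g [] = 0)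
    {w : List U} (hw : w ≠ []) :
    Word.pull g φ w = splitSum (fun x y => Word.pull g (fun t => φ (g x :: t)) y) w := by
  rw [pull_eq_add g φ (fun t => by rw [hg, hφ.zero_cons]), pull_eq_zero_of_ne_nil _ hw, zero_add]
  simp +contextual

/-- A morphism that is compatible with the operations is compatible with the coderivations. -/
lemma coder_pull {V : Type*} {g : List V → W} (hg : g [] = 0) {σ : V → V} {σ' : W →ₗ[ℂ] W}
    (hσ : ∀ w, g (w.map σ) = σ' (g w)) {b : List V → V} {b' : List W → W} (hb' : Multilin b')
    (hb0 : b' [] = 0) (h : ∀ w, Word.coder σ b g w = Word.pull g b' w) {φ : List W → M}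
    (hφ : Multilin φ) (w : List V) :
    Word.coder σ b (Word.pull g φ) w = Word.pull g (Word.coder σ' b' φ) w := by
  induction w using length_induction generalizing φ with
  | h w ih =>
    rcases eq_or_ne w [] with rfl | hw
    · simp
    rw [coder_congr σ b (fun t ht _ => hφ.pull_eq hg ht), coder_splitSum,
      (hφ.coder hb').pull_eq hg hw]
    simp only [coder_cons, pull_add, pull_splitSum, splitSum_add]
    rw [← splitSum_assoc (fun x y z => Word.pull g (fun u => Word.pull g
      (fun v => φ (b' (g x :: u) :: v)) z) y), add_comm]
    congr 1
    -- Terms where the coderivation acts beyond the first block `u`: induction on `v`, which is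
    -- shorter than `w` unless `u` is empty.
    · refine splitSum_congr fun u v huv => ?_
      rw [hσ]
      rcases eq_or_ne u [] with rfl | hu
      · have : Word.coder σ' b' (fun _ => (0 : M)) = fun _ => 0 := funext fun _ => by simp
        simp [hg, hφ.zero_cons, this]
      · refine ih v ?_ (hφ.cons _)
        have := List.length_pos_iff.2 hu
        simp [← huv, this]
    -- Terms where it acts inside the first block: by linearity in the first letter they reduce to
    -- the hypothesis on `g`.
    · refine splitSum_congr fun u v huv => ?_
      have hL : IsLinearMap ℂ fun a => Word.pull g (fun t => φ (a :: t)) v :=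
        isLinearMap_pull fun t => hφ.head t
      trans hL.mk' _ (Word.coder σ b g u)
      · rw [map_coder]; rfl
      · rw [h]
        rcases eq_or_ne u [] with rfl | hu
        · simp [hb0, hg, (hb'.zero_cons), hφ.zero_cons]
        rw [hb'.pull_eq hg hu, map_splitSum]
        refine splitSum_congr fun x y _ => ?_
        rw [map_pull]; rfl

/-- The composition of coalgebra morphisms. -/
lemma pull_pull {g : List V → W} (hg : g [] = 0) {g' : List U → V} (hg' : g' [] = 0)
    (hgm : Multilin g) {φ : List W → M} (hφ : Multilin φ) (w : List U) :
    Word.pull g' (Word.pull g φ) w = Word.pull (Word.pull g' g) φ w := by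
  have hg'' : Word.pull g' g [] = 0 := hg
  have hp : ∀ {φ : List W → M}, Multilin φ → ∀ t, Word.pull g φ (g' [] :: t) = 0 := by
    intro φ hφ t
    rw [hg']
    exact (hφ.pull hgm).zero_cons t
  induction w using length_induction generalizing φ with
  | h w ih =>
    rcases eq_or_ne w [] with rfl | hw
    · simp
    rw [hφ.pull_eq hg'' hw]
    -- The correction term of `pull_eq_add` is supported on the empty word, so it disappears because
    -- `w ≠ []`.
    trans Word.pull g' (splitSum fun x y => Word.pull g (fun t => φ (g x :: t)) y) w
    · have : ∀ t, Word.pull g φ t = Word.pull g (fun t => if t = [] then φ [] else 0) t +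
          splitSum (fun x y => Word.pull g (fun t => φ (g x :: t)) y) t :=
        pull_eq_add g φ (fun t => by rw [hg, hφ.zero_cons])
      rw [pull_congr (fun _ _ => rfl) (fun t _ => this t), pull_add,
        pull_eq_zero_of_ne_nil _ hw, zero_add]
      exact fun t ht => pull_eq_zero_of_ne_nil (by simp +contextual) ht
    · rw [pull_splitSum]
      refine splitSum_congr fun u v huv => ?_
      rcases eq_or_ne u [] with rfl | hu
      · simp [hg, hφ.zero_cons]
      rw [pull_congr (fun _ _ => rfl) (fun x _ => ih v (by
        have := List.length_pos_iff.2 hu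
        simp [← huv, this]) (hφ.cons (g x)))]
      have hL : IsLinearMap ℂ fun a => Word.pull (Word.pull g' g) (fun t => φ (a :: t)) v :=
        isLinearMap_pull fun t => hφ.head t
      exact (map_pull g' (hL.mk' _) g u).symm

/-- A multilinear function that vanishes on words with letters in a spanning set is zero. -/
lemma Multilin.eq_zero_of_span {φ : List V → M} (hφ : Multilin φ) {T : Set V}
    (hT : Submodule.span ℂ T = ⊤) (h : ∀ w : List V, (∀ a ∈ w, a ∈ T) → φ w = 0) (w : List V) :
    φ w = 0 := by
  induction w generalizing φ with
  | nil => exact h [] (by simp)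
  | cons a w ih =>
    have key : ⊤ ≤ LinearMap.ker ((hφ.head w).mk' _) := by
      rw [← hT, Submodule.span_le]
      intro c hc
      exact ih (hφ.cons c) fun w hw => h _ (by simpa [hc] using hw)
    exact key (Submodule.mem_top (x := a))

end Multilinear

end Word

namespace Word

/-! ### Gradings on words -/

section Graded

variable {V W U : Type*} [AddCommGroup V] [Module ℂ V] [AddCommGroup W] [Module ℂ W]
  [AddCommGroup U] [Module ℂ U]
  {gr : ℤ → Submodule ℂ V} {gr' : ℤ → Submodule ℂ W} {gr'' : ℤ → Submodule ℂ U}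

lemma map_negOnePow_smul {V W F : Type*} [AddCommGroup V] [AddCommGroup W] [FunLike F V W]
    [AddMonoidHomClass F V W] (L : F) (k : ℤ)
    (a : V) : L (k.negOnePow • a) = k.negOnePow • L a := by
  rw [Units.smul_def, Units.smul_def, map_zsmul]

lemma negOnePow_congr {j k : ℤ} (h : ∃ l, j = k + 2 * l) : j.negOnePow = k.negOnePow := by
  obtain ⟨l, rfl⟩ := h
  rw [Int.negOnePow_add, Int.negOnePow_even _ (even_two_mul l), mul_one]

lemma negOnePow_smul_mem (S : Submodule ℂ V) (k : ℤ) {a : V} (ha : a ∈ S) :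
    k.negOnePow • a ∈ S := by
  rw [Units.smul_def]
  exact S.toAddSubgroup.zsmul_mem ha _

/-- The linear map that agrees with `f k` on the component of degree `k`. -/
def gradedMap (h : DirectSum.IsInternal gr) (f : ℤ → V →ₗ[ℂ] W) : V →ₗ[ℂ] W :=
  (DirectSum.toModule ℂ ℤ W fun k => (f k).comp (gr k).subtype).comp
    (LinearEquiv.ofBijective (DirectSum.coeLinearMap gr) h).symm.toLinearMap

variable (h : DirectSum.IsInternal gr) (h' : DirectSum.IsInternal gr')

lemma gradedMap_of_mem (f : ℤ → V →ₗ[ℂ] W) {k : ℤ} {a : V} (ha : a ∈ gr k) :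
    gradedMap h f a = f k a := by
  have : (LinearEquiv.ofBijective (DirectSum.coeLinearMap gr) h).symm a =
      DirectSum.lof ℂ ℤ (fun k => gr k) k ⟨a, ha⟩ := by
    rw [LinearEquiv.symm_apply_eq]
    exact (DirectSum.coeLinearMap_lof gr k ⟨a, ha⟩).symm
  rw [gradedMap, LinearMap.comp_apply, LinearEquiv.coe_coe, this, DirectSum.toModule_lof]
  rfl

/-- The linear involution that acts on the component of degree `k` by `(-1)^k`. -/
def parity : V →ₗ[ℂ] V := gradedMap h fun k => (k.negOnePow : ℤ) • LinearMap.id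

lemma parity_of_mem {k : ℤ} {a : V} (ha : a ∈ gr k) : parity h a = k.negOnePow • a :=
  gradedMap_of_mem h _ ha

/-- The sign of the Koszul rule for the shifted grading. -/
def susp : V →ₗ[ℂ] V := -parity h

lemma susp_apply (a : V) : susp h a = -parity h a := rfl

lemma parity_mem {k : ℤ} {a : V} (ha : a ∈ gr k) : parity h a ∈ gr k := by
  rw [parity_of_mem h ha]
  exact negOnePow_smul_mem _ _ ha

include h in
/-- Two linear maps agree if they agree on homogeneous elements. -/
lemma linearMap_ext_of_isInternal {f g : V →ₗ[ℂ] W} (hfg : ∀ k, ∀ a ∈ gr k, f a = g a) :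
    f = g := by
  ext a
  have ha : a ∈ ⨆ k, gr k := by rw [h.submodule_iSup_eq_top]; trivial
  induction ha using Submodule.iSup_induction' with
  | mem k a ha => exact hfg k a ha
  | zero => simp
  | add a b _ _ ha hb => simp [ha, hb]

@[simp] lemma parity_parity (a : V) : parity h (parity h a) = a := by
  have : (parity h).comp (parity h) = LinearMap.id := linearMap_ext_of_isInternal h fun k a ha => by
    rw [LinearMap.comp_apply, parity_of_mem h ha, map_negOnePow_smul, parity_of_mem h ha, smul_smul]
    simp
  exact LinearMap.congr_fun this a

lemma pow_parity_of_mem {k : ℤ} {a : V} (ha : a ∈ gr k) (n : ℕ) :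
    (parity h ^ n) a = ((n : ℤ) * k).negOnePow • a := by
  induction n with
  | zero => simp
  | succ n ih =>
    rw [pow_succ', Module.End.mul_apply, ih, map_negOnePow_smul, parity_of_mem h ha, smul_smul,
      ← Int.negOnePow_add]
    congr 2; push_cast; ring

lemma pow_parity_mem {k : ℤ} {a : V} (ha : a ∈ gr k) (n : ℕ) : (parity h ^ n) a ∈ gr k := by
  rw [pow_parity_of_mem h ha]
  exact negOnePow_smul_mem _ _ ha

/-- The letters of the word `w` are homogeneous, of degrees `ds`. -/
abbrev IsHomog (gr : ℤ → Submodule ℂ V) (w : List V) (ds : List ℤ) : Prop :=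
  List.Forall₂ (fun a k => a ∈ gr k) w ds

lemma IsHomog.exists_append {u v : List V} {ds : List ℤ} (hw : IsHomog gr (u ++ v) ds) :
    ∃ d₁ d₂, ds = d₁ ++ d₂ ∧ IsHomog gr u d₁ ∧ IsHomog gr v d₂ := by
  induction u generalizing ds with
  | nil => exact ⟨[], ds, rfl, .nil, hw⟩
  | cons a u ih =>
    cases hw with
    | cons ha hw =>
      obtain ⟨d₁, d₂, rfl, h₁, h₂⟩ := ih hw
      exact ⟨_ :: d₁, d₂, rfl, .cons ha h₁, h₂⟩

lemma IsHomog.append {u v : List V} {d₁ d₂ : List ℤ} (hu : IsHomog gr u d₁)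
    (hv : IsHomog gr v d₂) : IsHomog gr (u ++ v) (d₁ ++ d₂) :=
  List.rel_append hu hv

/-- The total degree of a word in the shifted grading. -/
def shiftSum (ds : List ℤ) : ℤ := (ds.map fun k => k - 1).sum

@[simp] lemma shiftSum_nil : shiftSum [] = 0 := rfl
@[simp] lemma shiftSum_cons (k : ℤ) (ds : List ℤ) : shiftSum (k :: ds) = k - 1 + shiftSum ds := by
  simp [shiftSum]
@[simp] lemma shiftSum_append (d₁ d₂ : List ℤ) :
    shiftSum (d₁ ++ d₂) = shiftSum d₁ + shiftSum d₂ := by simp [shiftSum]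

lemma shiftSum_eq (ds : List ℤ) : shiftSum ds = ds.sum - ds.length := by
  induction ds with
  | nil => rfl
  | cons k ds ih => rw [shiftSum_cons, ih]; simp; ring

/-- `φ` has degree `q` for the shifted grading of words. -/
def HasDeg (gr : ℤ → Submodule ℂ V) (gr' : ℤ → Submodule ℂ W) (q : ℤ) (φ : List V → W) : Prop :=
  ∀ w ds, IsHomog gr w ds → φ w ∈ gr' (shiftSum ds + q)

lemma splitSum_mem {X : Type*} {S : Submodule ℂ W} {Φ : List X → List X → W} {w : List X}
    (hΦ : ∀ u v, u ++ v = w → Φ u v ∈ S) : splitSum Φ w ∈ S := by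
  induction w generalizing Φ with
  | nil => exact hΦ _ _ rfl
  | cons a w ih =>
    exact S.add_mem (hΦ _ _ rfl) (ih fun u v huv => hΦ (a :: u) v (by simp [huv]))

lemma HasDeg.zero (q : ℤ) : HasDeg gr gr' q fun _ => 0 := fun _ _ _ => Submodule.zero_mem _

lemma HasDeg.add {q : ℤ} {φ ψ : List V → W} (hφ : HasDeg gr gr' q φ) (hψ : HasDeg gr gr' q ψ) :
    HasDeg gr gr' q fun t => φ t + ψ t :=
  fun w ds hw => Submodule.add_mem _ (hφ w ds hw) (hψ w ds hw)

lemma HasDeg.neg {q : ℤ} {φ : List V → W} (hφ : HasDeg gr gr' q φ) :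
    HasDeg gr gr' q fun t => - φ t :=
  fun w ds hw => Submodule.neg_mem _ (hφ w ds hw)

lemma HasDeg.sub {q : ℤ} {φ ψ : List V → W} (hφ : HasDeg gr gr' q φ) (hψ : HasDeg gr gr' q ψ) :
    HasDeg gr gr' q fun t => φ t - ψ t :=
  fun w ds hw => Submodule.sub_mem _ (hφ w ds hw) (hψ w ds hw)

lemma HasDeg.comp {q r q' : ℤ} {φ : List V → W} (hφ : HasDeg gr gr' q φ) {L : W → U}
    (hL : ∀ k, ∀ a ∈ gr' k, L a ∈ gr'' (k + r)) (hq : q + r = q') :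
    HasDeg gr gr'' q' fun t => L (φ t) := fun w ds hw => by
  have := hL _ _ (hφ w ds hw)
  rwa [add_assoc, hq] at this

lemma HasDeg.cons {q k q' : ℤ} {φ : List V → W} (hφ : HasDeg gr gr' q φ) {a : V} (ha : a ∈ gr k)
    (hq : q' = q + (k - 1)) : HasDeg gr gr' q' fun t => φ (a :: t) := fun w ds hw => by
  have := hφ (a :: w) (k :: ds) (.cons ha hw)
  convert this using 2
  rw [shiftSum_cons, hq]; ring

/-- `HasDeg` shifts the degrees of the arguments but not those of the values. Operations therefore
have `q = 2` (shifted degree one) and components of morphisms have `q = 1` (shifted degree zero). -/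
lemma HasDeg.coder {q q' : ℤ} {φ : List V → W} (hφ : HasDeg gr gr' q φ) {σ : V → V}
    (hσ : ∀ k, ∀ a ∈ gr k, σ a ∈ gr k) {b : List V → V} (hb : HasDeg gr gr 2 b)
    (hq : q' = q + 1) : HasDeg gr gr' q' (coder σ b φ) := by
  intro w
  induction w generalizing φ q q' with
  | nil => exact fun _ _ => Submodule.zero_mem _
  | cons a w ih =>
    rintro _ (_ | ⟨ha, hw⟩)
    rename_i k ds
    refine Submodule.add_mem _ ?_ (splitSum_mem fun u v huv => ?_)
    · convert ih (hφ.cons (hσ _ _ ha) rfl) rfl ds hw using 2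
      rw [shiftSum_cons, hq]; ring
    · subst huv
      obtain ⟨d₁, d₂, rfl, h₁, h₂⟩ := IsHomog.exists_append hw
      convert hφ _ _ (.cons (hb _ _ (.cons ha h₁)) h₂) using 2
      simp only [shiftSum_cons, shiftSum_append, hq]; ring

lemma HasDeg.pull {q : ℤ} {φ : List W → U} (hφ : HasDeg gr' gr'' q φ) {g : List V → W}
    (hg : HasDeg gr gr' 1 g) : HasDeg gr gr'' q (pull g φ) := by
  intro w
  induction w using length_induction generalizing φ q with
  | h w ih =>
    cases w with
    | nil =>
      rintro _ ⟨⟩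
      exact hφ [] [] .nil
    | cons a w =>
      rintro _ (_ | ⟨ha, hw⟩)
      rename_i k ds
      rw [pull_cons]
      refine splitSum_mem fun u v huv => ?_
      subst huv
      obtain ⟨d₁, d₂, rfl, h₁, h₂⟩ := IsHomog.exists_append hw
      convert ih v (by simp) (hφ.cons (hg _ _ (.cons ha h₁)) rfl) _ h₂ using 2
      simp only [shiftSum_cons, shiftSum_append]; ring

include h in
/-- A multilinear function that vanishes on homogeneous words is zero. -/
lemma Multilin.eq_zero_of_isHomog {φ : List V → W} (hφ : Multilin φ)
    (h0 : ∀ w ds, IsHomog gr w ds → φ w = 0) (w : List V) : φ w = 0 := by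
  refine hφ.eq_zero_of_span (T := ⋃ k, gr k) ?_ (fun w hw => ?_) w
  · rw [Submodule.span_iUnion]; simpa using h.submodule_iSup_eq_top
  · have : ∃ ds, IsHomog gr w ds := by
      induction w with
      | nil => exact ⟨[], .nil⟩
      | cons a w ih =>
        obtain ⟨ds, hds⟩ := ih fun b hb => hw b (by simp [hb])
        obtain ⟨k, hk⟩ := Set.mem_iUnion.1 (hw a (by simp))
        exact ⟨k :: ds, .cons hk hds⟩
    exact h0 w _ this.choose_spec

/-- A letter of degree `k` contributes `(-1)^(k-1)`: this is the Koszul sign for moving an operation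
of odd shifted degree past the word `x`. -/
lemma map_susp_of_isHomog {φ : List V → W} (hφ : Multilin φ) {x : List V} {ds : List ℤ}
    (hx : IsHomog gr x ds) (t : List V) :
    φ (x.map (susp h) ++ t) = (shiftSum ds).negOnePow • φ (x ++ t) := by
  induction hx generalizing φ with
  | nil => simp
  | @cons a k x ds ha hx ih =>
    have hs : susp h a = (k - 1).negOnePow • a := by
      rw [susp_apply, parity_of_mem h ha, Int.negOnePow_sub, Int.negOnePow_one]
      simp
    rw [List.map_cons, hs, List.cons_append, ih (hφ.cons _), shiftSum_cons, add_comm,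
      Int.negOnePow_add, ← smul_smul]
    congr 1
    exact map_negOnePow_smul ((hφ.head _).mk' _) _ a

/-- A multilinear function of degree `q` commutes with the parity involutions up to a sign. -/
lemma HasDeg.map_susp {q : ℤ} {φ : List V → W} (hφ : HasDeg gr gr' q φ)
    (hm : Multilin φ) (w : List V) :
    φ (w.map (susp h)) = q.negOnePow • parity h' (φ w) := by
  rw [← sub_eq_zero]
  refine Multilin.eq_zero_of_isHomog (φ := fun w => φ (w.map (susp h)) -
    q.negOnePow • parity h' (φ w)) h ?_ (fun w ds hw => ?_) w
  · refine (hm.map _).sub ?_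
    exact hm.comp ((q.negOnePow : ℤ) • parity h')
  · have := map_susp_of_isHomog h hm hw []
    rw [List.append_nil, List.append_nil] at this
    rw [this, parity_of_mem h' (hφ w ds hw), smul_smul, ← Int.negOnePow_add, sub_eq_zero]
    congr 1
    exact negOnePow_congr ⟨-q, by ring⟩

end Graded

end Word

namespace Word

/-! ### Families of multilinear maps as functions on words -/

section Translation

variable {X : Type*} {V W U : Type*} [AddCommGroup V] [Module ℂ V] [AddCommGroup W] [Module ℂ W]
  [AddCommGroup U] [Module ℂ U]
  {gr : ℤ → Submodule ℂ V} {gr' : ℤ → Submodule ℂ W}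

/-- The word formed by the first `n` terms of a sequence. -/
def seg (n : ℕ) (a : ℕ → X) : List X := List.ofFn fun i : Fin n => a i

@[simp] lemma seg_zero (a : ℕ → X) : seg 0 a = [] := rfl

lemma seg_succ (n : ℕ) (a : ℕ → X) : seg (n + 1) a = a 0 :: seg n fun i => a (i + 1) := by
  simp [seg, List.ofFn_succ]

@[simp] lemma length_seg (n : ℕ) (a : ℕ → X) : (seg n a).length = n := by simp [seg]

lemma seg_congr {n : ℕ} {a b : ℕ → X} (h : ∀ i < n, a i = b i) : seg n a = seg n b := by
  simp only [seg]
  congr 1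
  ext i
  exact h i i.2

lemma seg_add (m n : ℕ) (a : ℕ → X) : seg (m + n) a = seg m a ++ seg n fun i => a (m + i) := by
  induction m generalizing a with
  | zero => simp
  | succ m ih =>
    rw [Nat.add_right_comm, seg_succ, seg_succ, ih, List.cons_append]
    congr 2
    exact seg_congr fun i _ => by congr 1; omega

lemma seg_getD (w : List X) (x : X) : seg w.length (fun i => w.getD i x) = w := by
  apply List.ext_getElem
  · simp
  · intro i h₁ h₂
    simp [seg]

lemma sum_seg (n : ℕ) (d : ℕ → ℤ) : (seg n d).sum = ∑ i ∈ Finset.range n, d i := by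
  rw [seg, List.sum_ofFn, Finset.sum_range]

lemma isHomog_seg {n : ℕ} {a : ℕ → V} {d : ℕ → ℤ} (h : ∀ i, a i ∈ gr (d i)) :
    IsHomog gr (seg n a) (seg n d) := by
  induction n generalizing a d with
  | zero => exact .nil
  | succ n ih =>
    rw [seg_succ, seg_succ]
    exact .cons (h 0) (ih fun i => h (i + 1))

lemma isHomog_ofFn {n : ℕ} {a : Fin n → V} {d : Fin n → ℤ} (h : ∀ i, a i ∈ gr (d i)) :
    IsHomog gr (List.ofFn a) (List.ofFn d) := by
  rw [IsHomog, List.forall₂_iff_get]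
  simpa using fun i hi => h ⟨i, hi⟩

lemma IsHomog.getD_mem {w : List V} {ds : List ℤ} (hw : IsHomog gr w ds) (i : ℕ) :
    w.getD i 0 ∈ gr (ds.getD i 0) := by
  induction hw generalizing i with
  | nil => simp
  | cons ha _ ih =>
    cases i with
    | zero => simpa using ha
    | succ i => simpa using ih i

/-- The value of a family of maps at a word. -/
def ev (m : ∀ n : ℕ, MultilinearMap ℂ (fun _ : Fin n => V) W) (w : List V) : W :=
  m w.length w.get

lemma ev_eq (m : ∀ n : ℕ, MultilinearMap ℂ (fun _ : Fin n => V) W) (w : List V) {n : ℕ}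
    (h : n = w.length) : ev m w = m n fun i => w.get (i.cast h) := by
  subst h; rfl

lemma LinAt.negOnePow_smul {φ : List V → W} {x y : List V} (hφ : LinAt φ x y) (k : ℤ) (a : V) :
    φ (x ++ k.negOnePow • a :: y) = k.negOnePow • φ (x ++ a :: y) :=
  map_negOnePow_smul (hφ.mk' _) k a

lemma ev_ofFn (m : ∀ n : ℕ, MultilinearMap ℂ (fun _ : Fin n => V) W) {n : ℕ} (a : Fin n → V) :
    ev m (List.ofFn a) = m n a := by
  rw [ev_eq m _ (List.length_ofFn (f := a)).symm]
  congr 1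
  ext i
  simp

lemma ev_seg (m : ∀ n : ℕ, MultilinearMap ℂ (fun _ : Fin n => V) W) (n : ℕ) (a : ℕ → V) :
    ev m (seg n a) = m n fun i => a i := ev_ofFn m _

lemma multilin_ev (m : ∀ n : ℕ, MultilinearMap ℂ (fun _ : Fin n => V) W) : Multilin (ev m) := by
  classical
  intro x y
  have hn : ∀ a : V, x.length + 1 + y.length = (x ++ a :: y).length := fun a => by simp; omega
  let f : Fin (x.length + 1 + y.length) → V := fun i => (x ++ 0 :: y).get (i.cast (hn 0))
  let j : Fin (x.length + 1 + y.length) := ⟨x.length, by omega⟩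
  have key : ∀ a, ev m (x ++ a :: y) = m _ (Function.update f j a) := by
    intro a
    rw [ev_eq m _ (hn a)]
    congr 1
    ext i
    rcases eq_or_ne i j with rfl | hij
    · simp [j]
    · have hij' : (i : ℕ) ≠ x.length := fun h => hij (Fin.ext h)
      simp only [Function.update_of_ne hij, f, List.get_eq_getElem, Fin.val_cast,
        List.getElem_append, List.getElem_cons]
      split_ifs <;> first | rfl | omega
  simp only [LinAt, key]
  exact (m _).toLinearMap f j |>.isLinear

/-- The family of multilinear maps of a multilinear function on words. -/
def ofMultilin (φ : List V → W) (hφ : Multilin φ) (n : ℕ) :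
    MultilinearMap ℂ (fun _ : Fin n => V) W where
  toFun a := φ (List.ofFn a)
  map_update_add' := by
    intro _ a i x y
    have h : ∀ x, List.ofFn (Function.update a i x) =
        (List.ofFn a).take i ++ x :: (List.ofFn a).drop (i + 1) := fun x => by
      rw [← List.set_eq_take_append_cons_drop (a := x) |>.trans (if_pos (by simp))]
      apply List.ext_getElem
      · simp
      · intro k h₁ h₂
        simp [List.getElem_set, Function.update_apply, Fin.ext_iff, eq_comm]
    rw [h, h, h]
    exact (hφ _ _).map_add x y
  map_update_smul' := by
    intro _ a i c x
    have h : ∀ x, List.ofFn (Function.update a i x) =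
        (List.ofFn a).take i ++ x :: (List.ofFn a).drop (i + 1) := fun x => by
      rw [← List.set_eq_take_append_cons_drop (a := x) |>.trans (if_pos (by simp))]
      apply List.ext_getElem
      · simp
      · intro k h₁ h₂
        simp [List.getElem_set, Function.update_apply, Fin.ext_iff, eq_comm]
    rw [h, h]
    exact (hφ _ _).map_smul c x

lemma ofMultilin_apply (φ : List V → W) (hφ : Multilin φ) (n : ℕ) (a : Fin n → V) :
    ofMultilin φ hφ n a = φ (List.ofFn a) := rfl

@[simp] lemma ev_ofMultilin (φ : List V → W) (hφ : Multilin φ) (w : List V) :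
    ev (ofMultilin φ hφ) w = φ w := by
  rw [ev, ofMultilin_apply, List.ofFn_get]

/-! ### The sign twist -/

/-- Apply the `j`-th power of `ε` to the letter followed by `j` letters. -/
def twist (ε : V →ₗ[ℂ] V) : List V → List V
  | [] => []
  | a :: w => (ε ^ w.length) a :: twist ε w

@[simp] lemma twist_nil (ε : V →ₗ[ℂ] V) : twist ε [] = [] := rfl

lemma twist_cons (ε : V →ₗ[ℂ] V) (a : V) (w : List V) :
    twist ε (a :: w) = (ε ^ w.length) a :: twist ε w := rfl

@[simp] lemma length_twist (ε : V →ₗ[ℂ] V) (w : List V) : (twist ε w).length = w.length := by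
  induction w with
  | nil => rfl
  | cons a w ih => simp [twist_cons, ih]

lemma twist_twist {ε : V →ₗ[ℂ] V} (hε : ∀ a, ε (ε a) = a) (w : List V) :
    twist ε (twist ε w) = w := by
  have hε' : ε * ε = 1 := LinearMap.ext hε
  induction w with
  | nil => rfl
  | cons a w ih =>
    rw [twist_cons, twist_cons, ih, length_twist, ← Module.End.mul_apply,
      ← (Commute.refl ε).mul_pow,
      hε', one_pow, Module.End.one_apply]

lemma Multilin.twist {φ : List V → W} (hφ : Multilin φ) (ε : V →ₗ[ℂ] V) :
    Multilin fun w => φ (twist ε w) := by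
  intro x
  induction x generalizing φ with
  | nil =>
    intro y
    exact isLinearMap_comp (g := fun a => φ (a :: Word.twist ε y)) (hφ.head (Word.twist ε y))
      (ε ^ y.length).isLinear
  | cons c x ih =>
    intro y
    simpa [LinAt, twist_cons] using ih (hφ.cons ((ε ^ (x.length + (y.length + 1))) c)) y

variable (h : DirectSum.IsInternal gr) (h' : DirectSum.IsInternal gr')

lemma isHomog_twist {w : List V} {ds : List ℤ} (hw : IsHomog gr w ds) :
    IsHomog gr (twist (parity h) w) ds := by
  induction hw with
  | nil => exact .nil
  | cons ha _ ih => exact .cons (pow_parity_mem h ha _) ih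

/-- The exponent of the sign of `twist` on a homogeneous word. -/
def twistExp : List ℤ → ℤ
  | [] => 0
  | k :: ds => ds.length * k + twistExp ds

@[simp] lemma twistExp_nil : twistExp [] = 0 := rfl

@[simp] lemma twistExp_cons (k : ℤ) (ds : List ℤ) :
    twistExp (k :: ds) = ds.length * k + twistExp ds := rfl

@[simp] lemma twistExp_append (d₁ d₂ : List ℤ) :
    twistExp (d₁ ++ d₂) = twistExp d₁ + d₂.length * d₁.sum + twistExp d₂ := by
  induction d₁ with
  | nil => simp
  | cons k d₁ ih => simp [ih]; ring

lemma map_twist_of_isHomog {φ : List V → W} (hφ : Multilin φ) {w : List V} {ds : List ℤ}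
    (hw : IsHomog gr w ds) : φ (twist (parity h) w) = (twistExp ds).negOnePow • φ w := by
  induction hw generalizing φ with
  | nil => simp
  | @cons a k w ds ha hw ih =>
    rw [twist_cons, ih (hφ.cons _), pow_parity_of_mem h ha, twistExp_cons, hw.length_eq, add_comm,
      Int.negOnePow_add, ← smul_smul]
    congr 1
    exact map_negOnePow_smul ((hφ.head _).mk' _) _ a

/-- The shifted version of a family of multilinear maps, as a function on words. -/
def shifted (m : ∀ n : ℕ, MultilinearMap ℂ (fun _ : Fin n => V) W) (w : List V) : W :=
  ev m (twist (parity h) w)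

lemma multilin_shifted (m : ∀ n : ℕ, MultilinearMap ℂ (fun _ : Fin n => V) W) :
    Multilin (shifted h m) := (multilin_ev m).twist _

lemma shifted_nil {m : ∀ n : ℕ, MultilinearMap ℂ (fun _ : Fin n => V) W} (hm : m 0 = 0) :
    shifted h m [] = 0 := by
  change m 0 _ = 0
  rw [hm]; rfl

lemma shifted_of_isHomog (m : ∀ n : ℕ, MultilinearMap ℂ (fun _ : Fin n => V) W) {w : List V}
    {ds : List ℤ} (hw : IsHomog gr w ds) :
    shifted h m w = (twistExp ds).negOnePow • ev m w :=
  map_twist_of_isHomog h (multilin_ev m) hw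

lemma shifted_singleton (m : ∀ n : ℕ, MultilinearMap ℂ (fun _ : Fin n => V) W) (a : V) :
    shifted h m [a] = m 1 fun _ => a := by
  simp only [shifted, twist_cons, List.length_nil, pow_zero, Module.End.one_apply, twist_nil]
  rw [show [a] = List.ofFn fun _ : Fin 1 => a by simp, ev_ofFn]

lemma hasDeg_shifted {q : ℤ} {m : ∀ n : ℕ, MultilinearMap ℂ (fun _ : Fin n => V) W}
    (hm : ∀ (n : ℕ) (d : Fin n → ℤ) (a : Fin n → V), (∀ i, a i ∈ gr (d i)) →
      m n a ∈ gr' (∑ i, d i + q - n)) : HasDeg gr gr' q (shifted h m) := by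
  intro w ds hw
  rw [shifted_of_isHomog h m hw]
  refine negOnePow_smul_mem _ _ ?_
  obtain ⟨n, hn⟩ : ∃ n, n = w.length := ⟨_, rfl⟩
  have hn' : n = ds.length := hn.trans hw.length_eq
  rw [ev_eq m w hn]
  convert hm n (fun i => ds.get (i.cast hn')) _ fun i => ?_ using 2
  · subst hn'
    rw [shiftSum_eq, ← List.sum_ofFn]
    simp; ring
  · have := hw.getD_mem i
    rwa [List.getD_eq_getElem _ _ (by omega), List.getD_eq_getElem _ _ (by omega)] at this

/-- The family of multilinear maps whose shifted version is `φ`. -/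
def unshifted (φ : List V → W) (hφ : Multilin φ) :
    ∀ n : ℕ, MultilinearMap ℂ (fun _ : Fin n => V) W :=
  ofMultilin (fun w => φ (twist (parity h) w)) (hφ.twist _)

@[simp] lemma shifted_unshifted (φ : List V → W) (hφ : Multilin φ) :
    shifted h (unshifted h φ hφ) = φ := by
  ext w
  rw [shifted, unshifted, ev_ofMultilin, twist_twist (parity_parity h)]

lemma unshifted_apply (φ : List V → W) (hφ : Multilin φ) (n : ℕ) (a : Fin n → V) :
    unshifted h φ hφ n a = φ (twist (parity h) (List.ofFn a)) := rfl

lemma unshifted_mem {q : ℤ} {φ : List V → W} (hφ : Multilin φ) (hd : HasDeg gr gr' q φ) (n : ℕ)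
    (d : Fin n → ℤ) (a : Fin n → V) (ha : ∀ i, a i ∈ gr (d i)) :
    unshifted h φ hφ n a ∈ gr' (∑ i, d i + q - n) := by
  have := hd _ _ (isHomog_twist h (isHomog_ofFn ha))
  rw [unshifted_apply]
  convert this using 2
  rw [shiftSum_eq, List.sum_ofFn, List.length_ofFn]; ring

lemma unshifted_zero {φ : List V → W} (hφ : Multilin φ) (h0 : φ [] = 0) :
    unshifted h φ hφ 0 = 0 := by
  ext a
  simp [unshifted_apply, h0]

/-! ### The operations with an inner operation -/

lemma nest_eq (φ : ∀ n : ℕ, MultilinearMap ℂ (fun _ : Fin n => V) W)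
    (m : ∀ n : ℕ, MultilinearMap ℂ (fun _ : Fin n => V) V) (a : ℕ → V) (r s t : ℕ) :
    nest φ m a r s t =
      ev φ (seg r a ++ ev m (seg s fun j => a (r + j)) :: seg t fun j => a (r + s + j)) := by
  rw [nest, ← ev_seg, ← ev_seg m s fun j => a (r + j), add_assoc, seg_add, add_comm 1 t, seg_succ]
  refine congrArg (ev φ) (congrArg₂ (· ++ ·) (seg_congr fun i hi => by simp [insertBlock, hi])
    (congrArg₂ List.cons (by simp [insertBlock]) (seg_congr fun i _ => ?_)))
  simp only [insertBlock]
  rw [if_neg (by omega), if_neg (by omega)]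
  congr 1; omega

lemma splitSum_seg {M : Type*} [AddCommMonoid M] (Φ : List X → List X → M) (n : ℕ) (a : ℕ → X) :
    splitSum Φ (seg n a) =
      ∑ k ∈ Finset.range (n + 1), Φ (seg k a) (seg (n - k) fun i => a (k + i)) := by
  induction n generalizing Φ a with
  | zero => simp
  | succ n ih =>
    rw [seg_succ, splitSum_cons, ih, Finset.sum_range_succ' _ (n + 1), add_comm]
    congr 1
    · refine Finset.sum_congr rfl fun k _ => ?_
      rw [seg_succ, Nat.add_sub_add_right]
      congr 1
      exact seg_congr fun i _ => by congr 1; omega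
    · simp [seg_succ]

lemma sum_Icc_one {M : Type*} [AddCommMonoid M] (n : ℕ) (f : ℕ → M) :
    ∑ s ∈ Finset.Icc 1 n, f s = ∑ k ∈ Finset.range n, f (k + 1) := by
  rw [Finset.range_eq_Ico, Finset.sum_Ico_add' f 0 n 1]
  rfl

/-- Unrolls the recursion of `coder` into the double sum over `r` and `s` used by `nestSum`. -/
lemma coder_seg {M : Type*} [AddCommMonoid M] (σ : X → X) (b : List X → X) (φ : List X → M)
    (n : ℕ) (a : ℕ → X) :
    coder σ b φ (seg n a) = ∑ r ∈ Finset.range n, ∑ s ∈ Finset.Icc 1 (n - r),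
      φ ((seg r a).map σ ++ b (seg s fun j => a (r + j)) ::
        seg (n - r - s) fun j => a (r + s + j)) := by
  induction n generalizing φ a with
  | zero => simp
  | succ n ih =>
    rw [seg_succ, coder_cons, ih, splitSum_seg]
    conv_rhs => rw [Finset.sum_range_succ']
    congr 1
    · refine Finset.sum_congr rfl fun r _ => ?_
      rw [Nat.add_sub_add_right]
      refine Finset.sum_congr rfl fun s _ => ?_
      rw [seg_succ, List.map_cons, List.cons_append]
      exact congrArg φ (congrArg (List.cons _) (congrArg₂ (· ++ ·) rfl (congrArg₂ List.cons
        (congrArg b (seg_congr fun i _ => congrArg a (by omega)))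
        (seg_congr fun i _ => congrArg a (by omega)))))
    · rw [Nat.sub_zero, sum_Icc_one]
      refine Finset.sum_congr rfl fun k _ => ?_
      simp only [seg_zero, List.map_nil, List.nil_append, zero_add, seg_succ]
      rw [Nat.add_sub_add_right]
      exact congrArg φ (congrArg (List.cons _) (seg_congr fun i _ => congrArg a (by omega)))

/-- Here the signs `(-1)^{r+st}` and the Koszul signs of the unshifted relations are absorbed: after
the twist, only the sign of `susp` on the first `r` letters remains, up to one global sign that does
not depend on `r` and `s`. -/
lemma coder_shifted_seg (φ : ∀ n : ℕ, MultilinearMap ℂ (fun _ : Fin n => V) W)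
    (m : ∀ n : ℕ, MultilinearMap ℂ (fun _ : Fin n => V) V)
    (hm : ∀ (n : ℕ) (d : Fin n → ℤ) (a : Fin n → V), (∀ i, a i ∈ gr (d i)) →
      m n a ∈ gr (∑ i, d i + 2 - n))
    (n : ℕ) (d : ℕ → ℤ) (a : ℕ → V) (ha : ∀ i, a i ∈ gr (d i)) :
    coder (susp h) (shifted h m) (shifted h φ) (seg n a) =
      (twistExp (seg n d)).negOnePow • nestSum φ m n d a := by
  rw [coder_seg, nestSum, Finset.smul_sum]
  refine Finset.sum_congr rfl fun r hr => ?_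
  rw [Finset.smul_sum]
  refine Finset.sum_congr rfl fun s hs => ?_
  rw [Finset.mem_range] at hr
  rw [Finset.mem_Icc] at hs
  obtain ⟨t, rfl⟩ : ∃ t, n = r + s + t := ⟨n - r - s, by omega⟩
  rw [show r + s + t - r - s = t by omega]
  have hx : IsHomog gr (seg r a) (seg r d) := isHomog_seg ha
  have hy : IsHomog gr (seg s fun j => a (r + j)) (seg s fun j => d (r + j)) :=
    isHomog_seg fun i => ha _
  have hz : IsHomog gr (seg t fun j => a (r + s + j)) (seg t fun j => d (r + s + j)) :=
    isHomog_seg fun i => ha _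
  have hby := hasDeg_shifted h hm _ _ hy
  rw [map_susp_of_isHomog h (multilin_shifted h φ) hx,
    shifted_of_isHomog h φ (hx.append (.cons hby hz)), smul_smul, ← Int.negOnePow_add,
    shifted_of_isHomog h m hy, nest_eq, smul_smul, ← Int.negOnePow_add]
  rw [(multilin_ev φ _ _).negOnePow_smul, smul_smul, ← Int.negOnePow_add]
  congr 1
  -- The two exponents are polynomials in `r`, `s`, `t` and the degrees, and they differ by twice
  -- this integer.
  refine negOnePow_congr ⟨t - s * t - r, ?_⟩
  rw [seg_add, seg_add]
  simp only [shiftSum_eq, twistExp_append, twistExp_cons, length_seg, List.length_cons,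
    List.sum_append, ← sum_seg]
  push_cast
  ring

end Translation

end Word

namespace Word

section Compositions

variable {X Y : Type*} {V W : Type*} [AddCommGroup V] [Module ℂ V] [AddCommGroup W] [Module ℂ W]
  {gr : ℤ → Submodule ℂ V} {gr' : ℤ → Submodule ℂ W}

/-! ### Sums over compositions -/

lemma sum_composition_zero {M : Type*} [AddCommMonoid M] (Ψ : List ℕ → M) :
    ∑ c : Composition 0, Ψ c.blocks = Ψ [] := by
  have hc : ∀ c : Composition 0, c.blocks = [] := fun c => by
    by_contra hne
    obtain ⟨b, l, hbl⟩ := List.exists_cons_of_ne_nil hne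
    have hb : 0 < b := c.blocks_pos (by rw [hbl]; simp)
    have := c.blocks_sum
    rw [hbl] at this
    simp at this
    omega
  simp [hc, composition_card]

/-- A composition of `n + 1` is a first block of size `k + 1` with a composition of `n - k`. This
matches the recursion of `pull`. -/
lemma sum_composition_succ {M : Type*} [AddCommMonoid M] (Ψ : List ℕ → M) (n : ℕ) :
    ∑ c : Composition (n + 1), Ψ c.blocks =
      ∑ k ∈ Finset.range (n + 1), ∑ c : Composition (n - k), Ψ ((k + 1) :: c.blocks) := by
  rw [Finset.sum_range, Finset.sum_sigma']
  symm
  refine Finset.sum_bij (fun x _ => ⟨((x.1 : ℕ) + 1) :: x.2.blocks, ?_, ?_⟩) (by simp) ?_ ?_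
    (fun _ _ => rfl)
  · intro i hi
    rcases List.mem_cons.1 hi with rfl | hi
    · omega
    · exact x.2.blocks_pos hi
  · have := x.1.2
    rw [List.sum_cons, x.2.blocks_sum]; omega
  · rintro ⟨k, c⟩ - ⟨k', c'⟩ - heq
    simp only [Composition.mk.injEq, List.cons.injEq, add_left_inj] at heq
    obtain rfl : k = k' := Fin.ext heq.1
    congr 1
    exact Composition.ext heq.2
  · intro c _
    have hs := c.blocks_sum
    obtain ⟨b, l, hbl⟩ : ∃ b l, c.blocks = b :: l := by
      refine List.exists_cons_of_ne_nil fun h0 => ?_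
      rw [h0] at hs; simp at hs
    have hb : 0 < b := c.blocks_pos (by rw [hbl]; simp)
    rw [hbl, List.sum_cons] at hs
    refine ⟨⟨⟨b - 1, by omega⟩, ⟨l, fun {i} hi => c.blocks_pos (by rw [hbl]; simp [hi]), ?_⟩⟩,
      by simp, ?_⟩
    · change l.sum = n - (b - 1)
      omega
    · apply Composition.ext
      change (b - 1 + 1) :: l = c.blocks
      rw [Nat.sub_add_cancel hb, hbl]

/-- The values of `g` at the blocks, with lengths in the list `l`, of a sequence. -/
def blockVals (g : List X → Y) : List ℕ → (ℕ → X) → List Y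
  | [], _ => []
  | k :: l, a => g (seg k a) :: blockVals g l fun i => a (k + i)

lemma blockVals_cons (g : List X → Y) (k : ℕ) (l : List ℕ) (a : ℕ → X) :
    blockVals g (k :: l) a = g (seg k a) :: blockVals g l fun i => a (k + i) := rfl

@[simp] lemma length_blockVals (g : List X → Y) (l : List ℕ) (a : ℕ → X) :
    (blockVals g l a).length = l.length := by
  induction l generalizing a with
  | nil => rfl
  | cons k l ih => simp [blockVals_cons, ih]

lemma getElem_blockVals (g : List X → Y) (l : List ℕ) (a : ℕ → X) (j : ℕ)
    (hj : j < (blockVals g l a).length) :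
    (blockVals g l a)[j] = g (seg (l[j]'(by simpa using hj)) fun i => a ((l.take j).sum + i)) := by
  induction l generalizing a j with
  | nil => simp [blockVals] at hj
  | cons k l ih =>
    cases j with
    | zero => simp [blockVals_cons]
    | succ j =>
      simp only [blockVals_cons, List.getElem_cons_succ, ih]
      simp [add_assoc]

lemma pull_seg {M : Type*} [AddCommMonoid M] (g : List X → Y) (φ : List Y → M) (n : ℕ)
    (a : ℕ → X) : pull g φ (seg n a) = ∑ c : Composition n, φ (blockVals g c.blocks a) := by
  induction n using Nat.strong_induction_on generalizing φ a with
  | _ n ih =>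
    cases n with
    | zero => rw [sum_composition_zero fun l => φ (blockVals g l a)]; rfl
    | succ n =>
      rw [sum_composition_succ fun l => φ (blockVals g l a), seg_succ, pull_cons, splitSum_seg]
      refine Finset.sum_congr rfl fun k _ => ?_
      rw [ih (n - k) (by omega)]
      refine Finset.sum_congr rfl fun c _ => ?_
      rw [blockVals_cons, seg_succ]
      congr 3
      ext i; congr 1; omega

/-! ### Signs of compositions -/

/-- The shifted degrees of blocks, increased by one. -/
def blockDegs : List ℕ → (ℕ → ℤ) → List ℤ
  | [], _ => []
  | k :: l, d => (shiftSum (seg k d) + 1) :: blockDegs l fun i => d (k + i)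

@[simp] lemma length_blockDegs (l : List ℕ) (d : ℕ → ℤ) : (blockDegs l d).length = l.length := by
  induction l generalizing d with
  | nil => rfl
  | cons k l ih => simp [blockDegs, ih]

/-- The sum of the exponents of the signs of `twist` on the blocks. -/
def blockTwists : List ℕ → (ℕ → ℤ) → ℤ
  | [], _ => 0
  | k :: l, d => twistExp (seg k d) + blockTwists l fun i => d (k + i)

/-- The exponent `compSign` for a list of block lengths. -/
def blockSign : List ℕ → (ℕ → ℤ) → ℤ
  | [], _ => 0
  | k :: l, d => l.length * ((k : ℤ) - 1) + (seg k d).sum * ((l.length : ℤ) - l.sum) +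
      blockSign l fun i => d (k + i)

lemma isHomog_blockVals {g : List V → W} (hg : HasDeg gr gr' 1 g) (l : List ℕ) {a : ℕ → V}
    {d : ℕ → ℤ} (ha : ∀ i, a i ∈ gr (d i)) : IsHomog gr' (blockVals g l a) (blockDegs l d) := by
  induction l generalizing a d with
  | nil => exact .nil
  | cons k l ih => exact .cons (hg _ _ (isHomog_seg ha)) (ih fun i => ha _)

/-- The sign identity for A∞-morphisms: the twist on the word of block values, together with the
twists inside the blocks, agrees modulo 2 with the twist on the whole word plus the sign of the
composition. -/
lemma blockSign_eq (l : List ℕ) (d : ℕ → ℤ) :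
    ∃ c, twistExp (blockDegs l d) + blockTwists l d =
      twistExp (seg l.sum d) + blockSign l d + 2 * c := by
  induction l generalizing d with
  | nil => exact ⟨0, rfl⟩
  | cons k l ih =>
    obtain ⟨c, hc⟩ := ih fun i => d (k + i)
    -- The summand `l.length * (1 - k)` is half the discrepancy caused by the first block.
    refine ⟨c + l.length * (1 - k), ?_⟩
    rw [List.sum_cons, seg_add]
    simp only [blockDegs, blockTwists, blockSign, twistExp_cons, twistExp_append, length_blockDegs,
      length_seg, shiftSum_eq]
    push_cast
    linear_combination hc

/-- `compSign` attaches to each block the degrees that precede it, whereas `blockSign` attaches to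
each block the blocks that follow it. Exchanging the order of summation gives the same exponent in
recursive form. -/
lemma compSign_eq {n : ℕ} (c : Composition n) (d : ℕ → ℤ) :
    compSign c d = blockSign c.blocks d := by
  have key : ∀ (l : List ℕ) (d : ℕ → ℤ), ∑ j : Fin l.length,
      (((l.length : ℤ) - (j + 1)) * ((l.get j : ℤ) - 1) +
        (1 - (l.get j : ℤ)) * ∑ i ∈ Finset.range (l.take j).sum, d i) = blockSign l d := by
    intro l
    induction l with
    | nil => intro d; rfl
    | cons k l ih =>
      intro d
      rw [blockSign, ← ih]
      have hl : ∑ j : Fin l.length, (1 - (l.get j : ℤ)) = l.length - l.sum := by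
        rw [Finset.sum_sub_distrib]
        simp [← Nat.cast_sum]
      rw [← hl, Finset.mul_sum, add_assoc, ← Finset.sum_add_distrib]
      have : ((k :: l).length : ℤ) = l.length + 1 := by simp
      rw [this]
      refine (Fin.sum_univ_succ (n := l.length) (fun j : Fin (l.length + 1) =>
        (((l.length : ℤ) + 1 - (j + 1)) * (((k :: l).get j : ℤ) - 1) +
        (1 - ((k :: l).get j : ℤ)) * ∑ i ∈ Finset.range ((k :: l).take j).sum, d i))).trans ?_
      congr 1
      · simp
      · refine Finset.sum_congr rfl fun j _ => ?_
        simp only [Fin.val_succ, List.take_succ_cons, List.sum_cons, Finset.sum_range_add, sum_seg,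
          List.get_cons_succ']
        push_cast
        ring
  rw [← key]
  rfl

lemma compTerm_eq (m : ∀ n : ℕ, MultilinearMap ℂ (fun _ : Fin n => W) W)
    (f : ∀ n : ℕ, MultilinearMap ℂ (fun _ : Fin n => V) W) {n : ℕ} (c : Composition n)
    (a : ℕ → V) : compTerm m f c a = ev m (blockVals (ev f) c.blocks a) := by
  rw [compTerm, ev_eq m _ (n := c.length) (by simp)]
  congr 1
  ext j
  rw [List.get_eq_getElem, getElem_blockVals, ev_seg]
  rfl

variable (h : DirectSum.IsInternal gr) (h' : DirectSum.IsInternal gr')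

lemma map_blockVals_shifted (f : ∀ n : ℕ, MultilinearMap ℂ (fun _ : Fin n => V) W)
    {M : Type*} [AddCommGroup M] [Module ℂ M] {φ : List W → M} (hφ : Multilin φ)
    (l : List ℕ) {a : ℕ → V} {d : ℕ → ℤ} (ha : ∀ i, a i ∈ gr (d i)) :
    φ (blockVals (shifted h f) l a) =
      (blockTwists l d).negOnePow • φ (blockVals (ev f) l a) := by
  induction l generalizing a d φ with
  | nil => simp [blockVals, blockTwists]
  | cons k l ih =>
    rw [blockVals_cons, blockVals_cons, blockTwists, ih (hφ.cons _) (fun i => ha (k + i)),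
      shifted_of_isHomog h f (isHomog_seg ha), add_comm, Int.negOnePow_add, ← smul_smul]
    exact congrArg _ ((hφ [] _).negOnePow_smul _ (ev f (seg k a)))

lemma pull_shifted_seg (m : ∀ n : ℕ, MultilinearMap ℂ (fun _ : Fin n => W) W)
    (f : ∀ n : ℕ, MultilinearMap ℂ (fun _ : Fin n => V) W)
    (hf : HasDeg gr gr' 1 (shifted h f))
    (n : ℕ) (d : ℕ → ℤ) (a : ℕ → V) (ha : ∀ i, a i ∈ gr (d i)) :
    pull (shifted h f) (shifted h' m) (seg n a) =
      (twistExp (seg n d)).negOnePow •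
        ∑ c : Composition n, Int.negOnePow (compSign c d) • compTerm m f c a := by
  rw [pull_seg, Finset.smul_sum]
  refine Finset.sum_congr rfl fun c _ => ?_
  rw [shifted_of_isHomog h' m (isHomog_blockVals hf c.blocks ha),
    map_blockVals_shifted h f (multilin_ev m) c.blocks ha, compTerm_eq, compSign_eq, smul_smul,
    smul_smul, ← Int.negOnePow_add, ← Int.negOnePow_add]
  obtain ⟨e, he⟩ := blockSign_eq c.blocks d
  rw [c.blocks_sum] at he
  rw [negOnePow_congr ⟨e, he⟩]

end Compositions

end Word

/-! ### A∞-algebras and A∞-morphisms in terms of functions on words -/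

section AInfWords

open Word

variable {V W U : Type*} [AddCommGroup V] [Module ℂ V] [AddCommGroup W] [Module ℂ W]
  [AddCommGroup U] [Module ℂ U] {gr : ℤ → Submodule ℂ V} {gr' : ℤ → Submodule ℂ W}
  {gr'' : ℤ → Submodule ℂ U}

namespace AInfAlgebra

variable (X : AInfAlgebra gr)

/-- The shifted operations of an A∞-algebra. -/
def bar : List V → V := shifted X.internal X.m

/-- The sign in the Koszul rule for the shifted grading. -/
def susp : V →ₗ[ℂ] V := Word.susp X.internal

lemma multilin_bar : Multilin X.bar := multilin_shifted _ _

lemma bar_nil : X.bar [] = 0 := shifted_nil _ X.m_zero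

lemma hasDeg_bar : HasDeg gr gr 2 X.bar := hasDeg_shifted _ X.m_mem

lemma susp_mem {k : ℤ} {a : V} (ha : a ∈ gr k) : X.susp a ∈ gr k :=
  Submodule.neg_mem _ (parity_mem _ ha)

/-- By multilinearity homogeneous words suffice, and there this is the A∞-relation up to a global
sign. -/
lemma coder_bar (w : List V) : coder X.susp X.bar X.bar w = 0 := by
  refine (X.multilin_bar.coder X.multilin_bar).eq_zero_of_isHomog X.internal (fun w ds hw => ?_) w
  rcases Nat.eq_zero_or_pos w.length with h0 | hn
  · rw [List.length_eq_zero_iff.1 h0, coder_nil]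
  · have := coder_shifted_seg X.internal X.m X.m X.m_mem w.length (fun i => ds.getD i 0)
      (fun i => w.getD i 0) hw.getD_mem
    rw [seg_getD, X.rel _ hn _ _ hw.getD_mem, smul_zero] at this
    exact this

/-- The A∞-algebra with given shifted operations. -/
def ofBar (h : DirectSum.IsInternal gr) (b : List V → V) (hb : Multilin b) (h0 : b [] = 0)
    (hd : HasDeg gr gr 2 b) (hbb : ∀ w, coder (Word.susp h) b b w = 0) : AInfAlgebra gr where
  internal := h
  m := unshifted h b hb
  m_zero := unshifted_zero h hb h0
  m_mem := unshifted_mem h hb hd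
  rel n hn d a ha := by
    have := coder_shifted_seg h (unshifted h b hb) (unshifted h b hb) (unshifted_mem h hb hd)
      n d a ha
    rw [shifted_unshifted, hbb] at this
    exact (smul_eq_zero_iff_eq _).1 this.symm

lemma bar_ofBar (h : DirectSum.IsInternal gr) (b : List V → V) (hb : Multilin b) (h0 : b [] = 0)
    (hd : HasDeg gr gr 2 b) (hbb : ∀ w, coder (Word.susp h) b b w = 0) :
    (ofBar h b hb h0 hd hbb).bar = b := shifted_unshifted h b hb

end AInfAlgebra

namespace AInfHom

variable {X : AInfAlgebra gr} {Y : AInfAlgebra gr'}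

/-- The shifted components of an A∞-morphism. -/
def bar (F : AInfHom X Y) : List V → W := shifted X.internal F.f

variable (F : AInfHom X Y)

lemma multilin_bar : Multilin F.bar := multilin_shifted _ _

lemma bar_nil : F.bar [] = 0 := shifted_nil _ F.f_zero

lemma hasDeg_bar : HasDeg gr gr' 1 F.bar := hasDeg_shifted _ F.f_mem

lemma bar_singleton (a : V) : F.bar [a] = F.linear a := shifted_singleton _ _ _

lemma coder_bar (w : List V) : coder X.susp X.bar F.bar w = pull F.bar Y.bar w := by
  rw [← sub_eq_zero]
  refine ((F.multilin_bar.coder X.multilin_bar).sub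
    (Y.multilin_bar.pull F.multilin_bar)).eq_zero_of_isHomog X.internal (fun w ds hw => ?_) w
  rcases Nat.eq_zero_or_pos w.length with h0 | hn
  · rw [List.length_eq_zero_iff.1 h0, coder_nil, pull_nil, Y.bar_nil, sub_zero]
  · have h₁ := coder_shifted_seg X.internal F.f X.m X.m_mem w.length (fun i => ds.getD i 0)
      (fun i => w.getD i 0) hw.getD_mem
    have h₂ := pull_shifted_seg X.internal Y.internal Y.m F.f F.hasDeg_bar w.length
      (fun i => ds.getD i 0) (fun i => w.getD i 0) hw.getD_mem
    rw [F.rel _ hn _ _ hw.getD_mem] at h₁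
    rw [← h₁, seg_getD] at h₂
    exact sub_eq_zero.2 h₂.symm

/-- The A∞-morphism with given shifted components. -/
def ofBar (f : List V → W) (hf : Multilin f) (h0 : f [] = 0) (hd : HasDeg gr gr' 1 f)
    (hrel : ∀ w, coder X.susp X.bar f w = pull f Y.bar w) : AInfHom X Y where
  f := unshifted X.internal f hf
  f_zero := unshifted_zero _ hf h0
  f_mem := unshifted_mem _ hf hd
  rel n hn d a ha := by
    have h₁ := coder_shifted_seg X.internal (unshifted X.internal f hf) X.m X.m_mem n d a ha
    have h₂ := pull_shifted_seg X.internal Y.internal Y.m (unshifted X.internal f hf)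
      (by rwa [shifted_unshifted]) n d a ha
    rw [shifted_unshifted] at h₁ h₂
    have := h₁.symm.trans ((hrel _).trans h₂)
    exact smul_left_cancel _ this

lemma bar_ofBar (f : List V → W) (hf : Multilin f) (h0 : f [] = 0) (hd : HasDeg gr gr' 1 f)
    (hrel : ∀ w, coder X.susp X.bar f w = pull f Y.bar w) :
    (ofBar (X := X) (Y := Y) f hf h0 hd hrel).bar = f := shifted_unshifted _ f hf

/-- The degree `1` of `HasDeg` gives a sign `-1`, which is exactly the one in `susp = -parity`. -/
lemma bar_map_susp (w : List V) : F.bar (w.map X.susp) = Y.susp (F.bar w) := by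
  have := F.hasDeg_bar.map_susp X.internal Y.internal F.multilin_bar w
  rw [Int.negOnePow_one, Units.neg_smul, one_smul] at this
  exact this

/-- The composition of A∞-morphisms. -/
def comp {Z : AInfAlgebra gr''} (G : AInfHom Y Z) (F : AInfHom X Y) : AInfHom X Z :=
  ofBar (pull F.bar G.bar) (G.multilin_bar.pull F.multilin_bar) G.bar_nil
    (G.hasDeg_bar.pull F.hasDeg_bar) fun w => by
      rw [coder_pull F.bar_nil F.bar_map_susp Y.multilin_bar Y.bar_nil F.coder_bar G.multilin_bar,
        ← pull_pull G.bar_nil F.bar_nil G.multilin_bar Z.multilin_bar]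
      exact pull_congr (fun _ _ => rfl) fun t _ => G.coder_bar t

lemma bar_comp {Z : AInfAlgebra gr''} (G : AInfHom Y Z) (F : AInfHom X Y) :
    (G.comp F).bar = pull F.bar G.bar := bar_ofBar _ _ _ _ _

end AInfHom

end AInfWords

namespace Word

/-! ### The square of a coderivation -/

section CoderSquare

variable {V M : Type*} [AddCommGroup V] [Module ℂ V] [AddCommGroup M] [Module ℂ M]

/-- An odd coderivation squares to zero as soon as its corestriction does. Terms with nested
insertions vanish by `hbb`; terms with insertions in disjoint places cancel in pairs, because `b`
anticommutes with `σ`. -/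
lemma coder_coder {σ : V →ₗ[ℂ] V} {b : List V → V}
    (hσ : ∀ w, b (w.map σ) = -σ (b w)) (hbb : ∀ w, coder σ b b w = 0) {φ : List V → M}
    (hφ : Multilin φ) (w : List V) : coder σ b (coder σ b φ) w = 0 := by
  induction w generalizing φ with
  | nil => rfl
  | cons a w ih =>
    have h₁ : ∀ u v, coder σ b (fun y => φ (b (σ a :: u.map σ) :: y)) v =
        - coder σ b (fun y => φ (σ (b (a :: u)) :: y)) v := fun u v => by
      have := hσ (a :: u)
      rw [List.map_cons] at this
      rw [this]
      exact (isLinearMap_coder (Ψ := fun c y => φ (c :: y)) fun t => hφ.head t).map_neg _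
    have h₂ : ∀ u v, coder σ b (fun x => φ (b (σ a :: x) :: v)) u +
        splitSum (fun x y => φ (b (b (a :: x) :: y) :: v)) u = 0 := fun u v => by
      have := congrArg ((hφ.head v).mk' _) (hbb (a :: u))
      rwa [coder_cons, map_add, map_coder, map_splitSum, map_zero] at this
    rw [coder_cons]
    simp only [coder_cons, coder_add, coder_splitSum, splitSum_add]
    rw [ih ((hφ.cons _)), zero_add, ← splitSum_assoc (fun x y z => φ (b (b (a :: x) :: y) :: z))]
    -- The nested insertions: `hbb` on each prefix that contains the first letter.
    have h₃ : splitSum (fun u v => coder σ b (fun x => φ (b (σ a :: x) :: v)) u) w +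
        splitSum (fun u v => splitSum (fun x y => φ (b (b (a :: x) :: y) :: v)) u) w = 0 := by
      rw [← splitSum_add]
      exact splitSum_eq_zero fun u v _ => h₂ u v
    -- The disjoint insertions, one of which involves the first letter.
    have h₄ : splitSum (fun u => coder σ b fun y => φ (b (σ a :: u.map σ) :: y)) w =
        - splitSum (fun u => coder σ b fun y => φ (σ (b (a :: u)) :: y)) w :=
      (splitSum_congr fun u v _ => h₁ u v).trans (map_splitSum (-AddMonoidHom.id M) _ w).symm
    rw [h₄, ← h₃]
    abel

end CoderSquare

/-! ### The convolution algebra -/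

/-- Functions on words with values in an algebra. -/
structure Coch (V B : Type*) where
  /-- the underlying function -/
  toFun : List V → B

namespace Coch

variable {V B : Type*}

instance : FunLike (Coch V B) (List V) B where
  coe := toFun
  coe_injective := fun ⟨_⟩ ⟨_⟩ h => congrArg mk h

@[simp] lemma coe_mk (φ : List V → B) : ⇑(mk φ) = φ := rfl

@[ext] lemma ext {φ ψ : Coch V B} (h : ∀ w, φ w = ψ w) : φ = ψ := DFunLike.ext _ _ h

variable [Ring B]

instance : Zero (Coch V B) := ⟨⟨0⟩⟩
instance : Add (Coch V B) := ⟨fun φ ψ => ⟨fun w => φ w + ψ w⟩⟩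
instance : Neg (Coch V B) := ⟨fun φ => ⟨fun w => -φ w⟩⟩
instance : Sub (Coch V B) := ⟨fun φ ψ => ⟨fun w => φ w - ψ w⟩⟩
instance : Mul (Coch V B) := ⟨fun φ ψ => ⟨splitSum fun u v => φ u * ψ v⟩⟩
instance : One (Coch V B) := ⟨⟨fun w => if w = [] then 1 else 0⟩⟩

lemma mul_apply (φ ψ : Coch V B) (w : List V) : (φ * ψ) w = splitSum (fun u v => φ u * ψ v) w := rfl

lemma one_apply (w : List V) : (1 : Coch V B) w = if w = [] then 1 else 0 := rfl

@[simp] lemma add_apply (φ ψ : Coch V B) (w : List V) : (φ + ψ) w = φ w + ψ w := rfl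
@[simp] lemma sub_apply (φ ψ : Coch V B) (w : List V) : (φ - ψ) w = φ w - ψ w := rfl
@[simp] lemma neg_apply (φ : Coch V B) (w : List V) : (-φ) w = -φ w := rfl
@[simp] lemma zero_apply (w : List V) : (0 : Coch V B) w = 0 := rfl

lemma mul_nil (φ ψ : Coch V B) : (φ * ψ) [] = φ [] * ψ [] := rfl

instance : Ring (Coch V B) :=
  { (inferInstance : Zero (Coch V B)), (inferInstance : Add (Coch V B)),
    (inferInstance : Neg (Coch V B)), (inferInstance : Sub (Coch V B)),
    (inferInstance : Mul (Coch V B)), (inferInstance : One (Coch V B)) with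
    add_assoc := fun _ _ _ => ext fun _ => add_assoc _ _ _
    add_comm := fun _ _ => ext fun _ => add_comm _ _
    zero_add := fun _ => ext fun _ => zero_add _
    add_zero := fun _ => ext fun _ => add_zero _
    neg_add_cancel := fun _ => ext fun _ => neg_add_cancel _
    sub_eq_add_neg := fun _ _ => ext fun _ => sub_eq_add_neg _ _
    left_distrib := fun φ ψ χ => by
      ext w
      simp only [mul_apply, add_apply, mul_add, splitSum_add]
    right_distrib := fun φ ψ χ => by
      ext w
      simp only [mul_apply, add_apply, add_mul, splitSum_add]
    zero_mul := fun φ => by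
      ext w
      simp [mul_apply]
    mul_zero := fun φ => by
      ext w
      simp [mul_apply]
    mul_assoc := fun φ ψ χ => by
      ext w
      have h₁ : ∀ u v, (φ * ψ) u * χ v = splitSum (fun x y => φ x * ψ y * χ v) u := fun u v =>
        map_splitSum (AddMonoidHom.mulRight (χ v)) _ u
      have h₂ : ∀ u v, φ u * (ψ * χ) v = splitSum (fun y z => φ u * (ψ y * χ z)) v := fun u v =>
        map_splitSum (AddMonoidHom.mulLeft (φ u)) _ v
      rw [mul_apply, mul_apply]
      simp only [h₁, h₂]
      rw [splitSum_assoc fun x y z => φ x * ψ y * χ z]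
      simp only [mul_assoc]
    one_mul := fun φ => by
      ext w
      rw [mul_apply, splitSum_eq_left]
      · simp [one_apply]
      · intro u v _ hu
        simp [one_apply, hu]
    mul_one := fun φ => by
      ext w
      have : ∀ (w : List V) (φ : Coch V B), (φ * 1) w = φ w := by
        intro w
        induction w with
        | nil => intro φ; simp [mul_apply, one_apply]
        | cons a w ih =>
          intro φ
          have := ih ⟨fun t => φ (a :: t)⟩
          rw [mul_apply] at this ⊢
          rw [splitSum_cons]
          simp only [coe_mk] at this
          rw [this]
          simp [one_apply]
      exact this w φ
    zsmul := zsmulRec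
    nsmul := nsmulRec }

/-- Apply an additive map to the values. -/
def post {C : Type*} [Ring C] (L : B →+ C) : Coch V B →+ Coch V C where
  toFun φ := ⟨fun w => L (φ w)⟩
  map_zero' := by ext w; simp
  map_add' φ ψ := by ext w; simp

@[simp] lemma post_apply {C : Type*} [Ring C] (L : B →+ C) (φ : Coch V B) (w : List V) :
    post L φ w = L (φ w) := rfl

lemma post_mul {L : B →+ B} (hL : ∀ x y, L (x * y) = L x * L y) (φ ψ : Coch V B) :
    post L (φ * ψ) = post L φ * post L ψ := by
  ext w
  rw [post_apply, mul_apply, map_splitSum]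
  simp only [hL]
  rfl

/-- The composition with a coderivation. -/
def der (σ : V → V) (b : List V → V) : Coch V B →+ Coch V B where
  toFun φ := ⟨coder σ b φ⟩
  map_zero' := by ext w; exact coder_zero σ b w
  map_add' φ ψ := by ext w; exact coder_add σ b φ ψ w

lemma der_apply (σ : V → V) (b : List V → V) (φ : Coch V B) (w : List V) :
    der σ b φ w = coder σ b φ w := rfl

lemma der_post {C : Type*} [Ring C] (σ : V → V) (b : List V → V) (L : B →+ C) (φ : Coch V B) :
    der σ b (post L φ) = post L (der σ b φ) := by
  ext w
  exact (map_coder σ b L φ w).symm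

/-- The product is dual to deconcatenation, so the co-Leibniz rule of the coderivation becomes a
Leibniz rule twisted by `σ` on the letters that are passed. -/
lemma der_mul (σ : V → V) (b : List V → V) (φ ψ : Coch V B) :
    der σ b (φ * ψ) = der σ b φ * ψ + ⟨fun w => φ (w.map σ)⟩ * der σ b ψ := by
  ext w
  refine (coder_splitSum σ b _ w).trans ?_
  rw [splitSum_add, add_apply]
  congr 1
  · refine splitSum_congr fun u v _ => ?_
    exact (map_coder σ b (AddMonoidHom.mulRight (ψ v)) φ u).symm
  · refine splitSum_congr fun u v _ => ?_
    exact (map_coder σ b (AddMonoidHom.mulLeft (φ (u.map σ))) ψ v).symm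

/-- Precomposition with a coalgebra morphism is multiplicative for the convolution product. -/
lemma pull_mul {W : Type*} (g : List W → V) (φ ψ : Coch V B) :
    (⟨pull g ⇑(φ * ψ)⟩ : Coch W B) = ⟨pull g φ⟩ * ⟨pull g ψ⟩ := by
  ext w
  refine (pull_splitSum g (fun u v => φ u * ψ v) w).trans
    (splitSum_congr (Ψ := fun u v => pull g φ u * pull g ψ v) fun u v _ => ?_)
  have h₁ : ∀ x, pull g (fun y => φ x * ψ y) v = φ x * pull g ψ v := fun x =>
    (map_pull g (AddMonoidHom.mulLeft (φ x)) ψ v).symm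
  simp only [h₁]
  exact (map_pull g (AddMonoidHom.mulRight (pull g ψ v)) φ u).symm

/-- The function that is `L` on words of length one, and zero on all the others. -/
def letter (L : V → B) : List V → B
  | [a] => L a
  | _ => 0

@[simp] lemma letter_nil (L : V → B) : letter L [] = 0 := rfl
@[simp] lemma letter_singleton (L : V → B) (a : V) : letter L [a] = L a := rfl
@[simp] lemma letter_cons_cons (L : V → B) (a b : V) (w : List V) :
    letter L (a :: b :: w) = 0 := rfl

lemma letter_of_length_ne_one (L : V → B) {w : List V} (hw : w.length ≠ 1) : letter L w = 0 := by
  match w with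
  | [] => rfl
  | [a] => simp at hw
  | _ :: _ :: _ => rfl

/-- A one-letter word results only when the whole word is inserted in `b`. Thus `letter L` recovers
a coderivation from its corestriction. -/
lemma der_letter (σ : V → V) {b : List V → V} {L : V → B} (hb : L (b []) = 0) :
    der σ b ⟨letter L⟩ = ⟨fun w => L (b w)⟩ := by
  ext w
  cases w with
  | nil => exact hb.symm
  | cons a w =>
    rw [der_apply, coe_mk, coe_mk, coder_cons, coder_congr (ψ := fun _ => 0), coder_zero, zero_add]
    · have h : ∀ (w : List V) (Φ : List V → V),
          splitSum (fun u v => letter L (Φ u :: v)) w = L (Φ w) := by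
        intro w
        induction w with
        | nil => intro Φ; rfl
        | cons c w ih =>
          intro Φ
          rw [splitSum_cons, letter_cons_cons, zero_add, ih fun u => Φ (c :: u)]
      exact h w fun u => b (a :: u)
    · intro t ht _
      exact letter_of_length_ne_one _ (by simpa using ht)

lemma pull_letter {W : Type*} {g : List W → V} {L : V → B} (hg : L (g []) = 0) :
    pull g (letter L) = fun w => L (g w) := by
  funext w
  cases w with
  | nil => exact hg.symm
  | cons a w =>
    rw [pull_cons]
    have h : ∀ (w : List W) (Φ : List W → V),
        splitSum (fun u v => pull g (fun t => letter L (Φ u :: t)) v) w = L (Φ w) := by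
      intro w
      induction w with
      | nil => intro Φ; rfl
      | cons c w ih =>
        intro Φ
        rw [splitSum_cons, ih fun u => Φ (c :: u), pull_cons]
        simp
    exact h w fun u => g (a :: u)

/-- When the factors vanish at the empty word, a product only sees strictly shorter words. This is
what allows equations in the convolution algebra to be solved, and shown to have one solution, by
induction on the length. -/
lemma mul_congr {φ φ' ψ ψ' : Coch V B} (hφ : φ [] = 0) (hφ' : φ' [] = 0) (hψ : ψ [] = 0)
    (hψ' : ψ' [] = 0) {w : List V} (h : ∀ u : List V, u.length < w.length → φ u = φ' u)
    (h' : ∀ u : List V, u.length < w.length → ψ u = ψ' u) : (φ * ψ) w = (φ' * ψ') w := by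
  rw [mul_apply, mul_apply]
  refine splitSum_congr fun u v huv => ?_
  rcases eq_or_ne u [] with rfl | hu
  · rw [hφ, hφ', zero_mul, zero_mul]
  rcases eq_or_ne v [] with rfl | hv
  · rw [hψ, hψ', mul_zero, mul_zero]
  have := List.length_pos_iff.2 hu
  have := List.length_pos_iff.2 hv
  rw [h u (by simp [← huv]; omega), h' v (by simp [← huv]; omega)]

variable [AddCommGroup V] [Module ℂ V] [Algebra ℂ B]

lemma multilin_mul {φ ψ : Coch V B} (hφ : Multilin φ) (hψ : Multilin ψ) :
    Multilin ⇑(φ * ψ) := fun x y =>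
  linAt_splitSum (Φ := fun u v => φ u * ψ v)
    (fun u v _ => isLinearMap_comp (LinearMap.mulLeft ℂ (φ u)).isLinear (hψ v y))
    (fun u v _ => isLinearMap_comp (LinearMap.mulRight ℂ (ψ v)).isLinear (hφ x u))

lemma multilin_letter (L : V →ₗ[ℂ] B) : Multilin (letter L) := by
  intro x y
  rcases x with _ | ⟨c, x⟩
  · cases y with
    | nil => exact L.isLinear
    | cons d y => exact isLinearMap_zero
  · have : ∀ a, letter L (c :: x ++ a :: y) = 0 := fun a =>
      letter_of_length_ne_one _ (by simp)
    simp only [LinAt, this]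
    exact isLinearMap_zero

variable {gr : ℤ → Submodule ℂ V}

lemma hasDeg_letter {gr' : ℤ → Submodule ℂ B} {L : V → B} (hL : ∀ k, ∀ a ∈ gr k, L a ∈ gr' k) :
    HasDeg gr gr' 1 (letter L) := by
  rintro _ _ (_ | @⟨a, k, w, ds, ha, _ | _⟩)
  · exact Submodule.zero_mem _
  · simpa using hL _ _ ha
  · exact Submodule.zero_mem _

lemma hasDeg_mul (D : DGAlgebra B) {p q r : ℤ} {φ ψ : Coch V B} (hφ : HasDeg gr D.gr p φ)
    (hψ : HasDeg gr D.gr q ψ) (hr : r = p + q) : HasDeg gr D.gr r ⇑(φ * ψ) := by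
  intro w ds hw
  refine splitSum_mem fun u v huv => ?_
  subst huv
  obtain ⟨d₁, d₂, rfl, h₁, h₂⟩ := IsHomog.exists_append hw
  convert D.mul_mem (hφ _ _ h₁) (hψ _ _ h₂) using 2
  rw [shiftSum_append, hr]; ring

end Coch

/-! ### Recursion on the length of words -/

section Fix

variable {V M : Type*} [Zero M]

/-- The values of `T φ` at words of length at most `n` only depend on the values of `φ` at shorter
words. -/
def Contracting (T : (List V → M) → List V → M) : Prop :=
  ∀ φ ψ : List V → M, ∀ w, (∀ v : List V, v.length < w.length → φ v = ψ v) → T φ w = T ψ w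

/-- The fixed point of a contracting operator. -/
def fix (T : (List V → M) → List V → M) (w : List V) : M := T^[w.length + 1] 0 w

lemma Contracting.iterate_eq {T : (List V → M) → List V → M} (hT : Contracting T) {m n : ℕ}
    {w : List V} (hm : w.length < m) (hn : w.length < n) : T^[m] 0 w = T^[n] 0 w := by
  induction m generalizing n w with
  | zero => omega
  | succ m ih =>
    obtain ⟨n, rfl⟩ : ∃ k, n = k + 1 := ⟨n - 1, by omega⟩
    rw [Function.iterate_succ_apply', Function.iterate_succ_apply']
    exact hT _ _ _ fun v hv => ih (by omega) (by omega)

lemma Contracting.fix_eq {T : (List V → M) → List V → M} (hT : Contracting T) :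
    fix T = T (fix T) := by
  ext w
  rw [fix, Function.iterate_succ_apply']
  exact hT _ _ _ fun v hv => hT.iterate_eq hv (by omega)

end Fix

end Word

namespace DGAlgebra

open Word

variable {B : Type*} [Ring B] [Algebra ℂ B] (D : DGAlgebra B)

/-! ### Contractions of a DG-algebra onto its cohomology -/

/-- A homotopy `h` that satisfies the side conditions, such that `1 + dh + hd` is a projection onto
a complement of the coboundaries in the cocycles. -/
structure Contraction where
  /-- the homotopy -/
  h : B →ₗ[ℂ] B
  h_mem : ∀ {k : ℤ} {x : B}, x ∈ D.gr k → h x ∈ D.gr (k - 1)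
  h_h : ∀ x, h (h x) = 0
  d_h_d : ∀ x, D.d (h (D.d x)) = - D.d x
  h_d_h : ∀ x, h (D.d (h x)) = - h x
  h_one : h 1 = 0

lemma cls_eq_zero_iff {z : B} (hz : D.d z = 0) : D.cls z hz = 0 ↔ ∃ y, D.d y = z :=
  Submodule.Quotient.mk_eq_zero _

lemma cls_eq_cls_iff {z z' : B} (hz : D.d z = 0) (hz' : D.d z' = 0) :
    D.cls z hz = D.cls z' hz' ↔ ∃ y, D.d y = z - z' :=
  Submodule.Quotient.eq _

lemma exists_cls (x : D.Cohomology) : ∃ z, ∃ hz : D.d z = 0, D.cls z hz = x := by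
  obtain ⟨⟨z, hz⟩, rfl⟩ := Submodule.Quotient.mk_surjective _ x
  exact ⟨z, hz, rfl⟩

variable {D} in
-- A linear section of `d` modulo `ℂ 1` is automatically zero on `1`. Working modulo `ℂ 1` loses
-- nothing, since a discrepancy `c • 1` is a coboundary, which forces `c = 0`.
lemma exists_generalized_inverse (h1 : ∀ y, D.d y ≠ 1) :
    ∃ g : B →ₗ[ℂ] B, (∀ x, D.d (g (D.d x)) = D.d x) ∧ g 1 = 0 := by
  let N := Submodule.span ℂ {(1 : B)}
  let f := N.mkQ.comp D.d
  obtain ⟨s, hs⟩ := f.rangeRestrict.exists_rightInverse_of_surjective f.range_rangeRestrict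
  obtain ⟨g, hg⟩ := LinearMap.exists_extend s
  refine ⟨g.comp N.mkQ, fun x => ?_, ?_⟩
  · have h₁ : N.mkQ (D.d (g (N.mkQ (D.d x)))) = N.mkQ (D.d x) := by
      have h₂ := LinearMap.congr_fun hg ⟨f x, LinearMap.mem_range_self f x⟩
      have h₃ := congrArg Subtype.val (LinearMap.congr_fun hs ⟨f x, LinearMap.mem_range_self f x⟩)
      rw [LinearMap.comp_apply, ← h₂] at h₃
      exact h₃
    have h₂ := (Submodule.Quotient.eq N).1 h₁
    obtain ⟨c, hc⟩ := Submodule.mem_span_singleton.1 h₂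
    rcases eq_or_ne c 0 with rfl | hc0
    · rw [zero_smul] at hc
      exact sub_eq_zero.1 hc.symm
    · refine absurd ?_ (h1 (c⁻¹ • (g (N.mkQ (D.d x)) - x)))
      rw [map_smul, map_sub, ← hc, smul_smul, inv_mul_cancel₀ hc0, one_smul]
  · have : N.mkQ 1 = 0 := (Submodule.Quotient.mk_eq_zero N).2 (Submodule.mem_span_singleton_self _)
    rw [LinearMap.comp_apply, this, map_zero]

/-- A generalized inverse `g` of `d` is improved in three moves: take its part of degree `-1`,
replace it by `g d g` so that also `g d g = g`, then correct it so that its square is zero. Each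
move preserves `g 1 = 0`, up to the sign of the last one. -/
lemma exists_contraction (h1 : D.cohOne ≠ 0) : Nonempty D.Contraction := by
  obtain ⟨g₀, hg₀, hg₀1⟩ := exists_generalized_inverse (D := D) fun y hy =>
    h1 ((D.cls_eq_zero_iff D.d_one).2 ⟨y, hy⟩)
  let pr : ℤ → B →ₗ[ℂ] B := fun j =>
    gradedMap D.internal fun k => if k = j then LinearMap.id else 0
  have hpr : ∀ j k, ∀ x ∈ D.gr k, pr j x = if k = j then x else 0 := fun j k x hx => by
    rw [gradedMap_of_mem D.internal _ hx]
    split_ifs <;> rfl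
  have hpr_mem : ∀ j x, pr j x ∈ D.gr j := by
    intro j x
    have : (D.gr j).mkQ.comp (pr j) = 0 := linearMap_ext_of_isInternal D.internal fun k a ha => by
      rw [LinearMap.comp_apply, hpr j k a ha]
      split_ifs with hk
      · subst hk
        exact (Submodule.Quotient.mk_eq_zero _).2 ha
      · simp
    exact (Submodule.Quotient.mk_eq_zero _).1 (LinearMap.congr_fun this x)
  have hpr_d : ∀ j x, D.d (pr j x) = pr (j + 1) (D.d x) := by
    intro j x
    have : D.d.comp (pr j) = (pr (j + 1)).comp D.d :=
      linearMap_ext_of_isInternal D.internal fun k a ha => by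
        rw [LinearMap.comp_apply, LinearMap.comp_apply, hpr j k a ha, hpr _ _ _ (D.d_mem ha)]
        by_cases hk : k = j <;> simp [hk]
    exact LinearMap.congr_fun this x
  let g₁ : B →ₗ[ℂ] B := gradedMap D.internal fun k => (pr (k - 1)).comp g₀
  have hg₁ : ∀ {k x}, x ∈ D.gr k → g₁ x = pr (k - 1) (g₀ x) := fun hx =>
    gradedMap_of_mem D.internal _ hx
  have hg₁_mem : ∀ {k x}, x ∈ D.gr k → g₁ x ∈ D.gr (k - 1) := fun hx => by
    rw [hg₁ hx]; exact hpr_mem _ _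
  have hg₁d : ∀ x, D.d (g₁ (D.d x)) = D.d x := by
    intro x
    have : D.d.comp (g₁.comp D.d) = D.d := linearMap_ext_of_isInternal D.internal fun k a ha => by
      have := D.d_mem ha
      rw [LinearMap.comp_apply, LinearMap.comp_apply, hg₁ this, hpr_d, hg₀, hpr _ _ _ this]
      simp
    exact LinearMap.congr_fun this x
  let g₂ : B →ₗ[ℂ] B := g₁.comp (D.d.comp g₁)
  have hg₂d : ∀ x, D.d (g₂ (D.d x)) = D.d x := fun x => by simp [g₂, hg₁d]
  have hg₂g : ∀ x, g₂ (D.d (g₂ x)) = g₂ x := fun x => by simp [g₂, hg₁d]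
  have hg₂_mem : ∀ {k x}, x ∈ D.gr k → g₂ x ∈ D.gr (k - 1) := fun {k x} hx => by
    have := D.d_mem (hg₁_mem hx)
    rw [sub_add_cancel] at this
    exact hg₁_mem this
  -- With `g d g = g`, the four terms in the square of `g g d - g` are `g³d - g² - g³d + g² = 0`.
  -- The term `g g d` affects neither `d h d` nor `h d h`, because `d d = 0`.
  refine ⟨⟨g₂.comp (g₂.comp D.d) - g₂, fun {k x} hx => ?_, ?_, ?_, ?_, ?_⟩⟩
  · have := hg₂_mem (D.d_mem hx)
    rw [add_sub_cancel_right] at this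
    exact Submodule.sub_mem _ (hg₂_mem this) (hg₂_mem hx)
  · intro x
    simp [hg₂g]
  · intro x
    simp [D.d_d, hg₂d]
  · intro x
    simp [D.d_d, hg₂g]
  · have h₂ : g₂ 1 = 0 := by
      have : g₁ 1 = 0 := by rw [hg₁ D.one_mem, hg₀1, map_zero]
      simp [g₂, this]
    simp [D.d_one, h₂]

namespace Contraction

variable {D} (c : D.Contraction)

/-- The projection `1 + dh + hd`. -/
def proj : B →ₗ[ℂ] B := LinearMap.id + D.d.comp c.h + c.h.comp D.d

lemma proj_apply (x : B) : c.proj x = x + D.d (c.h x) + c.h (D.d x) := rfl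

@[simp] lemma d_proj (x : B) : D.d (c.proj x) = 0 := by simp [proj_apply, D.d_d, c.d_h_d]
@[simp] lemma proj_d (x : B) : c.proj (D.d x) = 0 := by simp [proj_apply, D.d_d, c.d_h_d]
@[simp] lemma h_proj (x : B) : c.h (c.proj x) = 0 := by simp [proj_apply, c.h_h, c.h_d_h]
@[simp] lemma proj_h (x : B) : c.proj (c.h x) = 0 := by simp [proj_apply, c.h_h, c.h_d_h]

@[simp] lemma proj_proj (x : B) : c.proj (c.proj x) = c.proj x := by
  rw [c.proj_apply (c.proj x)]; simp

lemma proj_one : c.proj 1 = 1 := by simp [proj_apply, c.h_one, D.d_one]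

lemma proj_mem {k : ℤ} {x : B} (hx : x ∈ D.gr k) : c.proj x ∈ D.gr k := by
  refine Submodule.add_mem _ (Submodule.add_mem _ hx ?_) ?_
  · have := D.d_mem (c.h_mem hx)
    rwa [sub_add_cancel] at this
  · have := c.h_mem (D.d_mem hx)
    rwa [add_sub_cancel_right] at this

/-- The choice of a representing cocycle. -/
def incl : D.Cohomology →ₗ[ℂ] B :=
  Submodule.liftQ _ (c.proj.comp (LinearMap.ker D.d).subtype) (by
    rintro ⟨_, _⟩ ⟨y, rfl⟩
    exact c.proj_d y)

/-- The projection to the cohomology. -/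
def toCoh : B →ₗ[ℂ] D.Cohomology :=
  (Submodule.mkQ _).comp (c.proj.codRestrict (LinearMap.ker D.d) c.d_proj)

lemma incl_cls {z : B} (hz : D.d z = 0) : c.incl (D.cls z hz) = c.proj z := rfl

lemma toCoh_apply (x : B) : c.toCoh x = D.cls (c.proj x) (c.d_proj x) := rfl

lemma toCoh_of_d_eq_zero {z : B} (hz : D.d z = 0) : c.toCoh z = D.cls z hz := by
  rw [toCoh_apply, cls_eq_cls_iff]
  exact ⟨c.h z, by simp [proj_apply, hz]⟩

@[simp] lemma incl_toCoh (x : B) : c.incl (c.toCoh x) = c.proj x := by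
  rw [toCoh_apply, incl_cls, proj_proj]

@[simp] lemma toCoh_incl (x : D.Cohomology) : c.toCoh (c.incl x) = x := by
  obtain ⟨z, hz, rfl⟩ := D.exists_cls x
  rw [incl_cls, c.toCoh_of_d_eq_zero (c.d_proj z), ← toCoh_apply, c.toCoh_of_d_eq_zero hz]

@[simp] lemma d_incl (x : D.Cohomology) : D.d (c.incl x) = 0 := by
  obtain ⟨z, hz, rfl⟩ := D.exists_cls x
  rw [incl_cls, d_proj]

@[simp] lemma h_incl (x : D.Cohomology) : c.h (c.incl x) = 0 := by
  obtain ⟨z, hz, rfl⟩ := D.exists_cls x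
  rw [incl_cls, h_proj]

@[simp] lemma toCoh_d (x : B) : c.toCoh (D.d x) = 0 := by
  rw [toCoh_apply, cls_eq_zero_iff]; exact ⟨0, by simp⟩

@[simp] lemma toCoh_h (x : B) : c.toCoh (c.h x) = 0 := by
  rw [toCoh_apply, cls_eq_zero_iff]; exact ⟨0, by simp⟩

lemma incl_one : c.incl D.cohOne = 1 := c.proj_one

lemma toCoh_one : c.toCoh 1 = D.cohOne := c.toCoh_of_d_eq_zero D.d_one

lemma toCoh_mem {k : ℤ} {x : B} (hx : x ∈ D.gr k) : c.toCoh x ∈ D.cohGr k :=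
  ⟨⟨c.proj x, c.d_proj x⟩, c.proj_mem hx, rfl⟩

lemma incl_mem {k : ℤ} {x : D.Cohomology} (hx : x ∈ D.cohGr k) : c.incl x ∈ D.gr k := by
  obtain ⟨⟨z, hz⟩, hz', rfl⟩ := hx
  exact c.proj_mem hz'

-- The maps `incl` and `toCoh` are homogeneous and exhibit the cohomology as a graded retract of
-- `B`, so the decomposition of `B` passes to it.
include c in
lemma cohGr_internal : DirectSum.IsInternal D.cohGr := by
  apply DirectSum.isInternal_submodule_of_iSupIndep_of_iSup_eq_top
  · intro k
    rw [Submodule.disjoint_def]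
    intro x hx hx'
    have hk := D.internal.submodule_iSupIndep k
    rw [Submodule.disjoint_def] at hk
    have hle : ⨆ j, ⨆ (_ : j ≠ k), D.cohGr j ≤ (⨆ j, ⨆ (_ : j ≠ k), D.gr j).comap c.incl :=
      iSup_le fun j => iSup_le fun hj y hy =>
        Submodule.mem_iSup_of_mem j (Submodule.mem_iSup_of_mem hj (c.incl_mem hy))
    rw [← c.toCoh_incl x, hk _ (c.incl_mem hx) (hle hx'), map_zero]
  · rw [eq_top_iff]
    intro x _
    rw [← c.toCoh_incl x]
    have hle : (⊤ : Submodule ℂ B) ≤ (⨆ k, D.cohGr k).comap c.toCoh := by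
      rw [← D.internal.submodule_iSup_eq_top]
      exact iSup_le fun k y hy => Submodule.mem_iSup_of_mem k (c.toCoh_mem hy)
    exact hle Submodule.mem_top

end Contraction

end DGAlgebra

namespace DGAlgebra

open Word

variable {B : Type*} [Ring B] [Algebra ℂ B] (D : DGAlgebra B)

/-! ### The sign involution of a DG-algebra -/

/-- The sign involution. -/
def sgn : B →ₗ[ℂ] B := parity D.internal

lemma sgn_of_mem {k : ℤ} {x : B} (hx : x ∈ D.gr k) : D.sgn x = k.negOnePow • x :=
  parity_of_mem _ hx

@[simp] lemma sgn_sgn (x : B) : D.sgn (D.sgn x) = x := parity_parity _ x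

lemma sgn_mem {k : ℤ} {x : B} (hx : x ∈ D.gr k) : D.sgn x ∈ D.gr k := parity_mem _ hx

@[simp] lemma sgn_one : D.sgn 1 = 1 := by rw [D.sgn_of_mem D.one_mem]; simp

lemma sgn_comp {C : Type*} [AddCommGroup C] [Module ℂ C] {gr : ℤ → Submodule ℂ C}
    (hC : DirectSum.IsInternal gr) (L : B →ₗ[ℂ] C) (q : ℤ)
    (hL : ∀ k, ∀ x ∈ D.gr k, L x ∈ gr (k + q)) (x : B) :
    L (D.sgn x) = q.negOnePow • parity hC (L x) := by
  have : L.comp D.sgn = (q.negOnePow : ℤ) • (parity hC).comp L :=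
    linearMap_ext_of_isInternal D.internal fun k a ha => by
      rw [LinearMap.comp_apply, D.sgn_of_mem ha, map_negOnePow_smul]
      change _ = q.negOnePow • parity hC (L a)
      rw [parity_of_mem hC (hL k a ha), smul_smul, ← Int.negOnePow_add]
      congr 1
      exact negOnePow_congr ⟨-q, by ring⟩
  exact LinearMap.congr_fun this x

lemma d_sgn (x : B) : D.d (D.sgn x) = - D.sgn (D.d x) := by
  rw [D.sgn_comp D.internal D.d 1 (fun k x hx => D.d_mem hx)]
  simp [sgn, Int.negOnePow_one]

lemma mul_induction {P : B → Prop} (h0 : P 0) (hadd : ∀ x y, P x → P y → P (x + y))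
    (hmem : ∀ k, ∀ x ∈ D.gr k, P x) (x : B) : P x := by
  have hx : x ∈ ⨆ k, D.gr k := by rw [D.internal.submodule_iSup_eq_top]; trivial
  induction hx using Submodule.iSup_induction' with
  | mem k a ha => exact hmem k a ha
  | zero => exact h0
  | add a b _ _ ha hb => exact hadd a b ha hb

lemma sgn_mul (x y : B) : D.sgn (x * y) = D.sgn x * D.sgn y := by
  induction x using D.mul_induction with
  | h0 => simp
  | hadd x x' hx hx' => simp [add_mul, hx, hx']
  | hmem k x hx =>
    induction y using D.mul_induction with
    | h0 => simp
    | hadd y y' hy hy' => simp [mul_add, hy, hy']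
    | hmem l y hy =>
      rw [D.sgn_of_mem hx, D.sgn_of_mem hy, D.sgn_of_mem (D.mul_mem hx hy), Int.negOnePow_add,
        smul_mul_smul_comm]

lemma d_mul (x y : B) : D.d (x * y) = D.d x * y + D.sgn x * D.d y := by
  induction x using D.mul_induction with
  | h0 => simp
  | hadd x x' hx hx' => simp only [add_mul, map_add, hx, hx']; abel
  | hmem k x hx => rw [D.leibniz y hx, D.sgn_of_mem hx, smul_mul_assoc]

/-! ### The differential on functions on words -/

section Words

variable {V : Type*}

/-- Apply the differential to the values. -/
def dC : Coch V B →+ Coch V B := Coch.post D.d.toAddMonoidHom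

/-- Apply the sign involution to the values. -/
def sC : Coch V B →+ Coch V B := Coch.post D.sgn.toAddMonoidHom

@[simp] lemma dC_apply (φ : Coch V B) (w : List V) : D.dC φ w = D.d (φ w) := rfl
@[simp] lemma sC_apply (φ : Coch V B) (w : List V) : D.sC φ w = D.sgn (φ w) := rfl

@[simp] lemma sC_sC (φ : Coch V B) : D.sC (D.sC φ) = φ := Coch.ext fun w => by simp

lemma dC_dC (φ : Coch V B) : D.dC (D.dC φ) = 0 := Coch.ext fun w => by simp [D.d_d]

lemma dC_sC (φ : Coch V B) : D.dC (D.sC φ) = - D.sC (D.dC φ) := Coch.ext fun w => by simp [d_sgn]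

lemma sC_mul (φ ψ : Coch V B) : D.sC (φ * ψ) = D.sC φ * D.sC ψ := Coch.post_mul D.sgn_mul φ ψ

lemma dC_mul (φ ψ : Coch V B) : D.dC (φ * ψ) = D.dC φ * ψ + D.sC φ * D.dC ψ := by
  ext w
  rw [dC_apply, Coch.mul_apply, map_splitSum, Coch.add_apply, Coch.mul_apply, Coch.mul_apply,
    ← splitSum_add]
  simp only [d_mul]
  rfl

lemma der_dC (σ : V → V) (b : List V → V) (φ : Coch V B) :
    Coch.der σ b (D.dC φ) = D.dC (Coch.der σ b φ) := Coch.der_post _ _ _ _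

lemma der_sC (σ : V → V) (b : List V → V) (φ : Coch V B) :
    Coch.der σ b (D.sC φ) = D.sC (Coch.der σ b φ) := Coch.der_post _ _ _ _

/-- The twisted square `(-1)^{|φ|} φ φ`. -/
def sq (φ : Coch V B) : Coch V B := D.sC φ * φ

lemma sq_def (φ : Coch V B) : D.sq φ = D.sC φ * φ := rfl

variable [AddCommGroup V] [Module ℂ V] {gr : ℤ → Submodule ℂ V}

lemma multilin_sC {φ : Coch V B} (hφ : Multilin φ) : Multilin (D.sC φ) := hφ.comp D.sgn
lemma multilin_dC {φ : Coch V B} (hφ : Multilin φ) : Multilin (D.dC φ) := hφ.comp D.d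

lemma hasDeg_sC {q : ℤ} {φ : Coch V B} (hφ : HasDeg gr D.gr q φ) :
    HasDeg gr D.gr q (D.sC φ) := fun w ds hw => D.sgn_mem (hφ w ds hw)

lemma hasDeg_dC {q r : ℤ} {φ : Coch V B} (hφ : HasDeg gr D.gr q φ) (hr : q + 1 = r) :
    HasDeg gr D.gr r (D.dC φ) :=
  hφ.comp (L := D.d) (fun _ _ h => D.d_mem h) hr

lemma multilin_sq {φ : Coch V B} (hφ : Multilin φ) : Multilin (D.sq φ) :=
  Coch.multilin_mul (D.multilin_sC hφ) hφ

lemma hasDeg_sq {φ : Coch V B} (hφ : HasDeg gr D.gr 1 φ) : HasDeg gr D.gr 2 (D.sq φ) :=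
  Coch.hasDeg_mul D (D.hasDeg_sC hφ) hφ rfl

/-- For a function of degree one, the sign rule. -/
lemma map_susp_of_hasDeg_one (h : DirectSum.IsInternal gr) {φ : Coch V B} (hm : Multilin φ)
    (hφ : HasDeg gr D.gr 1 φ) : (⟨fun w => φ (w.map (susp h))⟩ : Coch V B) = -D.sC φ := by
  ext w
  have := hφ.map_susp h D.internal hm w
  rw [Int.negOnePow_one, Units.neg_smul, one_smul] at this
  exact this

lemma map_susp_of_hasDeg_zero (h : DirectSum.IsInternal gr) {φ : Coch V B} (hm : Multilin φ)
    (hφ : HasDeg gr D.gr 0 φ) : (⟨fun w => φ (w.map (susp h))⟩ : Coch V B) = D.sC φ := by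
  ext w
  have := hφ.map_susp h D.internal hm w
  rw [Int.negOnePow_zero, one_smul] at this
  exact this

end Words

/-- The shifted operations of a DG-algebra. -/
lemma bar_toAInf (w : List B) : D.toAInf.bar w =
    (D.dC ⟨Coch.letter id⟩ + D.sq ⟨Coch.letter id⟩ : Coch B B) w := by
  match w with
  | [] => simp [AInfAlgebra.bar_nil, sq_def, Coch.mul_nil]
  | [a] =>
    simp only [AInfAlgebra.bar, shifted_singleton, sq_def, Coch.add_apply, dC_apply, Coch.mul_apply,
      splitSum_cons, splitSum_nil]
    rw [show D.toAInf.m 1 (fun _ => a) = D.d a from D.m_one _]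
    simp
  | [a, b] =>
    simp only [AInfAlgebra.bar, shifted, twist_cons, sq_def, Coch.add_apply, dC_apply,
      Coch.mul_apply, splitSum_cons, splitSum_nil]
    rw [twist_nil, ev_eq _ _ (n := 2) rfl]
    rw [show ∀ a, D.toAInf.m 2 a = a 0 * a 1 from D.m_two]
    simp [sgn]
  | a :: b :: c :: w =>
    rw [AInfAlgebra.bar, shifted, ev, show D.toAInf.m _ = 0 from
      D.m_of_three_le (by simp [twist_cons])]
    simp only [sq_def, Coch.add_apply, dC_apply, Coch.mul_apply, splitSum_cons]
    rw [splitSum_eq_zero]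
    · simp
    · intro u v _
      simp

namespace Contraction

variable {D} (c : D.Contraction)

/-- Apply the homotopy to the values. -/
def hC {V : Type*} : Coch V B →+ Coch V B := Coch.post c.h.toAddMonoidHom

@[simp] lemma hC_apply {V : Type*} (φ : Coch V B) (w : List V) : c.hC φ w = c.h (φ w) := rfl

lemma sgn_h (x : B) : c.h (D.sgn x) = - D.sgn (c.h x) := by
  rw [D.sgn_comp D.internal c.h (-1) (fun k x hx => c.h_mem hx)]
  simp [sgn, Int.negOnePow_neg, Int.negOnePow_one]

lemma sgn_incl (x : D.Cohomology) :
    c.incl (parity c.cohGr_internal x) = D.sgn (c.incl x) := by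
  have : c.incl.comp (parity c.cohGr_internal) = D.sgn.comp c.incl :=
    linearMap_ext_of_isInternal c.cohGr_internal fun k a ha => by
      rw [LinearMap.comp_apply, LinearMap.comp_apply, parity_of_mem _ ha, map_negOnePow_smul,
        D.sgn_of_mem (c.incl_mem ha)]
  exact LinearMap.congr_fun this x

lemma hasDeg_hC {V : Type*} [AddCommGroup V] [Module ℂ V] {gr : ℤ → Submodule ℂ V} {q r : ℤ}
    {φ : Coch V B} (hφ : HasDeg gr D.gr q φ) (hr : q + -1 = r) : HasDeg gr D.gr r (c.hC φ) :=
  hφ.comp (L := c.h) (fun _ _ h => c.h_mem h) hr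

end Contraction

/-! ### Homotopy transfer -/

namespace Contraction

variable {D} (c : D.Contraction)

section FixedPoint

variable {V : Type*}

/-- The operator whose fixed points are the solutions of `φ = L + h((-1)^{|φ|} φ φ)`. -/
def inclOp (L : V → B) (φ : List V → B) (w : List V) : B :=
  Coch.letter L w + c.h (D.sq ⟨fun w => if w = [] then 0 else φ w⟩ w)

lemma contracting_inclOp (L : V → B) : Contracting (c.inclOp L) := by
  intro φ ψ w h
  rw [inclOp, inclOp, sq_def, sq_def]
  congr 2
  have h' : ∀ u : List V, u.length < w.length →
      (if u = [] then 0 else φ u) = if u = [] then 0 else ψ u := fun u hu => by rw [h u hu]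
  refine Coch.mul_congr ?_ ?_ ?_ ?_ (fun u hu => ?_) (fun u hu => h' u hu)
  iterate 4 simp
  exact congrArg D.sgn (h' u hu)

lemma sq_nil {φ : Coch V B} (h : φ [] = 0) : D.sq φ [] = 0 := by
  rw [sq_def, Coch.mul_nil, h, mul_zero]

/-- The quadratic term at a word only involves shorter words, so the solution is unique. -/
lemma eq_of_fixed {χ φ ψ : Coch V B} (hφ0 : φ [] = 0) (hψ0 : ψ [] = 0)
    (hφ : φ = χ + c.hC (D.sq φ)) (hψ : ψ = χ + c.hC (D.sq ψ)) : φ = ψ := by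
  ext w
  induction w using length_induction with
  | h w ih =>
    rw [hφ, hψ, Coch.add_apply, Coch.add_apply, hC_apply, hC_apply, sq_def, sq_def]
    congr 2
    refine Coch.mul_congr ?_ ?_ hφ0 hψ0 (fun u hu => ?_) ih
    · simp [hφ0]
    · simp [hψ0]
    · exact congrArg D.sgn (ih u hu)

end FixedPoint

/-- The shifted components of the A∞-quasi-isomorphism from the cohomology. -/
def inclWord : Coch D.Cohomology B := ⟨fix (c.inclOp c.incl)⟩

lemma inclWord_nil : c.inclWord [] = 0 := by
  change fix _ _ = 0
  rw [(c.contracting_inclOp _).fix_eq, inclOp, sq_nil rfl]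
  simp

lemma inclWord_eq : c.inclWord = ⟨Coch.letter c.incl⟩ + c.hC (D.sq c.inclWord) := by
  -- The operator ignores the value at the empty word so as to be contracting on all functions. For
  -- the solution this truncation changes nothing.
  have h : (⟨fun w => if w = [] then 0 else c.inclWord w⟩ : Coch D.Cohomology B) = c.inclWord := by
    ext w
    rw [Coch.coe_mk]
    split_ifs with hw
    · rw [hw, inclWord_nil]
    · rfl
  conv_rhs => rw [← h]
  ext w
  exact congrFun (c.contracting_inclOp _).fix_eq w

/-- Linearity in one letter compares words of one fixed length, and on those the fixed point is a
single iterate. -/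
lemma multilin_fix {V M : Type*} [AddCommGroup V] [Module ℂ V] [AddCommGroup M] [Module ℂ M]
    {T : (List V → M) → List V → M} (hT : ∀ φ, Multilin φ → Multilin (T φ)) :
    Multilin (fix T) := by
  have : ∀ n, Multilin (T^[n] 0) := fun n => by
    induction n with
    | zero => exact Multilin.zero
    | succ n ih => rw [Function.iterate_succ_apply']; exact hT _ ih
  intro x y
  simp only [LinAt, fix, List.length_append, List.length_cons]
  exact this _ x y

lemma multilin_ite {V M : Type*} [AddCommGroup V] [Module ℂ V] [AddCommGroup M] [Module ℂ M]
    {φ : List V → M} (hφ : Multilin φ) : Multilin fun w => if w = [] then 0 else φ w := by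
  intro x y
  simpa [LinAt] using hφ x y

lemma hasDeg_ite {V M : Type*} [AddCommGroup V] [Module ℂ V] [AddCommGroup M] [Module ℂ M]
    {gr : ℤ → Submodule ℂ V} {gr' : ℤ → Submodule ℂ M} {q : ℤ}
    {φ : List V → M} (hφ : HasDeg gr gr' q φ) :
    HasDeg gr gr' q fun w => if w = [] then 0 else φ w := by
  intro w ds hw
  dsimp only
  split_ifs
  · exact Submodule.zero_mem _
  · exact hφ w ds hw

lemma multilin_inclWord : Multilin c.inclWord := multilin_fix fun _ hφ =>
  (Coch.multilin_letter c.incl).add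
    ((D.multilin_sq (φ := ⟨_⟩) (multilin_ite hφ)).comp c.h)

lemma hasDeg_inclWord : HasDeg D.cohGr D.gr 1 c.inclWord := by
  have : ∀ n, HasDeg D.cohGr D.gr 1 ((c.inclOp c.incl)^[n] 0) := fun n => by
    induction n with
    | zero => exact HasDeg.zero _
    | succ n ih =>
      rw [Function.iterate_succ_apply']
      exact (Coch.hasDeg_letter fun k a ha => c.incl_mem ha).add
        (c.hasDeg_hC (D.hasDeg_sq (φ := ⟨_⟩) (hasDeg_ite ih)) rfl)
  exact fun w ds hw => this _ w ds hw

/-- The shifted operations on the cohomology. -/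
def cohBar (w : List D.Cohomology) : D.Cohomology := c.toCoh (D.sq c.inclWord w)

lemma cohBar_nil : c.cohBar [] = 0 := by rw [cohBar, sq_nil c.inclWord_nil, map_zero]

lemma multilin_cohBar : Multilin c.cohBar := (D.multilin_sq c.multilin_inclWord).comp c.toCoh

lemma hasDeg_cohBar : HasDeg D.cohGr D.cohGr 2 c.cohBar :=
  (D.hasDeg_sq c.hasDeg_inclWord).comp (r := 0)
    (fun k a ha => by rw [add_zero]; exact c.toCoh_mem ha) rfl

/-- The coderivation given by the operations on the cohomology. -/
def cohDer : Coch D.Cohomology B →+ Coch D.Cohomology B :=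
  Coch.der (susp c.cohGr_internal) c.cohBar

/-- For functions of degree one the twist by `susp` is `-sC`, and it cancels the involution already
present. -/
lemma cohDer_mul {φ : Coch D.Cohomology B} (hm : Multilin φ) (hd : HasDeg D.cohGr D.gr 1 φ)
    (ψ : Coch D.Cohomology B) :
    c.cohDer (D.sC φ * ψ) = D.sC (c.cohDer φ) * ψ - φ * c.cohDer ψ := by
  have h := D.map_susp_of_hasDeg_one c.cohGr_internal (D.multilin_sC hm) (D.hasDeg_sC hd)
  have := Coch.der_mul (susp c.cohGr_internal) c.cohBar (D.sC φ) ψ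
  rw [h, sC_sC, der_sC] at this
  rw [cohDer, this, neg_mul, sub_eq_add_neg]

lemma hC_dC {V : Type*} (φ : Coch V B) (w : List V) :
    c.proj (φ w) = φ w + D.dC (c.hC φ) w + c.hC (D.dC φ) w := rfl

/-- The equation of an A∞-morphism from the cohomology to the DG-algebra. -/
lemma cohDer_inclWord : c.cohDer c.inclWord = D.dC c.inclWord + D.sq c.inclWord := by
  set i := c.inclWord with hi
  set q := D.sq i with hq
  have hi' : i = ⟨Coch.letter c.incl⟩ + c.hC q := c.inclWord_eq
  have hd1 : D.dC (⟨Coch.letter c.incl⟩ : Coch D.Cohomology B) = 0 := by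
    ext w
    match w with
    | [] => simp
    | [a] => simp
    | _ :: _ :: _ => simp
  have hD1 : c.cohDer ⟨Coch.letter c.incl⟩ = q + D.dC (c.hC q) + c.hC (D.dC q) := by
    rw [cohDer, Coch.der_letter _ (L := c.incl) (by rw [cohBar_nil, map_zero])]
    ext w
    exact c.incl_toCoh (q w)
  set x := D.dC i + q - c.cohDer i with hx
  -- The defect `x` of the twisting equation lies in the image of `h`: the part coming from `incl ∘
  -- toCoh = 1 + dh + hd` cancels `q` and `d h q`.
  have h₁ : x = -c.hC (D.dC q + c.cohDer q) := by
    have hdi : D.dC i = D.dC (c.hC q) := by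
      conv_lhs => rw [hi']
      rw [map_add, hd1, zero_add]
    have hDi : c.cohDer i = q + D.dC (c.hC q) + c.hC (D.dC q) + c.hC (c.cohDer q) := by
      conv_lhs => rw [hi']
      rw [map_add, hD1]
      congr 1
      exact Coch.der_post _ _ _ _
    rw [hx, hdi, hDi, map_add]
    abel
  -- A Bianchi identity: the two sides differ by cubic terms in `i` that cancel by associativity.
  have h₂ : D.dC q + c.cohDer q = -(D.sC x * i) + i * x := by
    rw [hq, sq_def, dC_mul, c.cohDer_mul c.multilin_inclWord c.hasDeg_inclWord, dC_sC, sC_sC, hx,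
      map_sub, map_add, hq, sq_def, sC_mul, sC_sC]
    noncomm_ring
  have h0 : x [] = 0 := by
    have := c.inclWord_nil
    rw [hx, Coch.sub_apply, Coch.add_apply, dC_apply, hq, sq_nil this, this]
    simp [cohDer, Coch.der_apply]
  -- Hence `x` at a word is a linear expression in its values at shorter words, and it vanishes by
  -- induction.
  have hx0 : x = 0 := by
    ext w
    induction w using length_induction with
    | h w ih =>
      have hi0 := c.inclWord_nil
      have e₁ : (D.sC x * i) w = ((0 : Coch D.Cohomology B) * i) w :=
        Coch.mul_congr (by simp [h0]) rfl hi0 hi0 (fun u hu => by simp [ih u hu]) fun _ _ => rfl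
      have e₂ : (i * x) w = (i * (0 : Coch D.Cohomology B)) w :=
        Coch.mul_congr hi0 hi0 h0 rfl (fun _ _ => rfl) fun u hu => ih u hu
      rw [h₁, h₂, Coch.neg_apply, hC_apply, Coch.add_apply, Coch.neg_apply, e₁, e₂]
      simp
  exact (sub_eq_zero.1 hx0).symm

/-- By the twisting equation of `inclWord`, the coderivation sends `sq inclWord` to minus its
differential, and a coboundary has class zero. -/
lemma coder_cohBar (w : List D.Cohomology) :
    coder (susp c.cohGr_internal) c.cohBar c.cohBar w = 0 := by
  have h₁ : D.dC (D.sq c.inclWord) + c.cohDer (D.sq c.inclWord) = 0 := by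
    rw [sq_def, dC_mul, c.cohDer_mul c.multilin_inclWord c.hasDeg_inclWord, dC_sC, sC_sC,
      c.cohDer_inclWord, map_add, sq_def, sC_mul, sC_sC]
    noncomm_ring
  have h₂ : c.toCoh (c.cohDer (D.sq c.inclWord) w) =
      coder (susp c.cohGr_internal) c.cohBar c.cohBar w :=
    map_coder _ _ c.toCoh _ w
  rw [← h₂, eq_neg_of_add_eq_zero_right h₁, Coch.neg_apply, map_neg, dC_apply, toCoh_d, neg_zero]

/-- The transferred A∞-structure on the cohomology. -/
def cohAlg : AInfAlgebra D.cohGr :=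
  AInfAlgebra.ofBar c.cohGr_internal c.cohBar c.multilin_cohBar c.cohBar_nil c.hasDeg_cohBar
    c.coder_cohBar

lemma bar_cohAlg : c.cohAlg.bar = c.cohBar := AInfAlgebra.bar_ofBar _ _ _ _ _ _

/-- Only compositions with one or two blocks survive, giving `d g` and the twisted square. The
A∞-morphisms to a DG-algebra are therefore the twisting functions of degree one that vanish at the
empty word. -/
lemma pull_bar_toAInf {V : Type*} {g : List V → B} (hg : g [] = 0) :
    pull g D.toAInf.bar = (D.dC ⟨g⟩ + D.sq ⟨g⟩ : Coch V B) := by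
  have h₁ : D.toAInf.bar = (D.dC ⟨Coch.letter id⟩ + D.sq ⟨Coch.letter id⟩ : Coch B B) :=
    funext D.bar_toAInf
  have h₂ : pull g (Coch.letter (id : B → B)) = g := Coch.pull_letter (L := (id : B → B)) hg
  have h₃ := Coch.pull_mul g (D.sC ⟨Coch.letter id⟩) ⟨Coch.letter id⟩
  have h₄ : pull g (D.sC ⟨Coch.letter id⟩ : Coch B B) = D.sC (⟨g⟩ : Coch V B) := by
    funext w
    conv_rhs => rw [← h₂]
    exact (map_pull g D.sgn _ w).symm
  have h₅ : pull g (D.dC ⟨Coch.letter id⟩ : Coch B B) = D.dC (⟨g⟩ : Coch V B) := by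
    funext w
    conv_rhs => rw [← h₂]
    exact (map_pull g D.d _ w).symm
  funext w
  rw [h₁]
  refine (pull_add g _ _ w).trans ?_
  rw [h₅, Coch.add_apply]
  congr 1
  simp only [Coch.coe_mk, h₂, h₄] at h₃
  exact DFunLike.congr_fun h₃ w

/-- The A∞-quasi-isomorphism from the cohomology to the DG-algebra. -/
def cohIncl : AInfHom c.cohAlg D.toAInf :=
  AInfHom.ofBar c.inclWord c.multilin_inclWord c.inclWord_nil c.hasDeg_inclWord fun w => by
    rw [bar_cohAlg, pull_bar_toAInf c.inclWord_nil]
    exact DFunLike.congr_fun c.cohDer_inclWord w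

lemma bar_cohIncl : c.cohIncl.bar = c.inclWord := AInfHom.bar_ofBar _ _ _ _ _

end Contraction

end DGAlgebra

namespace DGAlgebra

open Word

variable {B : Type*} [Ring B] [Algebra ℂ B] (D : DGAlgebra B)

/-! ### The A∞-quasi-isomorphism to the cohomology -/

/-- The tautological function on words. -/
def taut (_D : DGAlgebra B) : Coch B B := ⟨Coch.letter id⟩

@[simp] lemma taut_nil : D.taut [] = 0 := rfl

/-- The coderivation given by the operations of a DG-algebra. -/
def barDer : Coch B B →+ Coch B B := Coch.der (susp D.internal) D.toAInf.bar

lemma barDer_apply (φ : Coch B B) (w : List B) :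
    D.barDer φ w = coder (susp D.internal) D.toAInf.bar φ w := rfl

/-- The tautological function is the twisting function of the identity of `B`. -/
lemma barDer_taut : D.barDer D.taut = D.dC D.taut + D.sq D.taut := by
  rw [barDer, taut, Coch.der_letter _ (b := D.toAInf.bar) (L := id) D.toAInf.bar_nil]
  ext w
  exact D.bar_toAInf w

lemma barDer_barDer {φ : Coch B B} (hφ : Multilin φ) : D.barDer (D.barDer φ) = 0 := by
  ext w
  refine coder_coder (σ := susp D.internal) (fun w => ?_) D.toAInf.coder_bar hφ w
  have := D.toAInf.hasDeg_bar.map_susp D.internal D.internal D.toAInf.multilin_bar w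
  rw [this, susp_apply, neg_neg]
  simp [Int.negOnePow_even 2 even_two]

lemma multilin_taut : Multilin D.taut := Coch.multilin_letter (LinearMap.id : B →ₗ[ℂ] B)

lemma hasDeg_taut : HasDeg D.gr D.gr 1 D.taut := Coch.hasDeg_letter fun _ _ h => h

lemma barDer_mul_of_hasDeg_one {φ : Coch B B} (hm : Multilin φ) (hd : HasDeg D.gr D.gr 1 φ)
    (ψ : Coch B B) : D.barDer (φ * ψ) = D.barDer φ * ψ - D.sC φ * D.barDer ψ := by
  rw [barDer, Coch.der_mul, D.map_susp_of_hasDeg_one D.internal hm hd, neg_mul, sub_eq_add_neg]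

lemma barDer_mul_of_hasDeg_zero {φ : Coch B B} (hm : Multilin φ) (hd : HasDeg D.gr D.gr 0 φ)
    (ψ : Coch B B) : D.barDer (φ * ψ) = D.barDer φ * ψ + D.sC φ * D.barDer ψ := by
  rw [barDer, Coch.der_mul, D.map_susp_of_hasDeg_zero D.internal hm hd]

namespace Contraction

variable {D} (c : D.Contraction)

/-- The first component of a function with values in pairs, made zero at the empty word. -/
def left (φ : List B → B × B) : Coch B B := ⟨fun w => if w = [] then 0 else (φ w).1⟩

/-- The second component of a function with values in pairs, made zero at the empty word. -/
def right (φ : List B → B × B) : Coch B B := ⟨fun w => if w = [] then 0 else (φ w).2⟩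

/-- An auxiliary expression for the recursion that defines the gauge transformation. -/
def remainder (D : DGAlgebra B) (γ τ : Coch B B) : Coch B B := D.taut + D.taut * γ - D.sC γ * τ

/-- The operator whose fixed point is the pair of a gauge transformation and the transformed
function. -/
def gaugeOp (φ : List B → B × B) (w : List B) : B × B :=
  ((-c.hC (remainder D (left φ) (right φ))) w,
    (remainder D (left φ) (right φ) - D.dC (-c.hC (remainder D (left φ) (right φ))) -
      D.barDer (-c.hC (remainder D (left φ) (right φ)))) w)

lemma remainder_congr {φ ψ : List B → B × B} {w : List B}
    (h : ∀ v : List B, v.length < w.length → φ v = ψ v) :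
    remainder D (left φ) (right φ) w = remainder D (left ψ) (right ψ) w := by
  have h₁ : ∀ u : List B, u.length < w.length → left φ u = left ψ u := fun u hu => by
    simp only [left, Coch.coe_mk, h u hu]
  have h₂ : ∀ u : List B, u.length < w.length → right φ u = right ψ u := fun u hu => by
    simp only [right, Coch.coe_mk, h u hu]
  simp only [remainder, Coch.sub_apply, Coch.add_apply]
  congr 1
  · congr 1
    exact Coch.mul_congr rfl rfl rfl rfl (fun _ _ => rfl) h₁
  · exact Coch.mul_congr (by simp [left]) (by simp [left]) rfl rfl
      (fun u hu => congrArg D.sgn (h₁ u hu)) h₂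

lemma contracting_gaugeOp : Contracting c.gaugeOp := by
  intro φ ψ w h
  -- All lengths up to that of `w` are needed, since the coderivation in the second component
  -- evaluates the first one at words as long as `w`.
  have h₁ : ∀ t : List B, t.length ≤ w.length → (-c.hC (remainder D (left φ) (right φ))) t =
      (-c.hC (remainder D (left ψ) (right ψ))) t := fun t ht => by
    rw [Coch.neg_apply, Coch.neg_apply, hC_apply, hC_apply,
      remainder_congr fun v hv => h v (hv.trans_le ht)]
  refine Prod.ext (h₁ w le_rfl) ?_
  simp only [gaugeOp, Coch.sub_apply, dC_apply]
  rw [h₁ w le_rfl, remainder_congr h]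
  congr 1
  exact coder_congr _ _ fun t _ ht => h₁ t ht

/-- The gauge transformation, without its constant term. -/
def gauge : Coch B B := ⟨fun w => (fix c.gaugeOp w).1⟩

/-- The transform of the tautological function. -/
def straight : Coch B B := ⟨fun w => (fix c.gaugeOp w).2⟩

lemma remainder_nil (φ : List B → B × B) : remainder D (left φ) (right φ) [] = 0 := by
  simp [remainder, Coch.mul_nil, left, right]

lemma gauge_nil : c.gauge [] = 0 := by
  change (fix c.gaugeOp []).1 = 0
  rw [c.contracting_gaugeOp.fix_eq, gaugeOp, Coch.neg_apply, hC_apply, remainder_nil]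
  simp

lemma straight_nil : c.straight [] = 0 := by
  change (fix c.gaugeOp []).2 = 0
  rw [c.contracting_gaugeOp.fix_eq, gaugeOp]
  simp [remainder_nil, barDer_apply]

lemma left_fix : left (fix c.gaugeOp) = c.gauge := by
  ext w
  rw [left, Coch.coe_mk]
  split_ifs with hw
  · rw [hw, gauge_nil]
  · rfl

lemma right_fix : right (fix c.gaugeOp) = c.straight := by
  ext w
  rw [right, Coch.coe_mk]
  split_ifs with hw
  · rw [hw, straight_nil]
  · rfl

lemma gauge_eq : c.gauge = -c.hC (remainder D c.gauge c.straight) := by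
  ext w
  refine (congrArg Prod.fst (congrFun c.contracting_gaugeOp.fix_eq w)).trans ?_
  rw [gaugeOp, left_fix, right_fix]

/-- With `g = 1 + gauge`, `t = straight` and `o = taut`, this is the gauge equation `(-1)^{|g|} g t
= o g - d g - D g`, where `D` is `barDer`. The choice of `gauge` in `gauge_eq` is made so that `h t
= 0`. -/
lemma straight_eq :
    c.straight = remainder D c.gauge c.straight - D.dC c.gauge - D.barDer c.gauge := by
  ext w
  refine (congrArg Prod.snd (congrFun c.contracting_gaugeOp.fix_eq w)).trans ?_
  rw [gaugeOp, left_fix, right_fix, ← gauge_eq]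

lemma multilin_remainder {γ τ : Coch B B} (hγ : Multilin γ) (hτ : Multilin τ) :
    Multilin (remainder D γ τ) :=
  (D.multilin_taut.add (Coch.multilin_mul D.multilin_taut hγ)).sub
    (Coch.multilin_mul (D.multilin_sC hγ) hτ)

lemma hasDeg_remainder {γ τ : Coch B B} (hγ : HasDeg D.gr D.gr 0 γ) (hτ : HasDeg D.gr D.gr 1 τ) :
    HasDeg D.gr D.gr 1 (remainder D γ τ) :=
  (D.hasDeg_taut.add (Coch.hasDeg_mul D D.hasDeg_taut hγ rfl)).sub
    (Coch.hasDeg_mul D (D.hasDeg_sC hγ) hτ rfl)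

lemma multilin_gaugeOp (n : ℕ) : Multilin (fun w => (c.gaugeOp^[n] 0 w).1) ∧
    Multilin (fun w => (c.gaugeOp^[n] 0 w).2) := by
  induction n with
  | zero => exact ⟨Multilin.zero, Multilin.zero⟩
  | succ n ih =>
    rw [Function.iterate_succ_apply']
    have hr := multilin_remainder (D := D) (γ := left (c.gaugeOp^[n] 0))
      (τ := right (c.gaugeOp^[n] 0)) (multilin_ite ih.1) (multilin_ite ih.2)
    have hγ : Multilin (-c.hC (remainder D (left (c.gaugeOp^[n] 0)) (right (c.gaugeOp^[n] 0)))) :=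
      (hr.comp c.h).neg
    exact ⟨hγ, (hr.sub (D.multilin_dC hγ)).sub
      (hγ.coder (σ := susp D.internal) D.toAInf.multilin_bar)⟩

lemma hasDeg_gaugeOp (n : ℕ) : HasDeg D.gr D.gr 0 (fun w => (c.gaugeOp^[n] 0 w).1) ∧
    HasDeg D.gr D.gr 1 (fun w => (c.gaugeOp^[n] 0 w).2) := by
  induction n with
  | zero => exact ⟨HasDeg.zero _, HasDeg.zero _⟩
  | succ n ih =>
    rw [Function.iterate_succ_apply']
    have hr := hasDeg_remainder (γ := left (c.gaugeOp^[n] 0))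
      (τ := right (c.gaugeOp^[n] 0)) (hasDeg_ite ih.1) (hasDeg_ite ih.2)
    have hγ : HasDeg D.gr D.gr 0
        (-c.hC (remainder D (left (c.gaugeOp^[n] 0)) (right (c.gaugeOp^[n] 0)))) :=
      (c.hasDeg_hC hr rfl).neg
    exact ⟨hγ, (hr.sub (D.hasDeg_dC hγ rfl)).sub
      (hγ.coder (σ := susp D.internal) (fun _ _ h => D.toAInf.susp_mem h) D.toAInf.hasDeg_bar rfl)⟩

lemma multilin_gauge : Multilin c.gauge := by
  intro x y
  simp only [LinAt, gauge, Coch.coe_mk, fix, List.length_append, List.length_cons]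
  exact (c.multilin_gaugeOp _).1 x y

lemma multilin_straight : Multilin c.straight := by
  intro x y
  simp only [LinAt, straight, Coch.coe_mk, fix, List.length_append, List.length_cons]
  exact (c.multilin_gaugeOp _).2 x y

lemma hasDeg_gauge : HasDeg D.gr D.gr 0 c.gauge := fun w ds hw => (c.hasDeg_gaugeOp _).1 w ds hw

lemma hasDeg_straight : HasDeg D.gr D.gr 1 c.straight :=
  fun w ds hw => (c.hasDeg_gaugeOp _).2 w ds hw

/-- The gauge transform of the tautological function is a twisting function. -/
lemma barDer_straight : D.barDer c.straight = D.dC c.straight + D.sq c.straight := by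
  have hA : c.straight + D.sC c.gauge * c.straight =
      D.taut + D.taut * c.gauge - D.dC c.gauge - D.barDer c.gauge := by
    conv_lhs => enter [1]; rw [c.straight_eq, remainder]
    abel
  have hd := congrArg D.dC hA
  have hD := congrArg D.barDer hA
  have hs := congrArg D.sC hA
  simp only [map_add, map_sub, dC_mul, sC_sC, dC_sC, dC_dC, sC_mul] at hd hs
  have hDs : D.barDer (D.sC c.gauge * c.straight) =
      D.sC (D.barDer c.gauge) * c.straight + c.gauge * D.barDer c.straight := by
    rw [D.barDer_mul_of_hasDeg_zero (D.multilin_sC c.multilin_gauge) (D.hasDeg_sC c.hasDeg_gauge),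
      sC_sC, barDer, der_sC]
  have hDd : D.barDer (D.dC c.gauge) = D.dC (D.barDer c.gauge) := D.der_dC _ _ _
  rw [map_add, map_sub, map_sub, map_add, hDs,
    D.barDer_mul_of_hasDeg_one D.multilin_taut D.hasDeg_taut, D.barDer_barDer c.multilin_gauge,
    D.barDer_taut, hDd] at hD
  set t := c.straight
  set g := c.gauge
  set o := D.taut
  set E := D.dC t + D.sq t - D.barDer t with hE
  -- Applying the differential and the coderivation to the gauge equation `hA`, and using the
  -- twisting equation of `o`, gives `(1 + g) E = 0` for the defect `E` of the twisting equation of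
  -- `t`.
  have key : E + g * E = 0 := by
    have e₁ : E + g * E = (D.dC t + (-D.sC (D.dC g) * t + g * D.dC t)) -
        (D.barDer t + (D.sC (D.barDer g) * t + g * D.barDer t)) +
        (D.sC (D.dC g) + D.sC (D.barDer g) + (D.sC t + g * D.sC t)) * t := by
      rw [hE, sq_def]
      noncomm_ring
    have e₂ : D.sC (D.dC g) + D.sC (D.barDer g) + (D.sC t + g * D.sC t) =
        D.sC o + D.sC o * D.sC g := by
      rw [hs]; abel
    rw [e₁, hd, hD, e₂, sq_def]
    have e₃ : D.sC o * (t + D.sC g * t) = D.sC o * (o + o * g - D.dC g - D.barDer g) := by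
      rw [hA]
    have e₄ : (D.sC o + D.sC o * D.sC g) * t = D.sC o * (t + D.sC g * t) := by noncomm_ring
    rw [e₄, e₃]
    noncomm_ring
  have hg0 : g [] = 0 := c.gauge_nil
  have hE' : ∀ w, E w = -(g * E) w := fun w => by
    have := DFunLike.congr_fun key w
    rw [Coch.add_apply] at this
    exact eq_neg_of_add_eq_zero_left this
  have hE0 : E [] = 0 := by rw [hE', Coch.mul_nil, hg0, zero_mul, neg_zero]
  -- As `g` vanishes at the empty word, `1 + g` can be cancelled by induction on the length.
  have : E = 0 := by
    ext w
    induction w using length_induction with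
    | h w ih =>
      rw [hE', Coch.mul_congr (ψ' := 0) hg0 hg0 hE0 rfl (fun _ _ => rfl) ih]
      simp
  exact (sub_eq_zero.1 this).symm

lemma hC_dC_hC {V : Type*} (φ : Coch V B) : c.hC (D.dC (c.hC φ)) = -c.hC φ :=
  Coch.ext fun w => by simp [c.h_d_h]

lemma hC_hC {V : Type*} (φ : Coch V B) : c.hC (c.hC φ) = 0 :=
  Coch.ext fun w => by simp [c.h_h]

lemma hC_gauge : c.hC c.gauge = 0 := by rw [gauge_eq, map_neg, hC_hC, neg_zero]

lemma hC_barDer (φ : Coch B B) : c.hC (D.barDer φ) = D.barDer (c.hC φ) :=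
  (Coch.der_post _ _ _ _).symm

/-- Since `h d h = -h`, the term `h d γ` equals `h` of the remainder, which it cancels. The last
term vanishes because `h` commutes with the coderivation and `h γ = 0`. -/
lemma hC_straight : c.hC c.straight = 0 := by
  rw [straight_eq, map_sub, map_sub, hC_barDer, hC_gauge, map_zero, sub_zero, gauge_eq, map_neg,
    map_neg, hC_dC_hC, neg_neg, ← gauge_eq, sub_self]

/-- The shifted components of the A∞-quasi-isomorphism to the cohomology. -/
def projWord (w : List B) : D.Cohomology := c.toCoh (c.straight w)

lemma projWord_apply (w : List B) : c.projWord w = c.toCoh (c.straight w) := rfl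

lemma projWord_nil : c.projWord [] = 0 := by rw [projWord, straight_nil, map_zero]

lemma multilin_projWord : Multilin c.projWord := c.multilin_straight.comp c.toCoh

lemma hasDeg_projWord : HasDeg D.gr D.cohGr 1 c.projWord :=
  c.hasDeg_straight.comp (r := 0) (fun k a ha => by rw [add_zero]; exact c.toCoh_mem ha) rfl

lemma pull_sq_inclWord : (⟨pull c.projWord (D.sq c.inclWord)⟩ : Coch B B) =
    D.sq ⟨pull c.projWord c.inclWord⟩ := by
  rw [sq_def, Coch.pull_mul]
  congr 1
  ext w
  exact (map_pull c.projWord D.sgn _ w).symm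

lemma pull_inclWord : (⟨pull c.projWord c.inclWord⟩ : Coch B B) =
    ⟨fun w => c.incl (c.projWord w)⟩ + c.hC (D.sq ⟨pull c.projWord c.inclWord⟩) := by
  rw [← pull_sq_inclWord]
  ext w
  have h₁ := pull_congr (g := c.projWord) (w := w) (fun _ _ => rfl)
    (fun t _ => DFunLike.congr_fun c.inclWord_eq t)
  have h₂ := Coch.pull_letter (g := c.projWord) (L := c.incl) (by rw [projWord_nil, map_zero])
  rw [Coch.coe_mk, h₁]
  refine (pull_add _ _ _ w).trans ?_
  rw [Coch.coe_mk, h₂, Coch.add_apply, hC_apply]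
  congr 1
  exact (map_pull c.projWord c.h _ w).symm

/-- Apply `h` to the twisting equation: as `h t = 0`, it gives `h d t = -h (sq t)`, while `1 + dh +
hd = incl ∘ toCoh` gives `t + h d t = incl (toCoh t)`. -/
lemma straight_fixed : c.straight =
    ⟨fun w => c.incl (c.projWord w)⟩ + c.hC (D.sq c.straight) := by
  have h := congrArg c.hC c.barDer_straight
  rw [hC_barDer, hC_straight, map_zero, map_add] at h
  ext w
  have h₁ := c.hC_dC c.straight w
  have h₂ := DFunLike.congr_fun h w
  rw [hC_straight] at h₁
  rw [Coch.add_apply, Coch.zero_apply] at h₂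
  change c.straight w = c.incl (c.toCoh (c.straight w)) + c.hC (D.sq c.straight) w
  rw [incl_toCoh, h₁, dC_apply, Coch.zero_apply, map_zero,
    add_zero, add_assoc, ← h₂, add_zero]

/-- Both sides solve the same fixed point equation, so the straightened twisting function factors
through the inclusion of the cohomology. -/
lemma straight_eq_pull : c.straight = ⟨pull c.projWord c.inclWord⟩ :=
  c.eq_of_fixed c.straight_nil c.inclWord_nil c.straight_fixed c.pull_inclWord

/-- The class of the twisting equation of `straight`: the differential drops out, and the
factorization identifies the quadratic term with the transferred operations. -/
lemma coder_projWord (w : List B) :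
    coder (susp D.internal) D.toAInf.bar c.projWord w = pull c.projWord c.cohBar w := by
  have h₁ : coder (susp D.internal) D.toAInf.bar c.projWord w = c.toCoh (D.barDer c.straight w) :=
    (map_coder _ _ c.toCoh _ w).symm
  have h₂ : pull c.projWord c.cohBar w = c.toCoh (pull c.projWord (D.sq c.inclWord) w) :=
    (map_pull _ c.toCoh _ w).symm
  have h₃ := DFunLike.congr_fun c.pull_sq_inclWord w
  rw [← straight_eq_pull, Coch.coe_mk] at h₃
  rw [h₁, h₂, h₃, barDer_straight, Coch.add_apply, map_add, dC_apply, toCoh_d, zero_add]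

/-- The A∞-quasi-isomorphism from the DG-algebra to the cohomology. -/
def cohProj : AInfHom D.toAInf c.cohAlg :=
  AInfHom.ofBar c.projWord c.multilin_projWord c.projWord_nil c.hasDeg_projWord fun w => by
    rw [bar_cohAlg]
    exact c.coder_projWord w

lemma bar_cohProj : c.cohProj.bar = c.projWord := AInfHom.bar_ofBar _ _ _ _ _

end Contraction

end DGAlgebra

/-! ### Strict units -/

namespace Word

lemma mem_twist {V : Type*} [AddCommGroup V] [Module ℂ V] {ε : V →ₗ[ℂ] V} {η : V} (hη : ε η = η)
    {w : List V} (hw : η ∈ w) : η ∈ twist ε w := by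
  induction w with
  | nil => simp at hw
  | cons a w ih =>
    rw [twist_cons, List.mem_cons]
    rcases List.mem_cons.1 hw with rfl | hw
    · refine Or.inl ?_
      generalize w.length = n
      induction n with
      | zero => simp
      | succ n ih => rw [pow_succ, Module.End.mul_apply, hη]; exact ih
    · exact Or.inr (ih hw)

lemma parity_of_mem_zero {V : Type*} [AddCommGroup V] [Module ℂ V] {gr : ℤ → Submodule ℂ V}
    (h : DirectSum.IsInternal gr) {η : V} (hη : η ∈ gr 0) : parity h η = η := by
  rw [parity_of_mem h hη, Int.negOnePow_zero, one_smul]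

end Word

open Word

section

variable {V W : Type*} [AddCommGroup V] [Module ℂ V] [AddCommGroup W] [Module ℂ W]
  {gr : ℤ → Submodule ℂ V} {gr' : ℤ → Submodule ℂ W}

lemma AInfAlgebra.m_eq (X : AInfAlgebra gr) {n : ℕ} (a : Fin n → V) :
    X.m n a = X.bar (twist (parity X.internal) (List.ofFn a)) := by
  rw [AInfAlgebra.bar, shifted, twist_twist (parity_parity _), ev_ofFn]

/-- The parity in `h₂` comes from the twist, which applies the sign involution to the first of two
letters. -/
lemma AInfAlgebra.isStrictUnit_of_bar (X : AInfAlgebra gr) {η : V} (hη : η ∈ gr 0)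
    (h₁ : ∀ a, X.bar [η, a] = a) (h₂ : ∀ a, X.bar [a, η] = parity X.internal a)
    (h₃ : ∀ w : List V, w.length ≠ 2 → η ∈ w → X.bar w = 0) : X.IsStrictUnit η where
  mem := hη
  mul_unit a := by
    rw [m_eq]
    simp [twist_cons, h₂]
  unit_mul a := by
    rw [m_eq]
    simp [twist_cons, parity_of_mem_zero X.internal hη, h₁]
  eq_zero n hn a ha := by
    rw [m_eq]
    refine h₃ _ (by simpa using hn) (mem_twist (parity_of_mem_zero _ hη) ?_)
    rwa [List.mem_ofFn]

namespace AInfHom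

variable {X : AInfAlgebra gr} {Y : AInfAlgebra gr'} (F : AInfHom X Y)

lemma f_eq {n : ℕ} (a : Fin n → V) :
    F.f n a = F.bar (twist (parity X.internal) (List.ofFn a)) := by
  rw [bar, shifted, twist_twist (parity_parity _), ev_ofFn]

lemma isStrictlyUnital_iff {η : V} {θ : W} (hη : η ∈ gr 0) : F.IsStrictlyUnital η θ ↔
    F.bar [η] = θ ∧ ∀ w, η ∈ w → w ≠ [η] → F.bar w = 0 := by
  have hp := parity_of_mem_zero X.internal hη
  constructor
  · rintro ⟨h₁, h₂⟩
    refine ⟨by rw [bar_singleton, h₁], fun w hw hw' => ?_⟩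
    rw [bar, shifted, ev]
    refine h₂ _ (fun hl => hw' ?_) _ ?_
    · obtain ⟨a, rfl⟩ := List.length_eq_one_iff.1 ((length_twist _ w).symm.trans hl)
      simpa [eq_comm] using hw
    · simpa [List.mem_iff_get] using mem_twist hp hw
  · rintro ⟨h₁, h₂⟩
    refine ⟨by rw [← bar_singleton, h₁], fun n hn a ha => ?_⟩
    rw [f_eq]
    refine h₂ _ (mem_twist hp (by rwa [List.mem_ofFn])) fun h => hn ?_
    simpa using congrArg List.length h

end AInfHom

end

namespace DGAlgebra

variable {B : Type*} [Ring B] [Algebra ℂ B] (D : DGAlgebra B)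

lemma bar_toAInf_singleton (a : B) : D.toAInf.bar [a] = D.d a := by
  rw [bar_toAInf]
  simp [sq_def, Coch.mul_apply, splitSum_cons]

lemma bar_toAInf_pair (a b : B) : D.toAInf.bar [a, b] = D.sgn a * b := by
  rw [bar_toAInf]
  simp [sq_def, Coch.mul_apply, splitSum_cons]

lemma bar_toAInf_of_length {w : List B} (hw : 3 ≤ w.length) : D.toAInf.bar w = 0 := by
  rw [AInfAlgebra.bar, shifted, ev, show D.toAInf.m _ = 0 from D.m_of_three_le (by simpa using hw)]
  rfl

lemma cohOne_mem : D.cohOne ∈ D.cohGr 0 := ⟨⟨1, D.d_one⟩, D.one_mem, rfl⟩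

lemma susp_one : susp D.internal (1 : B) = -1 := by
  rw [susp_apply, parity_of_mem_zero D.internal D.one_mem]

/-- The composite of a function that kills the words containing `1` with the coderivation of a
DG-algebra. -/
lemma coder_one {φ : List B → B} (hφ : Multilin φ) {x y : List B}
    (h : ∀ t : List B, (1 : B) ∈ t → t.length ≤ (x ++ 1 :: y).length → φ t = 0) :
    coder (susp D.internal) D.toAInf.bar φ (x ++ 1 :: y) =
      (if y = [] then 0 else φ (x.map (susp D.internal) ++ y)) -
        if x = [] then 0 else φ (x.map (susp D.internal) ++ y) := by
  induction x generalizing φ with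
  | nil =>
    rw [List.nil_append, coder_cons]
    have h₁ : coder (susp D.internal) D.toAInf.bar (fun t => φ (susp D.internal 1 :: t)) y = 0 := by
      rw [coder_congr (ψ := fun _ => 0), coder_zero]
      intro t _ ht
      rw [susp_one, (hφ.head t).map_neg, h _ (by simp) (by simpa using ht), neg_zero]
    rw [h₁, zero_add]
    cases y with
    | nil => simp [bar_toAInf_singleton, D.d_one, hφ.zero_cons]
    | cons b y =>
      rw [splitSum_cons, splitSum_eq_left]
      · simp [bar_toAInf_singleton, D.d_one, hφ.zero_cons, bar_toAInf_pair]
      · intro u v _ hu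
        rw [D.bar_toAInf_of_length, hφ.zero_cons]
        have := List.length_pos_iff.2 hu
        simp; omega
  | cons a x ih =>
    rw [List.cons_append, coder_cons, ih (hφ.cons _)]
    · cases x with
      | nil =>
        rw [List.nil_append, splitSum_cons, splitSum_eq_left]
        -- The unit can only disappear by multiplication with a neighbour. Here `a` absorbs it from
        -- the left with the sign of `susp`, opposite to absorption by the next letter.
        · rw [h (D.toAInf.bar [a] :: 1 :: y) (by simp) (by simp), bar_toAInf_pair, mul_one]
          have : D.sgn a = -susp D.internal a := by rw [susp_apply, neg_neg]; rfl
          rw [this, (hφ.head y).map_neg]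
          simp [sub_eq_add_neg]
        · intro u v _ hu
          rw [D.bar_toAInf_of_length, hφ.zero_cons]
          have := List.length_pos_iff.2 hu
          simp; omega
      | cons b x =>
        rw [splitSum_eq_zero]
        · simp
        · intro u v huv
          rcases List.append_eq_append_iff.1 huv with ⟨s, hs, hv⟩ | ⟨s, hs, hv⟩
          · exact h _ (by simp [hv]) (by simp [← huv])
          · cases s with
            | nil =>
              rw [List.nil_append] at hv
              exact h _ (by simp [← hv]) (by simp [← huv])
            | cons s₀ s =>
              rw [D.bar_toAInf_of_length (by simp [hs]; omega), hφ.zero_cons]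
    · intro t ht hl
      exact h _ (by simp [ht]) (by simpa using hl)

namespace Contraction

variable {D} (c : D.Contraction)

/-! ### Units and homotopy transfer -/

lemma inclWord_apply (w : List D.Cohomology) :
    c.inclWord w = Coch.letter c.incl w + c.h (D.sq c.inclWord w) :=
  DFunLike.congr_fun c.inclWord_eq w

lemma sq_inclWord_singleton (x : D.Cohomology) : D.sq c.inclWord [x] = 0 := by
  simp [sq_def, Coch.mul_apply, splitSum_cons, inclWord_nil]

lemma inclWord_singleton (x : D.Cohomology) : c.inclWord [x] = c.incl x := by
  rw [inclWord_apply, sq_inclWord_singleton, map_zero, add_zero, Coch.letter_singleton]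

lemma sq_inclWord_pair (x y : D.Cohomology) :
    D.sq c.inclWord [x, y] = D.sgn (c.incl x) * c.incl y := by
  simp [sq_def, Coch.mul_apply, splitSum_cons, inclWord_nil, inclWord_singleton]

lemma h_inclWord (w : List D.Cohomology) : c.h (c.inclWord w) = 0 := by
  rw [inclWord_apply, map_add, c.h_h, add_zero]
  match w with
  | [] => simp
  | [a] => simp
  | _ :: _ :: _ => simp

/-- An expression `∑ L ((-1)^{|i u|} i u i v)` vanishes at a word that contains the unit. -/
lemma map_sq_inclWord_of_mem {M : Type*} [AddCommGroup M] [Module ℂ M] (L : B →ₗ[ℂ] M)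
    {w : List D.Cohomology} (hw : D.cohOne ∈ w) 
    (h : ∀ v : List D.Cohomology, v.length < w.length → D.cohOne ∈ v → v ≠ [D.cohOne] →
      c.inclWord v = 0)
    (hL : ∀ v : List D.Cohomology, v.length + 1 = w.length → L (c.inclWord v) = 0)
    (hL' : ∀ v : List D.Cohomology, v.length + 1 = w.length → L (D.sgn (c.inclWord v)) = 0) :
    L (D.sq c.inclWord w) = 0 := by
  rw [sq_def, Coch.mul_apply, map_splitSum]
  refine splitSum_eq_zero fun u v huv => ?_
  rw [sC_apply]
  rcases eq_or_ne u [] with rfl | hu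
  · simp [inclWord_nil]
  rcases eq_or_ne v [] with rfl | hv
  · simp [inclWord_nil]
  have hu' := List.length_pos_iff.2 hu
  have hv' := List.length_pos_iff.2 hv
  have hl := congrArg List.length huv
  rw [List.length_append] at hl
  rw [← huv, List.mem_append] at hw
  rcases hw with hm | hm
  · by_cases hu₁ : u = [D.cohOne]
    · rw [hu₁, inclWord_singleton, incl_one, sgn_one, one_mul]
      exact hL v (by rw [← hl, hu₁, List.length_singleton, add_comm])
    · rw [h u (by omega) hm hu₁, map_zero, zero_mul, map_zero]
  · by_cases hv₁ : v = [D.cohOne]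
    · rw [hv₁, inclWord_singleton, incl_one, mul_one]
      exact hL' u (by rw [← hl, hv₁, List.length_singleton])
    · rw [h v (by omega) hm hv₁, mul_zero, map_zero]

/-- By induction, a product survives only if one factor is the value `1` at the one-letter word
`[D.cohOne]`. What is left is `h` of a value of `inclWord`, up to `sgn`, and this is zero by the
side conditions. -/
lemma inclWord_of_mem {w : List D.Cohomology} (hw : D.cohOne ∈ w) (hw₁ : w ≠ [D.cohOne]) :
    c.inclWord w = 0 := by
  induction w using length_induction with
  | h w ih =>
    rw [inclWord_apply, Coch.letter_of_length_ne_one, zero_add]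
    · refine c.map_sq_inclWord_of_mem c.h hw (fun v hv => ih v hv)
        (fun v _ => c.h_inclWord v) fun v _ => ?_
      rw [sgn_h, h_inclWord, map_zero, neg_zero]
    · intro hl
      obtain ⟨a, rfl⟩ := List.length_eq_one_iff.1 hl
      exact hw₁ (by simpa [eq_comm] using hw)

/-- As for `inclWord`, with `toCoh` instead of `h`: the surviving factor sits at a word of length at
least two, where `inclWord` has values in the image of `h`, and `toCoh ∘ h = 0`. -/
lemma cohBar_of_mem {w : List D.Cohomology} (hl : w.length ≠ 2) (hw : D.cohOne ∈ w) :
    c.cohBar w = 0 := by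
  rw [cohBar]
  by_cases h₁ : w.length = 1
  · obtain ⟨a, rfl⟩ := List.length_eq_one_iff.1 h₁
    rw [sq_inclWord_singleton, map_zero]
  have hpos := List.length_pos_of_mem hw
  refine c.map_sq_inclWord_of_mem c.toCoh hw (fun v _ => c.inclWord_of_mem)
    (fun v hv => ?_) fun v hv => ?_
  · rw [inclWord_apply, Coch.letter_of_length_ne_one _ (by omega), zero_add, toCoh_h]
  · rw [inclWord_apply, Coch.letter_of_length_ne_one _ (by omega), zero_add,
      ← neg_eq_zero, ← map_neg, ← sgn_h, toCoh_h]

lemma isStrictUnit_cohAlg : c.cohAlg.IsStrictUnit D.cohOne := by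
  refine c.cohAlg.isStrictUnit_of_bar D.cohOne_mem (fun a => ?_) (fun a => ?_) fun w hl hw => ?_
  · rw [bar_cohAlg, cohBar, sq_inclWord_pair, incl_one, sgn_one, one_mul, toCoh_incl]
  · rw [bar_cohAlg, cohBar, sq_inclWord_pair, incl_one, mul_one, ← sgn_incl, toCoh_incl]
  · rw [bar_cohAlg]
    exact c.cohBar_of_mem hl hw

lemma cohIncl_unital : c.cohIncl.IsStrictlyUnital D.cohOne 1 := by
  rw [AInfHom.isStrictlyUnital_iff _ D.cohOne_mem, bar_cohIncl]
  exact ⟨by rw [inclWord_singleton, incl_one], fun w => c.inclWord_of_mem⟩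

lemma gauge_apply (w : List B) : c.gauge w = -c.h (remainder D c.gauge c.straight w) :=
  DFunLike.congr_fun c.gauge_eq w

lemma straight_apply (w : List B) : c.straight w =
    remainder D c.gauge c.straight w - D.d (c.gauge w) - D.barDer c.gauge w :=
  DFunLike.congr_fun c.straight_eq w

lemma remainder_singleton (a : B) : remainder D c.gauge c.straight [a] = a := by
  simp [remainder, Coch.mul_apply, splitSum_cons, gauge_nil, straight_nil, taut]

lemma gauge_singleton (a : B) : c.gauge [a] = -c.h a := by
  rw [gauge_apply, remainder_singleton]

lemma straight_singleton (a : B) : c.straight [a] = c.proj a := by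
  rw [straight_apply, remainder_singleton, gauge_singleton, barDer_apply, coder_cons, coder_nil,
    splitSum_nil, bar_toAInf_singleton, gauge_singleton, proj_apply, map_neg]
  abel

lemma gauge_map_susp (w : List B) : c.gauge (w.map (susp D.internal)) = D.sgn (c.gauge w) :=
  DFunLike.congr_fun (D.map_susp_of_hasDeg_zero D.internal c.multilin_gauge c.hasDeg_gauge) w

/-- The value of the auxiliary expression at a word that contains the unit. -/
lemma remainder_of_mem {x y : List B} (hw : x ≠ [] ∨ y ≠ [])
    (hg : ∀ v : List B, v.length < (x ++ 1 :: y).length → (1 : B) ∈ v → c.gauge v = 0)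
    (hs : ∀ v : List B, v.length < (x ++ 1 :: y).length → (1 : B) ∈ v → v ≠ [1] →
      c.straight v = 0) :
    remainder D c.gauge c.straight (x ++ 1 :: y) =
      (if x = [] then c.gauge y else 0) - if y = [] then D.sgn (c.gauge x) else 0 := by
  have h₀ : D.taut (x ++ 1 :: y) = 0 := Coch.letter_of_length_ne_one _ (by
    rcases hw with h | h <;>
    · have := List.length_pos_iff.2 h
      simp; omega)
  rw [remainder, Coch.sub_apply, Coch.add_apply, h₀, zero_add]
  congr 1
  · have key : ∀ (a : B) (w : List B), (D.taut * c.gauge) (a :: w) = a * c.gauge w := fun a w => by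
      rw [Coch.mul_apply, splitSum_cons, taut_nil, zero_mul, zero_add, splitSum_eq_left]
      · rfl
      · intro u v _ hu
        rw [taut, Coch.coe_mk, Coch.letter_of_length_ne_one, zero_mul]
        simpa using hu
    cases x with
    | nil => simp [key]
    | cons a x =>
      rw [List.cons_append, key, hg _ (by simp) (by simp)]
      simp
  · have hz : ∀ u v : List B, u ++ v = x ++ 1 :: y → ((1 : B) ∈ u ∨ ((1 : B) ∈ v ∧ v ≠ [1])) →
        D.sC c.gauge u * c.straight v = 0 := by
      intro u v huv h
      rcases eq_or_ne u [] with rfl | hu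
      · simp [gauge_nil]
      rcases eq_or_ne v [] with rfl | hv
      · simp [straight_nil]
      have hu' := List.length_pos_iff.2 hu
      have hv' := List.length_pos_iff.2 hv
      have hl := congrArg List.length huv
      rw [List.length_append] at hl
      rcases h with h | ⟨h, h₁⟩
      · rw [sC_apply, hg u (by omega) h, map_zero, zero_mul]
      · rw [hs v (by omega) h h₁, mul_zero]
    rw [Coch.mul_apply]
    split_ifs with hy
    · subst hy
      rw [splitSum_append_singleton]
      · rw [straight_singleton, proj_one, mul_one, sC_apply]
      · intro u v huv hv
        rcases eq_or_ne v [] with rfl | hv₀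
        · rw [straight_nil, mul_zero]
        refine hz u v huv (Or.inr ⟨?_, by rintro rfl; simp at hv⟩)
        have h₁ := congrArg List.getLast? huv
        rw [List.getLast?_append_of_ne_nil _ hv₀] at h₁
        exact List.mem_of_getLast? (by simpa using h₁)
    · refine splitSum_eq_zero fun u v huv => hz u v huv ?_
      rcases List.append_eq_append_iff.1 huv with ⟨s, hs, hv⟩ | ⟨s, hs, hv⟩
      · refine Or.inr ⟨by simp [hv], fun h => hy ?_⟩
        have := congrArg List.length (hv.symm.trans h)
        simp only [List.length_append, List.length_cons, List.length_nil] at this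
        exact List.length_eq_zero_iff.1 (by omega)
      · cases s with
        | nil =>
          rw [List.nil_append] at hv
          exact Or.inr ⟨by simp [← hv], by simpa [← hv] using hy⟩
        | cons s₀ s =>
          rw [List.cons_append, List.cons.injEq] at hv
          exact Or.inl (by simp [hs, ← hv.1])

/-- On a longer word containing `1`, the remainder reduces to values of `gauge` at the word with `1`
removed from an end. They are killed by `h`, whence the first claim. For the second, the
coderivation produces the same boundary terms (`coder_one`), and they cancel. -/
lemma gauge_straight_of_mem {w : List B} (hw : (1 : B) ∈ w) :
    c.gauge w = 0 ∧ (w ≠ [1] → c.straight w = 0) := by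
  induction w using length_induction with
  | h w ih =>
    -- Words as long as `w` are included, because the coderivation at `w` evaluates `gauge` at other
    -- words of the same length.
    have hg : ∀ t : List B, (1 : B) ∈ t → t.length ≤ w.length → c.gauge t = 0 := by
      intro t ht hl
      obtain ⟨x, y, rfl⟩ := List.append_of_mem ht
      by_cases hxy : x ≠ [] ∨ y ≠ []
      · have hh : ∀ v, c.h (c.gauge v) = 0 := fun v => DFunLike.congr_fun c.hC_gauge v
        rw [gauge_apply, c.remainder_of_mem hxy (fun v hv h => (ih v (by omega) h).1)
          (fun v hv h => (ih v (by omega) h).2), map_sub]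
        split_ifs <;> simp [sgn_h, hh]
      · push Not at hxy
        obtain ⟨rfl, rfl⟩ := hxy
        rw [List.nil_append, gauge_singleton, c.h_one, neg_zero]
    refine ⟨hg w hw le_rfl, fun hw₁ => ?_⟩
    obtain ⟨x, y, rfl⟩ := List.append_of_mem hw
    have hxy : x ≠ [] ∨ y ≠ [] := by
      by_contra! hxy
      obtain ⟨rfl, rfl⟩ := hxy
      exact hw₁ rfl
    rw [straight_apply, c.remainder_of_mem hxy (fun v hv h => (ih v hv h).1)
      (fun v hv h => (ih v hv h).2), hg _ hw le_rfl, map_zero, sub_zero, barDer_apply,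
      D.coder_one c.multilin_gauge hg]
    split_ifs with h₁ h₂ h₂
    · simp_all
    · simp [h₁]
    · simp [h₂, gauge_map_susp]
    · simp

lemma projWord_singleton (a : B) : c.projWord [a] = c.toCoh a := by
  rw [projWord_apply, straight_singleton, toCoh_apply, ← toCoh_apply, ← incl_toCoh, toCoh_incl]

lemma cohProj_unital : c.cohProj.IsStrictlyUnital 1 D.cohOne := by
  rw [AInfHom.isStrictlyUnital_iff _ D.one_mem, bar_cohProj]
  refine ⟨by rw [projWord_singleton, toCoh_one], fun w hw hw₁ => ?_⟩
  rw [projWord_apply, (c.gauge_straight_of_mem hw).2 hw₁, map_zero]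

/-- The strictly unital minimal model given by a contraction. -/
def minimalModel : D.MinimalModel where
  alg := c.cohAlg
  minimal := by
    ext a
    rw [AInfAlgebra.m_eq, bar_cohAlg, cohBar]
    simp [twist_cons, sq_inclWord_singleton]
  isStrictUnit := c.isStrictUnit_cohAlg
  i := c.cohIncl
  i_unital := c.cohIncl_unital
  i_linear x := by
    have h : c.cohIncl.linear x = c.incl x := by
      rw [← AInfHom.bar_singleton, bar_cohIncl, inclWord_singleton]
    refine ⟨by rw [h, d_incl], ?_⟩
    conv_rhs => rw [← c.toCoh_incl x, c.toCoh_of_d_eq_zero (c.d_incl x)]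
    congr 1
  p := c.cohProj
  p_unital := c.cohProj_unital
  p_linear z hz := by
    rw [← AInfHom.bar_singleton, bar_cohProj, projWord_singleton, c.toCoh_of_d_eq_zero hz]

end Contraction

/-- The nonvanishing of the class of `1` is what permits a homotopy with `h 1 = 0`, hence strict
unitality. -/
lemma nonempty_minimalModel (h : D.cohOne ≠ 0) : Nonempty D.MinimalModel :=
  (D.exists_contraction h).map Contraction.minimalModel

end DGAlgebra

/-! ### Comparison of minimal models -/

namespace Word

section

variable {V W M : Type*} [AddCommGroup W] [Module ℂ W] [AddCommGroup M] [Module ℂ M]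

/-- In any composition, the block of `η` is killed by `g` unless it is `[η]`, and then `φ` sees the
letter `g [η]`. -/
lemma pull_eq_zero_of_mem {g : List V → W} {φ : List W → M} (hφ : Multilin φ) {η : V}
    (hg : ∀ w, η ∈ w → w ≠ [η] → g w = 0) (h : ∀ t, g [η] ∈ t → φ t = 0) {w : List V}
    (hw : η ∈ w) : pull g φ w = 0 := by
  induction w using length_induction generalizing φ with
  | h w ih =>
    cases w with
    | nil => simp at hw
    | cons a w =>
      rw [pull_cons]
      refine splitSum_eq_zero fun x y hxy => ?_
      by_cases hx : η ∈ a :: x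
      · suffices ∀ t, φ (g (a :: x) :: t) = 0 by simp only [this, pull_zero]
        intro t
        by_cases hx₁ : a :: x = [η]
        · rw [hx₁]; exact h _ (by simp)
        · rw [hg _ hx hx₁, hφ.zero_cons]
      · refine ih y ?_ (hφ.cons _) (fun t ht => h _ (by simp [ht])) ?_
        · simpa [Nat.lt_succ_iff] using length_le_of_append hxy
        · rw [← hxy, ← List.cons_append, List.mem_append] at hw
          exact hw.resolve_left hx

lemma pull_eq_zero_of_mem_of_ne {g : List V → W} {φ : List W → M} (hφ : Multilin φ) {η : V}
    (hg : ∀ w, η ∈ w → w ≠ [η] → g w = 0) (h : ∀ t, g [η] ∈ t → t ≠ [g [η]] → φ t = 0)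
    {w : List V} (hw : η ∈ w) (hw₁ : w ≠ [η]) : pull g φ w = 0 := by
  cases w with
  | nil => simp at hw
  | cons a w =>
    rw [pull_cons]
    refine splitSum_eq_zero fun x y hxy => ?_
    by_cases hx : η ∈ a :: x
    · by_cases hx₁ : a :: x = [η]
      · rw [hx₁]
        refine pull_eq_zero_of_ne_nil (fun t ht => h (g [η] :: t) (by simp) (by simpa using ht)) ?_
        rintro rfl
        rw [List.append_nil] at hxy
        exact hw₁ (hxy ▸ hx₁)
      · simp only [hg _ hx hx₁, hφ.zero_cons, pull_zero]
    · refine pull_eq_zero_of_mem (hφ.cons _) hg (fun t ht => h _ (by simp [ht]) ?_) ?_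
      · rintro h
        rw [List.cons.injEq] at h
        rw [h.2] at ht
        simp at ht
      · rw [← hxy, ← List.cons_append, List.mem_append] at hw
        exact hw.resolve_left hx

end

end Word

open Word

namespace AInfHom

variable {V W U : Type*} [AddCommGroup V] [Module ℂ V] [AddCommGroup W] [Module ℂ W]
  [AddCommGroup U] [Module ℂ U] {gr : ℤ → Submodule ℂ V} {gr' : ℤ → Submodule ℂ W}
  {gr'' : ℤ → Submodule ℂ U} {X : AInfAlgebra gr} {Y : AInfAlgebra gr'} {Z : AInfAlgebra gr''}

lemma comp_linear (G : AInfHom Y Z) (F : AInfHom X Y) (x : V) :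
    (G.comp F).linear x = G.linear (F.linear x) := by
  rw [← bar_singleton, bar_comp, ← bar_singleton, ← bar_singleton]
  simp [pull_cons]

lemma IsStrictlyUnital.comp {G : AInfHom Y Z} {F : AInfHom X Y} {η : V} {θ : W} {ζ : U}
    (hG : G.IsStrictlyUnital θ ζ) (hF : F.IsStrictlyUnital η θ) (hη : η ∈ gr 0) (hθ : θ ∈ gr' 0) :
    (G.comp F).IsStrictlyUnital η ζ := by
  rw [isStrictlyUnital_iff _ hη, bar_singleton, comp_linear, hF.unit, hG.unit]
  rw [isStrictlyUnital_iff _ hη] at hF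
  rw [isStrictlyUnital_iff _ hθ] at hG
  refine ⟨rfl, fun w hw hw₁ => ?_⟩
  rw [bar_comp]
  refine pull_eq_zero_of_mem_of_ne G.multilin_bar hF.2 (fun t ht ht₁ => ?_) hw hw₁
  rw [hF.1] at ht ht₁
  exact hG.2 t ht ht₁

lemma isLinearMap_linear (F : AInfHom X Y) : IsLinearMap ℂ F.linear := by
  have h := F.multilin_bar.head []
  simp only [bar_singleton] at h
  exact h

/-- A strictly unital A∞-morphism from a unitally positive A∞-algebra has values in the unitally
positive part. -/
lemma f_mem_unitPos (F : AInfHom X Y) {η : V} {θ : W} (hF : F.IsStrictlyUnital η θ)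
    (hX : unitPosSubmodule gr η = ⊤) (n : ℕ) (a : Fin n → V) :
    F.f n a ∈ unitPosSubmodule gr' θ := by
  rw [unitPosSubmodule_eq_span] at hX ⊢
  refine multilinear_mem_of_span _ _ _ (fun a ha => ?_) a fun i => by rw [hX]; trivial
  by_cases hu : ∃ j, a j = η
  · by_cases hn : n = 1
    · subst hn
      have h : a = fun _ => η := by
        obtain ⟨j, hj⟩ := hu
        ext i
        rw [← hj, Subsingleton.elim i j]
      rw [h, show F.f 1 (fun _ => η) = θ from hF.unit]
      exact Submodule.subset_span (Or.inl rfl)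
    · rw [hF.eq_zero n hn a hu]
      exact Submodule.zero_mem _
  · rcases Nat.eq_zero_or_pos n with rfl | hn
    · rw [F.f_zero]; exact Submodule.zero_mem _
    have : ∀ i, ∃ k : ℤ, 0 < k ∧ a i ∈ gr k := fun i =>
      (ha i).resolve_left (fun h => hu ⟨i, h⟩)
    choose d hd hmem using this
    refine Submodule.subset_span (Or.inr ⟨_, ?_, F.f_mem n d a hmem⟩)
    -- With all degrees at least one, the degree `∑ d i + 1 - n` of the value is at least one.
    have : ∑ _i : Fin n, (1 : ℤ) ≤ ∑ i, d i := Finset.sum_le_sum fun i _ => hd i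
    simp at this
    omega

/-- Restrict the target of an A∞-morphism to the unitally positive subalgebra. -/
def codRestrictUnitPos (F : AInfHom X Y) {θ : W} (hθ : Y.IsStrictUnit θ)
    (hF : ∀ n a, F.f n a ∈ unitPosSubmodule gr' θ) : AInfHom X (Y.unitallyPositive hθ) where
  f n := (F.f n).codRestrict _ (hF n)
  f_zero := by
    ext a
    rw [MultilinearMap.codRestrict_apply_coe, F.f_zero]; rfl
  f_mem n d a ha := F.f_mem n d a ha
  rel n hn d a ha := by
    apply Subtype.ext
    have h := F.rel n hn d a ha
    simp only [nestSum, AddSubmonoidClass.coe_finsetSum] at h ⊢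
    convert h using 1
    · refine Finset.sum_congr rfl fun r _ => Finset.sum_congr rfl fun s _ => ?_
      rw [Units.smul_def, Units.smul_def, Submodule.coe_smul_of_tower]
      rfl
    · refine Finset.sum_congr rfl fun c _ => ?_
      rw [Units.smul_def, Units.smul_def, Submodule.coe_smul_of_tower]
      rfl

end AInfHom

/-! ### Morphisms of DG-algebras and the comparison A∞-morphism. -/

namespace DGAlgebra

variable {B₁ B₂ : Type*} [Ring B₁] [Algebra ℂ B₁] [Ring B₂] [Algebra ℂ B₂]
  (D₁ : DGAlgebra B₁) (D₂ : DGAlgebra B₂)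

/-- Morphisms of DG-algebras. -/
structure Hom extends B₁ →ₐ[ℂ] B₂ where
  map_mem : ∀ {k : ℤ} {x : B₁}, x ∈ D₁.gr k → toAlgHom x ∈ D₂.gr k
  map_d : ∀ x, toAlgHom (D₁.d x) = D₂.d (toAlgHom x)

variable {D₁ D₂} (φ : Hom D₁ D₂)

lemma Hom.map_sgn (x : B₁) : φ.toAlgHom (D₁.sgn x) = D₂.sgn (φ.toAlgHom x) := by
  have := D₁.sgn_comp D₂.internal φ.toAlgHom.toLinearMap 0
    (fun k x hx => by rw [add_zero]; exact φ.map_mem hx) x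
  rwa [Int.negOnePow_zero, one_smul] at this

/-- The composite of an A∞-morphism to a DG-algebra with a morphism of DG-algebras. -/
def Hom.compAInf {V : Type*} [AddCommGroup V] [Module ℂ V] {gr : ℤ → Submodule ℂ V}
    {X : AInfAlgebra gr} (F : AInfHom X D₁.toAInf) : AInfHom X D₂.toAInf :=
  AInfHom.ofBar (fun w => φ.toAlgHom (F.bar w)) (F.multilin_bar.comp φ.toAlgHom.toLinearMap)
    (by rw [F.bar_nil, map_zero])
    (F.hasDeg_bar.comp (L := φ.toAlgHom) (r := 0)
      (fun k x hx => by rw [add_zero]; exact φ.map_mem hx) rfl) fun w => by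
    rw [← map_coder _ _ φ.toAlgHom, F.coder_bar, Contraction.pull_bar_toAInf F.bar_nil,
      Contraction.pull_bar_toAInf (by rw [F.bar_nil, map_zero]), Coch.add_apply, Coch.add_apply,
      map_add, sq_def, sq_def, Coch.mul_apply, Coch.mul_apply, map_splitSum]
    simp only [map_mul, dC_apply, sC_apply, φ.map_d, φ.map_sgn, Coch.coe_mk]

lemma Hom.bar_compAInf {V : Type*} [AddCommGroup V] [Module ℂ V] {gr : ℤ → Submodule ℂ V}
    {X : AInfAlgebra gr} (F : AInfHom X D₁.toAInf) (w : List V) :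
    (φ.compAInf F).bar w = φ.toAlgHom (F.bar w) :=
  congrFun (AInfHom.bar_ofBar _ _ _ _ _) w

/-- A morphism of DG-algebras that is injective in cohomology and whose image contains the cocycles
of positive degree gives an A∞-isomorphism of minimal models onto the unitally positive part, if
the cohomology of the source is unitally positive. -/
theorem Hom.exists_isIso (hpos : unitPosSubmodule D₁.cohGr D₁.cohOne = ⊤)
    (hinj : ∀ z, D₁.d z = 0 → (∃ y, D₂.d y = φ.toAlgHom z) → ∃ y, D₁.d y = z)
    (hsurj : ∀ k : ℤ, 0 < k → ∀ z ∈ D₂.gr k, D₂.d z = 0 → ∃ x, D₁.d x = 0 ∧ φ.toAlgHom x = z)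
    (M : D₁.MinimalModel) (N : D₂.MinimalModel) :
    ∃ F : AInfHom M.alg N.unitallyPositive, F.IsIso := by
  have hG : (φ.compAInf M.i).IsStrictlyUnital D₁.cohOne 1 := by
    have h := (AInfHom.isStrictlyUnital_iff _ D₁.cohOne_mem).1 M.i_unital
    rw [AInfHom.isStrictlyUnital_iff _ D₁.cohOne_mem]
    refine ⟨by rw [φ.bar_compAInf, h.1, map_one], fun w hw hw₁ => ?_⟩
    rw [φ.bar_compAInf, h.2 w hw hw₁, map_zero]
  have hF := N.p_unital.comp hG D₁.cohOne_mem D₂.one_mem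
  set F := N.p.comp (φ.compAInf M.i) with hFdef
  -- The linear component is the map induced by `φ` in cohomology: the representative chosen by
  -- `M.i` differs from `z` by a coboundary, and `N.p` sends cocycles to their classes.
  have hlin : ∀ z (hz : D₁.d z = 0),
      F.linear (D₁.cls z hz) = D₂.cls (φ.toAlgHom z) (by rw [← φ.map_d, hz, map_zero]) := by
    intro z hz
    obtain ⟨hx, hx'⟩ := M.i_linear (D₁.cls z hz)
    rw [cls_eq_cls_iff] at hx'
    obtain ⟨y, hy⟩ := hx'
    have h₁ : (φ.compAInf M.i).linear (D₁.cls z hz) =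
        φ.toAlgHom (M.i.linear (D₁.cls z hz)) := by
      rw [← AInfHom.bar_singleton, φ.bar_compAInf, AInfHom.bar_singleton]
    rw [hFdef, AInfHom.comp_linear, h₁, N.p_linear _ (by rw [← φ.map_d, hx, map_zero]),
      cls_eq_cls_iff]
    exact ⟨φ.toAlgHom y, by rw [← φ.map_d, hy, map_sub]⟩
  have hmem := F.f_mem_unitPos hF hpos
  refine ⟨F.codRestrictUnitPos N.isStrictUnit hmem, fun x y hxy => ?_, fun u => ?_⟩
  · have hxy' : F.linear x = F.linear y := congrArg Subtype.val hxy
    obtain ⟨z, hz, rfl⟩ := D₁.exists_cls x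
    obtain ⟨z', hz', rfl⟩ := D₁.exists_cls y
    rw [hlin, hlin, cls_eq_cls_iff] at hxy'
    rw [cls_eq_cls_iff]
    exact hinj _ (by rw [map_sub, hz, hz', sub_zero]) (by rwa [map_sub])
  · have hu := (unitPosSubmodule_eq_span D₂.cohGr D₂.cohOne).le u.2
    -- Surjectivity is checked on generators: the unit is reached by strict unitality, and classes
    -- of positive degree by lifting cocycles.
    have hle : Submodule.span ℂ {x | x = D₂.cohOne ∨ ∃ k : ℤ, 0 < k ∧ x ∈ D₂.cohGr k} ≤
        LinearMap.range (F.isLinearMap_linear.mk' _) := by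
      rw [Submodule.span_le]
      rintro x (rfl | ⟨k, hk, ⟨z, hz⟩, hzk, rfl⟩)
      · exact ⟨D₁.cohOne, hF.unit⟩
      · obtain ⟨x, hx, rfl⟩ := hsurj k hk z hzk hz
        exact ⟨D₁.cls x hx, hlin x hx⟩
    obtain ⟨x, hx⟩ := hle hu
    exact ⟨x, Subtype.ext hx⟩

end DGAlgebra

/-! ### Cochains with values in a subcomplex -/

section Lifting

open CochainComplex CochainComplex.HomComplex

lemma Module.Projective.exists_lift_mem {R P L M : Type*} [Ring R] [AddCommGroup P] [Module R P]
    [AddCommGroup L] [Module R L] [AddCommGroup M] [Module R M] [Module.Projective R P]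
    (f : P →ₗ[R] M) (g : L →ₗ[R] M) (N : Submodule R L) (h : ∀ x, ∃ y ∈ N, g y = f x) :
    ∃ s : P →ₗ[R] L, (∀ x, g (s x) = f x) ∧ ∀ x, s x ∈ N := by
  have hf : ∀ x, f x ∈ N.map g := fun x => h x
  obtain ⟨s, hs⟩ := Module.projective_lifting_property (g.submoduleMap N)
    (f.codRestrict (N.map g) hf) (g.submoduleMap_surjective N)
  refine ⟨N.subtype.comp s, fun x => ?_, fun x => (s x).2⟩
  exact congrArg Subtype.val (LinearMap.congr_fun hs x)

variable {R : Type u} [Ring R]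

lemma CochainComplex.exists_d_eq_of_isZero_homology (K : CochainComplex (ModuleCat.{u} R) ℤ)
    {p q r : ℤ} (hp : p + 1 = q) (hr : q + 1 = r) (h : Limits.IsZero (K.homology q)) {x : K.X q}
    (hx : (K.d q r).hom x = 0) : ∃ y, (K.d p q).hom y = x := by
  rw [← K.exactAt_iff_isZero_homology, K.exactAt_iff' p q r (by simp; omega) (by simp; omega),
    ShortComplex.moduleCat_exact_iff] at h
  exact h x hx

variable {Q : CochainComplex (ModuleCat.{u} R) ℤ}

lemma CochainComplex.d_d_apply (K : CochainComplex (ModuleCat.{u} R) ℤ) (p q r : ℤ) (x : K.X p) :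
    (K.d q r).hom ((K.d p q).hom x) = 0 := by
  rw [← LinearMap.comp_apply, ← ModuleCat.hom_comp, K.d_comp_d]
  rfl

lemma CochainComplex.HomComplex.δ_v_apply {K L : CochainComplex (ModuleCat.{u} R) ℤ} {k m : ℤ}
    (hm : k + 1 = m) (z : Cochain K L k) {p q q₁ p₁ : ℤ} (hpq : p + m = q) (hq₁ : q₁ = q - 1)
    (hp₁ : p + 1 = p₁) (x : K.X p) :
    ((δ k m z).v p q hpq).hom x = (L.d q₁ q).hom ((z.v p q₁ (by omega)).hom x) +
      m.negOnePow • (z.v p₁ q (by omega)).hom ((K.d p p₁).hom x) := by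
  rw [δ_v k m hm z p q hpq q₁ p₁ hq₁ hp₁]
  rfl

/-- A cocycle with values in a graded submodule that is exact in the relevant degrees is the
coboundary of a cochain with values in the graded submodule. -/
lemma CochainComplex.HomComplex.exists_δ_eq {K : CochainComplex (ModuleCat.{u} R) ℤ} {n : ℕ}
    (hproj : ∀ k, Module.Projective R (Q.X k))
    (hzero : ∀ k : ℤ, ¬ (-(n : ℤ) < k ∧ k ≤ 0) → Limits.IsZero (Q.X k))
    (N : ∀ q, Submodule R (K.X q)) (hNd : ∀ p q, ∀ x ∈ N p, (K.d p q).hom x ∈ N q)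
    {j k : ℤ} (hjk : j + 1 = k)
    (hN : ∀ p q r s : ℤ, -(n : ℤ) < p → p ≤ 0 → p + k = r → q + 1 = r → r + 1 = s →
      ∀ x ∈ N r, (K.d r s).hom x = 0 → ∃ y ∈ N q, (K.d q r).hom y = x)
    (z : Cochain Q K k) (hz : δ k (k + 1) z = 0)
    (hzN : ∀ p q h x, (z.v p q h).hom x ∈ N q) :
    ∃ u : Cochain Q K j, δ j k u = z ∧ ∀ p q h x, (u.v p q h).hom x ∈ N q := by
  -- Induction down the resolution: `u` solves the equation on `Q^p` for `p > -m`. It starts with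
  -- zero, because `Q^p = 0` for `p > 0`, and stops at `m = n` for the same reason below.
  have key : ∀ m : ℕ, m ≤ n → ∃ u : Cochain Q K j, (∀ p q h x, (u.v p q h).hom x ∈ N q) ∧
      ∀ p q (h : p + k = q), -(m : ℤ) < p → (δ j k u).v p q h = z.v p q h := by
    intro m
    induction m with
    | zero =>
      intro _
      refine ⟨0, fun p q h x => by simp, fun p q h hp => ?_⟩
      exact (hzero p (by omega)).eq_of_src _ _
    | succ m ih =>
      intro hm
      obtain ⟨u, huN, hu⟩ := ih (by omega)
      have hwN : ∀ p q (h : p + k = q) x, ((z - δ j k u).v p q h).hom x ∈ N q := by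
        intro p q h x
        rw [Cochain.sub_v]
        refine Submodule.sub_mem _ (hzN p q h x) ?_
        rw [δ_v_apply hjk u h rfl rfl, Units.smul_def]
        exact Submodule.add_mem _ (hNd _ _ _ (huN _ _ _ _))
          (AddSubgroup.zsmul_mem (N q).toAddSubgroup (huN _ _ _ _) _)
      have hwd : δ k (k + 1) (z - δ j k u) = 0 := by rw [δ_sub, hz, δ_δ, sub_zero]
      have hp₁ : (z - δ j k u).v (-(m : ℤ) + 1) (-(m : ℤ) + 1 + k) rfl = 0 := by
        rw [Cochain.sub_v, hu _ _ _ (by omega), sub_self]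
      -- The remaining error at `p = -m` consists of cycles, because the error is a cocycle and
      -- vanishes at `p = -m + 1`. Exactness and projectivity then give the next component `s`.
      have hdw : ∀ x, (K.d (-(m : ℤ) + k) (-(m : ℤ) + 1 + k)).hom
          (((z - δ j k u).v (-(m : ℤ)) (-(m : ℤ) + k) rfl).hom x) = 0 := by
        intro x
        have h := δ_v_apply (m := k + 1) rfl (z - δ j k u) (p := -(m : ℤ)) (q := -(m : ℤ) + 1 + k)
          (by omega) (q₁ := -(m : ℤ) + k) (by omega) rfl x
        rw [hwd, hp₁] at h
        simpa using h.symm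
      have := hproj (-(m : ℤ))
      obtain ⟨s, hs, hsN⟩ := Module.Projective.exists_lift_mem
        ((z - δ j k u).v (-(m : ℤ)) (-(m : ℤ) + k) rfl).hom
        (K.d (-(m : ℤ) + j) (-(m : ℤ) + k)).hom (N (-(m : ℤ) + j)) fun x =>
          hN (-(m : ℤ)) _ _ (-(m : ℤ) + 1 + k) (by omega) (by omega) rfl (by omega) (by omega) _
            (hwN _ _ _ x) (hdw x)
      have hsing : ∀ p q (h : p + j = q), -(m : ℤ) < p →
          (Cochain.single (K := Q) (L := K) (ModuleCat.ofHom s) j).v p q h = 0 :=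
        fun p q h hp => Cochain.single_v_eq_zero _ _ _ _ _ (by omega)
      -- Adding a component at `-m` changes `δ u` only at `p = -m` and `p = -m - 1`, so the
      -- equations already solved are preserved.
      refine ⟨u + Cochain.single (ModuleCat.ofHom s) j, fun p q h x => ?_, fun p q h hp => ?_⟩
      · rw [Cochain.add_v]
        refine Submodule.add_mem _ (huN p q h x) ?_
        by_cases hp : p = -(m : ℤ)
        · subst hp
          obtain rfl : q = -(m : ℤ) + j := h.symm
          rw [Cochain.single_v]
          exact hsN x
        · rw [Cochain.single_v_eq_zero _ _ _ _ _ hp]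
          exact Submodule.zero_mem _
      · ext x
        rw [δ_add, Cochain.add_v]
        change ((δ j k u).v p q h).hom x + _ = _
        rw [δ_v_apply hjk (Cochain.single _ _) h (q₁ := p + j) (by omega) rfl,
          hsing (p + 1) q _ (by omega)]
        by_cases hp' : -(m : ℤ) < p
        · rw [hsing p _ _ hp', hu _ _ _ hp']
          simp
        · obtain rfl : p = -(m : ℤ) := by push_cast at hp; omega
          subst h
          rw [Cochain.single_v]
          have := hs x
          rw [Cochain.sub_v] at this
          change _ = _ - ((δ j k u).v _ _ _).hom x at this
          simp only [ModuleCat.hom_ofHom, ModuleCat.hom_zero, LinearMap.zero_apply, smul_zero,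
            add_zero, this]
          abel
  obtain ⟨u, huN, hu⟩ := key n le_rfl
  refine ⟨u, ?_, huN⟩
  ext1 p q h
  by_cases hp : -(n : ℤ) < p
  · exact hu p q h hp
  · exact (hzero p (by omega)).eq_of_src _ _

end Lifting

/-! ### Endomorphisms of a projective resolution -/

section Resolution

open CochainComplex CochainComplex.HomComplex

variable {R : Type u} [Ring R] {Q L : CochainComplex (ModuleCat.{u} R) ℤ} (ε : Q ⟶ L)

lemma HomologicalComplex.Hom.comm_apply_moduleCat (p q : ℤ) (x : Q.X p) :
    (ε.f q).hom ((Q.d p q).hom x) = (L.d p q).hom ((ε.f p).hom x) := by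
  rw [← LinearMap.comp_apply, ← ModuleCat.hom_comp, ← ε.comm]
  rfl

lemma ModuleCat.eq_zero_of_isZero {M : ModuleCat.{u} R} (h : Limits.IsZero M) (x : M) : x = 0 :=
  (ModuleCat.subsingleton_of_isZero h).elim _ _

namespace CochainComplex

variable {ε}

lemma exists_d_eq_of_ne_zero (hε : QuasiIso ε) (hL : ∀ q ≠ 0, Limits.IsZero (L.X q))
    {p q r : ℤ} (hp : p + 1 = q) (hr : q + 1 = r) (hq : q ≠ 0) {x : Q.X q}
    (hx : (Q.d q r).hom x = 0) : ∃ y, (Q.d p q).hom y = x := by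
  refine Q.exists_d_eq_of_isZero_homology hp hr ?_ hx
  rw [← Q.exactAt_iff_isZero_homology, exactAt_iff_of_quasiIsoAt ε, HomologicalComplex.exactAt_iff]
  exact ShortComplex.exact_of_isZero_X₂ _ (hL q hq)

lemma exact_augmentation (hε : QuasiIso ε) (hL : ∀ q ≠ 0, Limits.IsZero (L.X q))
    (hQ : ∀ q : ℤ, 0 < q → Limits.IsZero (Q.X q)) : (ShortComplex.mk (Q.d (-1) 0) (ε.f 0) (by
      rw [← ε.comm, (hL (-1) (by decide)).eq_of_tgt (ε.f (-1)) 0, Limits.zero_comp])).Exact ∧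
    Epi (ε.f 0) := by
  have h : QuasiIsoAt ε 0 := inferInstance
  rw [quasiIsoAt_iff' ε (-1) 0 1 (by simp) (by simp)] at h
  exact (ShortComplex.quasiIso_iff_of_zeros' _ ((hQ 1 one_pos).eq_of_tgt _ _)
    ((hL (-1) (by decide)).eq_of_src _ _) ((hL 1 (by decide)).eq_of_tgt _ _)).1 h

lemma augmentation_d (hL : ∀ q ≠ 0, Limits.IsZero (L.X q)) (p : ℤ) (x : Q.X p) :
    (ε.f 0).hom ((Q.d p 0).hom x) = 0 := by
  rw [ε.comm_apply_moduleCat]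
  by_cases hp : p + 1 = 0
  · rw [ModuleCat.eq_zero_of_isZero (hL p (by omega)) ((ε.f p).hom x), map_zero]
  · rw [L.shape _ _ hp]; rfl

lemma exists_d_eq_of_augmentation (hε : QuasiIso ε) (hL : ∀ q ≠ 0, Limits.IsZero (L.X q))
    (hQ : ∀ q : ℤ, 0 < q → Limits.IsZero (Q.X q)) {x : Q.X 0} (hx : (ε.f 0).hom x = 0) :
    ∃ y, (Q.d (-1) 0).hom y = x :=
  (ShortComplex.moduleCat_exact_iff _).1 (exact_augmentation hε hL hQ).1 x hx

lemma augmentation_surjective (hε : QuasiIso ε) (hL : ∀ q ≠ 0, Limits.IsZero (L.X q))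
    (hQ : ∀ q : ℤ, 0 < q → Limits.IsZero (Q.X q)) : Function.Surjective (ε.f 0).hom :=
  (ModuleCat.epi_iff_surjective _).1 (exact_augmentation hε hL hQ).2

namespace HomComplex

/-- A cocycle of the endomorphism complex of a resolution whose composite with the augmentation is a
coboundary is a coboundary. -/
lemma exists_δ_eq_of_augmentation (hε : QuasiIso ε) (hL : ∀ q ≠ 0, Limits.IsZero (L.X q))
    (hQ : ∀ q : ℤ, 0 < q → Limits.IsZero (Q.X q)) {n : ℕ} (hproj : ∀ k, Module.Projective R (Q.X k))
    (hzero : ∀ k : ℤ, ¬ (-(n : ℤ) < k ∧ k ≤ 0) → Limits.IsZero (Q.X k)) {j k : ℤ} (hjk : j + 1 = k)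
    (z : Cochain Q Q k) (hz : δ k (k + 1) z = 0) {p p₁ : ℤ} (hp : p + k = 0) (hp₁ : p + 1 = p₁)
    (v : Q.X p₁ →ₗ[R] L.X 0)
    (hv : ∀ x, (ε.f 0).hom ((z.v p 0 hp).hom x) = v ((Q.d p p₁).hom x)) :
    ∃ u : Cochain Q Q j, δ j k u = z := by
  have := hproj p₁
  obtain ⟨w, hw⟩ := Module.projective_lifting_property _ v (augmentation_surjective hε hL hQ)
  -- A lift of `v` through the augmentation. The sign cancels the one in `δ`, so that the
  -- augmentation composed with `δ t` is `v ∘ d`.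
  let t : Cochain Q Q j := k.negOnePow • Cochain.single (p := p₁) (q := 0) (ModuleCat.ofHom w) j
  have ht : ∀ x, (ε.f 0).hom (((δ j k t).v p 0 hp).hom x) = v ((Q.d p p₁).hom x) := by
    intro x
    rw [δ_v_apply hjk t hp (q₁ := -1) (by decide) hp₁, map_add, augmentation_d hL, zero_add]
    simp only [t]
    rw [Cochain.units_smul_v, Cochain.single_v _ _ (by omega)]
    change (ε.f 0).hom (k.negOnePow • k.negOnePow • w _) = _
    rw [smul_smul, ← Int.negOnePow_add, Int.negOnePow_even _ (Even.add_self k), one_smul]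
    exact LinearMap.congr_fun hw _
  -- After this correction the cocycle has values in the kernel of the augmentation, which is
  -- acyclic.
  have hu : ∃ u : Cochain Q Q j, δ j k u = z - δ j k t ∧
      ∀ p q h x, (u.v p q h).hom x ∈ LinearMap.ker (ε.f q).hom := by
    refine exists_δ_eq hproj hzero (fun q => LinearMap.ker (ε.f q).hom)
      (fun p q x hx => by
        rw [LinearMap.mem_ker] at hx ⊢
        rw [ε.comm_apply_moduleCat, hx, map_zero]) hjk (fun p' q r s _ _ _ hq hs x hx hdx => ?_)
      (z - δ j k t) (by rw [δ_sub, hz, δ_δ, sub_zero]) fun p' q h x => ?_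
    · rcases lt_trichotomy r 0 with hr | hr | hr
      · obtain ⟨y, hy⟩ := exists_d_eq_of_ne_zero hε hL hq hs hr.ne hdx
        exact ⟨y, ModuleCat.eq_zero_of_isZero (hL q (by omega)) _, hy⟩
      · subst hr
        obtain rfl : q = -1 := by omega
        obtain ⟨y, hy⟩ := exists_d_eq_of_augmentation hε hL hQ hx
        exact ⟨y, ModuleCat.eq_zero_of_isZero (hL _ (by decide)) _, hy⟩
      · refine ⟨0, Submodule.zero_mem _, ?_⟩
        rw [map_zero, ModuleCat.eq_zero_of_isZero (hQ r hr) x]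
    · rw [LinearMap.mem_ker]
      by_cases hq : q = 0
      · subst hq
        obtain rfl : p' = p := by omega
        rw [Cochain.sub_v]
        change (ε.f 0).hom ((z.v p' 0 h).hom x - ((δ j k t).v p' 0 h).hom x) = 0
        rw [map_sub, ht, hv, sub_self]
      · exact ModuleCat.eq_zero_of_isZero (hL q hq) _
  obtain ⟨u, hu, -⟩ := hu
  exact ⟨u + t, by rw [δ_add, hu, sub_add_cancel]⟩

/-- A component of negative degree with target `Q^0` has source in positive degree, which is zero.
There is thus nothing to cobound after augmentation. -/
lemma exists_δ_eq_of_neg (hε : QuasiIso ε) (hL : ∀ q ≠ 0, Limits.IsZero (L.X q))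
    (hQ : ∀ q : ℤ, 0 < q → Limits.IsZero (Q.X q)) {n : ℕ} (hproj : ∀ k, Module.Projective R (Q.X k))
    (hzero : ∀ k : ℤ, ¬ (-(n : ℤ) < k ∧ k ≤ 0) → Limits.IsZero (Q.X k)) {j k : ℤ} (hjk : j + 1 = k)
    (hk : k < 0) (z : Cochain Q Q k) (hz : δ k (k + 1) z = 0) :
    ∃ u : Cochain Q Q j, δ j k u = z :=
  exists_δ_eq_of_augmentation hε hL hQ hproj hzero hjk z hz (p := -k) (by omega) rfl 0
    fun x => by rw [ModuleCat.eq_zero_of_isZero (hQ (-k) (by omega)) x]; simp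

/-- A cocycle of degree zero induces an endomorphism of the cokernel `L^0` of `Q^{-1} → Q^0`, a
scalar `c`. The difference with `c` times the identity is zero after augmentation, hence a
coboundary. -/
lemma exists_δ_eq_sub_smul (hε : QuasiIso ε) (hL : ∀ q ≠ 0, Limits.IsZero (L.X q))
    (hQ : ∀ q : ℤ, 0 < q → Limits.IsZero (Q.X q)) {n : ℕ} [Algebra ℂ R]
    (hproj : ∀ k, Module.Projective R (Q.X k))
    (hzero : ∀ k : ℤ, ¬ (-(n : ℤ) < k ∧ k ≤ 0) → Limits.IsZero (Q.X k))
    (hend : ∀ f : L.X 0 ⟶ L.X 0, ∃ c : ℂ, f = c • 𝟙 _) (z : Cochain Q Q 0)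
    (hz : δ 0 1 z = 0) :
    ∃ c : ℂ, ∃ u : Cochain Q Q (-1), δ (-1) 0 u = z - c • Cochain.ofHom (𝟙 Q) := by
  obtain ⟨hex, hepi⟩ := exact_augmentation hε hL hQ
  set T := ShortComplex.mk (Q.d (-1) 0) (ε.f 0) _ with hT
  have hT' : Epi T.g := hepi
  have hd : Q.d (-1) 0 ≫ z.v 0 0 (add_zero 0) ≫ ε.f 0 = 0 := by
    have h := Cochain.congr_v hz (-1) 0 (by decide)
    rw [δ_v 0 1 rfl z (-1) 0 (by decide) (-1) 0 (by decide) (by decide)] at h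
    have h' := congrArg (· ≫ ε.f 0) h
    have h₀ : Q.d (-1) 0 ≫ ε.f 0 = 0 := by
      ext x
      exact augmentation_d hL (-1) x
    simpa [h₀, Int.negOnePow_one] using h'
  obtain ⟨c, hc⟩ := hend (hex.desc (z.v 0 0 (add_zero 0) ≫ ε.f 0) hd)
  have hc' : z.v 0 0 (add_zero 0) ≫ ε.f 0 = c • ε.f 0 := by
    have := hex.g_desc (z.v 0 0 (add_zero 0) ≫ ε.f 0) hd
    rw [hc] at this
    rw [← this, Linear.comp_smul, Category.comp_id]
  refine ⟨c, exists_δ_eq_of_augmentation hε hL hQ hproj hzero (by decide) _ ?_ (p := 0) rfl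
    rfl 0 fun x => ?_⟩
  · rw [δ_sub, δ_smul, δ_ofHom, smul_zero, sub_zero]
    exact hz
  · have := congrArg (fun f => f.hom x) hc'
    rw [Cochain.sub_v, Cochain.smul_v, Cochain.ofHom_v]
    change (ε.f 0).hom ((z.v 0 0 _).hom x - algebraMap ℂ R c • x) = _
    rw [map_sub, map_smul]
    change (ε.f 0).hom ((z.v 0 0 _).hom x) = algebraMap ℂ R c • (ε.f 0).hom x at this
    rw [this]
    simp

/-- On `Q^0` a coboundary is `d ∘ u`, as `Q^1 = 0`, and this is killed by the augmentation. The
identity is not, since the augmentation is onto a nonzero module. -/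
lemma δ_ne_id (hε : QuasiIso ε) (hL : ∀ q ≠ 0, Limits.IsZero (L.X q))
    (hQ : ∀ q : ℤ, 0 < q → Limits.IsZero (Q.X q)) [Nontrivial (L.X 0)] (u : Cochain Q Q (-1)) :
    δ (-1) 0 u ≠ Cochain.ofHom (𝟙 Q) := by
  intro h
  obtain ⟨y, hy⟩ := exists_ne (0 : L.X 0)
  obtain ⟨x, rfl⟩ := augmentation_surjective hε hL hQ y
  refine hy ?_
  have h₁ := congrArg (fun f => f.hom x) (Cochain.congr_v h 0 0 (add_zero 0))
  simp only [δ_v_apply (show (-1 : ℤ) + 1 = 0 by decide) u (add_zero 0) (q₁ := -1) (by decide) rfl,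
    Cochain.ofHom_v] at h₁
  rw [ModuleCat.eq_zero_of_isZero (hQ (0 + 1) (by decide)) ((Q.d 0 (0 + 1)).hom x), map_zero,
    smul_zero, add_zero] at h₁
  have h₂ := congrArg (ε.f 0).hom h₁
  rw [augmentation_d hL] at h₂
  exact h₂.symm

end HomComplex

end CochainComplex

end Resolution

/-! ### Endomorphisms and extension of scalars -/

section

universe v

open CochainComplex CochainComplex.HomComplex

namespace IStar

variable {A : Type u} [Ring A] (e : A) {M N L : Type v} [AddCommGroup M] [Module Aᵐᵒᵖ M]
  [AddCommGroup N] [Module Aᵐᵒᵖ N] [AddCommGroup L] [Module Aᵐᵒᵖ L]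

/-- The composite of the quotient map with a map of right `A_con`-modules, as a map of right
`A`-modules. -/
def restrict (f : IStar e M →ₗ[(Acon e)ᵐᵒᵖ] IStar e N) : M →ₗ[Aᵐᵒᵖ] N ⧸ traceSubmodule e N where
  toFun x := f (mk e M x)
  map_add' x y := by
    rw [map_add, map_add]; rfl
  map_smul' a x := by
    obtain ⟨y, hy⟩ := mk_surjective e (f (mk e M x))
    have h : f (mk e M (a • x)) = (op (a.unop : Acon e) : (Acon e)ᵐᵒᵖ) • f (mk e M x) := by
      rw [← map_smul]; rfl
    rw [h, ← hy]
    rfl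

lemma exists_lift [Module.Projective Aᵐᵒᵖ M] (f : IStar e M →ₗ[(Acon e)ᵐᵒᵖ] IStar e N) :
    ∃ s : M →ₗ[Aᵐᵒᵖ] N, ∀ x, mk e N (s x) = f (mk e M x) := by
  obtain ⟨s, hs⟩ := Module.projective_lifting_property (traceSubmodule e N).mkQ (restrict e f)
    (traceSubmodule e N).mkQ_surjective
  exact ⟨s, fun x => LinearMap.congr_fun hs x⟩

/-- The composite `M → i^*M → i^*N → L`, where `a` descends to the quotient. It is described through
representatives because `f` need not lift to `N`. -/
lemma exists_desc (a : N →ₗ[Aᵐᵒᵖ] L) (ha : ∀ y ∈ traceSubmodule e N, a y = 0)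
    (f : IStar e M →ₗ[(Acon e)ᵐᵒᵖ] IStar e N) :
    ∃ s : M →ₗ[Aᵐᵒᵖ] L, ∀ x y, f (mk e M x) = mk e N y → s x = a y := by
  refine ⟨((traceSubmodule e N).liftQ a ha).comp (restrict e f), fun x y hxy => ?_⟩
  change (traceSubmodule e N).liftQ a ha (f (mk e M x)) = a y
  rw [hxy]
  rfl

lemma map_mem_traceSubmodule (f : M →ₗ[Aᵐᵒᵖ] N) {x : M} (hx : x ∈ traceSubmodule e M) :
    f x ∈ traceSubmodule e N := by
  rw [← mk_eq_zero_iff] at hx ⊢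
  rw [← map_mk, hx, map_zero]

lemma traceSubmodule_eq_bot [IsSimpleModule Aᵐᵒᵖ M] [Nontrivial (IStar e M)] :
    traceSubmodule e M = ⊥ := by
  refine (eq_bot_or_eq_top _).resolve_right fun h => ?_
  obtain ⟨y, hy⟩ := exists_ne (0 : IStar e M)
  obtain ⟨x, rfl⟩ := mk_surjective e y
  exact hy ((mk_eq_zero_iff e x).2 (h ▸ Submodule.mem_top))

end IStar

variable {A : Type u} [Ring A] (e : A)

instance [Algebra ℂ A] : (iStar.{u, v} e).Linear ℂ where
  map_smul {M N} f r := by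
    ext x
    obtain ⟨m, rfl⟩ := IStar.mk_surjective e x
    rfl

variable {Q L : CochainComplex (ModuleCat.{u} Aᵐᵒᵖ) ℤ} {ε : Q ⟶ L}

namespace CochainComplex.HomComplex

/-- A cocycle of the endomorphism complex of a resolution is a coboundary if it becomes one after
extension of scalars, provided that the extension of scalars does not change the resolved module. -/
lemma exists_δ_eq_of_map_iStar (hε : QuasiIso ε) (hL : ∀ q ≠ 0, Limits.IsZero (L.X q))
    (hQ : ∀ q : ℤ, 0 < q → Limits.IsZero (Q.X q)) {n : ℕ}
    (hproj : ∀ k, Module.Projective Aᵐᵒᵖ (Q.X k))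
    (hzero : ∀ k : ℤ, ¬ (-(n : ℤ) < k ∧ k ≤ 0) → Limits.IsZero (Q.X k))
    (htr : ∀ x ∈ traceSubmodule e (Q.X 0), (ε.f 0).hom x = 0) {j k : ℤ} (hjk : j + 1 = k)
    (z : Cochain Q Q k) (hz : δ k (k + 1) z = 0)
    (y : Cochain (iStarComplex e Q) (iStarComplex e Q) j) (hy : δ j k y = z.map (iStar e)) :
    ∃ u : Cochain Q Q j, δ j k u = z := by
  -- The component of `y` with target `i^*Q^0`, followed by the augmentation, cobounds the composite
  -- of `z` with the augmentation. The other term `d ∘ y` of `δ y` is killed by the augmentation.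
  obtain ⟨v, hv⟩ := IStar.exists_desc e (ε.f 0).hom htr (y.v (-k + 1) 0 (by omega)).hom
  refine exists_δ_eq_of_augmentation hε hL hQ hproj hzero hjk z hz (p := -k) (by omega) rfl
    (k.negOnePow • v) fun x => ?_
  obtain ⟨w₁, hw₁⟩ := IStar.mk_surjective e
    ((y.v (-k) (-1) (by omega)).hom (IStar.mk e (Q.X (-k)) x))
  obtain ⟨w₂, hw₂⟩ := IStar.mk_surjective e ((y.v (-k + 1) 0 (by omega)).hom
    (IStar.mk e (Q.X (-k + 1)) ((Q.d (-k) (-k + 1)).hom x)))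
  have h := δ_v_apply hjk y (p := -k) (q := 0) (by omega) (q₁ := -1) (by decide) rfl
    (IStar.mk e (Q.X (-k)) x)
  have h₁ : IStar.mk e (Q.X 0) ((z.v (-k) 0 (by omega)).hom x) =
      IStar.mk e (Q.X 0) ((Q.d (-1) 0).hom w₁ + k.negOnePow • w₂) := by
    rw [hy, ← hw₁] at h
    refine h.trans ?_
    rw [map_add, Units.smul_def, Units.smul_def, map_zsmul, hw₂]
    rfl
  have h₀ : (z.v (-k) 0 (by omega)).hom x - ((Q.d (-1) 0).hom w₁ + k.negOnePow • w₂) ∈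
      traceSubmodule e (Q.X 0) := by
    rw [← IStar.mk_eq_zero_iff, map_sub, h₁, sub_self]
  have h₂ := htr _ h₀
  rw [map_sub, map_add, augmentation_d hL, zero_add, sub_eq_zero] at h₂
  rw [h₂, Units.smul_def, map_zsmul, ← hv _ _ hw₂.symm]
  rfl

/-- Every cocycle of positive degree lifts along the extension of scalars. -/
lemma exists_map_iStar_eq (hε : QuasiIso ε) (hL : ∀ q ≠ 0, Limits.IsZero (L.X q))
    (hQ : ∀ q : ℤ, 0 < q → Limits.IsZero (Q.X q)) {n : ℕ}
    (hproj : ∀ k, Module.Projective Aᵐᵒᵖ (Q.X k))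
    (hzero : ∀ k : ℤ, ¬ (-(n : ℤ) < k ∧ k ≤ 0) → Limits.IsZero (Q.X k))
    (htr : ∀ x ∈ traceSubmodule e (Q.X 0), (ε.f 0).hom x = 0)
    (hP : ∀ q : ℤ, 1 - (n : ℤ) < q → q < 0 → Limits.IsZero ((iStarComplex e Q).homology q))
    {k : ℤ} (hk : 0 < k) (z : Cochain (iStarComplex e Q) (iStarComplex e Q) k)
    (hz : δ k (k + 1) z = 0) :
    ∃ x : Cochain Q Q k, δ k (k + 1) x = 0 ∧ x.map (iStar e) = z := by
  have hlift : ∀ p q (h : p + k = q), ∃ s : Q.X p →ₗ[Aᵐᵒᵖ] Q.X q,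
      ∀ x, IStar.mk e _ (s x) = (z.v p q h).hom (IStar.mk e _ x) := fun p q h => by
    have := hproj p
    exact IStar.exists_lift e (z.v p q h).hom
  choose s hs using hlift
  let t : Cochain Q Q k := Cochain.mk fun p q h => ModuleCat.ofHom (s p q h)
  have ht : t.map (iStar e) = z := by
    ext p q h x
    obtain ⟨x, rfl⟩ := IStar.mk_surjective e x
    exact hs p q h x
  -- The degreewise lift `t` need not be a cocycle, but `i^*(δ t) = δ z = 0`.
  have htN : ∀ p q h x, ((δ k (k + 1) t).v p q h).hom x ∈ traceSubmodule e (Q.X q) := by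
    intro p q h x
    rw [← IStar.mk_eq_zero_iff]
    have h₁ : (δ k (k + 1) t).map (iStar e) = 0 := by rw [← δ_map, ht, hz]
    have h₂ := congrArg (fun f => f.hom (IStar.mk e (Q.X p) x)) (Cochain.congr_v h₁ p q h)
    exact h₂
  have hu : ∃ u : Cochain Q Q k, δ k (k + 1) u = δ k (k + 1) t ∧
      ∀ p q h x, (u.v p q h).hom x ∈ traceSubmodule e (Q.X q) := by
    refine exists_δ_eq hproj hzero (fun q => traceSubmodule e (Q.X q))
      (fun p q x hx => IStar.map_mem_traceSubmodule e _ hx) rfl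
      (fun p q r s hp hp₀ hr hq hs x hx hdx => ?_) _ (δ_δ _ _ _ _) htN
    rcases lt_or_ge 0 r with hr₀ | hr₀
    · refine ⟨0, Submodule.zero_mem _, ?_⟩
      rw [map_zero, ModuleCat.eq_zero_of_isZero (hQ r hr₀) x]
    · obtain ⟨y, rfl⟩ : ∃ y, (Q.d q r).hom y = x := by
        rcases hr₀.lt_or_eq with hr₁ | rfl
        · exact exists_d_eq_of_ne_zero hε hL hq hs hr₁.ne hdx
        · obtain rfl : q = -1 := by omega
          exact exists_d_eq_of_augmentation hε hL hQ (htr x hx)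
      -- The connecting map: a preimage `y` of `x` under `d` becomes a cycle in `i^*Q`. Here `q = p
      -- + k` with `p > -n` and `k > 0`, and `q = r - 1 < 0`, so this cycle bounds. Subtracting `d
      -- w` moves `y` into `Q · AeA` without changing its boundary.
      have hy : ((iStarComplex e Q).d q r).hom (IStar.mk e (Q.X q) y) = 0 :=
        (IStar.mk_eq_zero_iff e _).2 hx
      obtain ⟨w, hw⟩ := (iStarComplex e Q).exists_d_eq_of_isZero_homology
        (sub_add_cancel q 1) hq (hP q (by omega) (by omega)) hy
      obtain ⟨w, rfl⟩ := IStar.mk_surjective e w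
      refine ⟨y - (Q.d (q - 1) q).hom w, (IStar.mk_eq_zero_iff e _).1 ?_, ?_⟩
      · rw [map_sub, sub_eq_zero]
        exact hw.symm
      · rw [map_sub, d_d_apply, sub_zero]
  obtain ⟨u, hu, huN⟩ := hu
  refine ⟨t - u, by rw [δ_sub, hu, sub_self], ?_⟩
  have : u.map (iStar e) = 0 := by
    ext p q h x
    obtain ⟨x, rfl⟩ := IStar.mk_surjective e x
    exact (IStar.mk_eq_zero_iff e _).2 (huN p q h x)
  rw [Cochain.map_sub, ht, this, sub_zero]

end CochainComplex.HomComplex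

end

/-! ### Functoriality of the endomorphism DG-algebra -/

section EndMap

open CochainComplex CochainComplex.HomComplex

universe w w' u'

variable {C : Type u} [Category.{w} C] [Preadditive C] [Linear ℂ C]
  {C' : Type u'} [Category.{w'} C'] [Preadditive C'] [Linear ℂ C'] (F : C ⥤ C') [F.Additive]
  [F.Linear ℂ] (K : CochainComplex C ℤ)

/-- The action of a linear functor on cochains. -/
def EndDeg.map (k : ℤ) :
    EndDeg K k →ₗ[ℂ] EndDeg ((F.mapHomologicalComplex (ComplexShape.up ℤ)).obj K) k where
  toFun z := Cochain.map z F
  map_add' z z' := Cochain.map_add z z' F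
  map_smul' c z := by
    ext p q h
    exact Functor.map_smul F c _

/-- The morphism of endomorphism algebras given by a linear functor. -/
def EndAlg.map : EndAlg K →ₐ[ℂ] EndAlg ((F.mapHomologicalComplex (ComplexShape.up ℤ)).obj K) :=
  DirectSum.toAlgebra ℂ _
    (fun k => (DirectSum.lof ℂ ℤ (EndDeg _) k).comp (EndDeg.map F K k))
    (by
      change DirectSum.of (EndDeg _) 0 (Cochain.map (Cochain.ofHom (𝟙 K)) F) = _
      rw [Cochain.map_ofHom, CategoryTheory.Functor.map_id]
      rfl)
    (fun {i j} x y => by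
      change DirectSum.of (EndDeg _) (i + j) (Cochain.map (Cochain.comp y x (add_comm j i)) F) =
        DirectSum.of (EndDeg _) i (Cochain.map x F) * DirectSum.of (EndDeg _) j (Cochain.map y F)
      rw [Cochain.map_comp, DirectSum.of_mul_of]
      rfl)

lemma EndAlg.map_of (k : ℤ) (x : EndDeg K k) :
    EndAlg.map F K (DirectSum.of (EndDeg K) k x) = DirectSum.of (EndDeg _) k (Cochain.map x F) :=
  DirectSum.toAddMonoid_of
    (fun k => ((DirectSum.lof ℂ ℤ (EndDeg _) k).comp (EndDeg.map F K k)).toAddMonoidHom) k x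

lemma EndAlg.map_apply (x : EndAlg K) (k : ℤ) : EndAlg.map F K x k = Cochain.map (x k) F := by
  induction x using DirectSum.induction_on with
  | zero => rw [map_zero]; exact (Cochain.map_zero K K k F).symm
  | of j x =>
    rw [EndAlg.map_of]
    by_cases h : j = k
    · subst h
      rw [DirectSum.of_eq_same, DirectSum.of_eq_same]
    · rw [DirectSum.of_eq_of_ne _ _ _ (Ne.symm h), DirectSum.of_eq_of_ne _ _ _ (Ne.symm h)]
      exact (Cochain.map_zero K K k F).symm
  | add x y hx hy =>
    rw [map_add, DirectSum.add_apply, hx, hy, DirectSum.add_apply]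
    exact (Cochain.map_add _ _ F).symm

lemma endD_apply (x : EndAlg K) {j k : ℤ} (h : j + 1 = k) : endD K x k = δ j k (x j) := by
  subst h
  induction x using DirectSum.induction_on with
  | zero => rw [map_zero]; exact (δ_zero _ _).symm
  | of i x =>
    rw [endD_of]
    by_cases h : i = j
    · subst h
      rw [DirectSum.of_eq_same, DirectSum.of_eq_same]
    · rw [DirectSum.of_eq_of_ne _ _ _ (by omega), DirectSum.of_eq_of_ne _ _ _ (Ne.symm h)]
      exact (δ_zero _ _).symm
  | add x y hx hy =>
    rw [map_add, DirectSum.add_apply, hx, hy, DirectSum.add_apply, δ_add]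

/-- The morphism of endomorphism DG-algebras given by a linear functor. -/
def endMap : DGAlgebra.Hom (endDG K)
    (endDG ((F.mapHomologicalComplex (ComplexShape.up ℤ)).obj K)) where
  toAlgHom := EndAlg.map F K
  map_mem := by
    rintro k _ ⟨x, rfl⟩
    exact ⟨Cochain.map x F, (EndAlg.map_of F K k x).symm⟩
  map_d x := by
    change EndAlg.map F K (endD K x) = endD _ (EndAlg.map F K x)
    induction x using DirectSum.induction_on with
    | zero => simp only [map_zero]
    | of k x => rw [endD_of, EndAlg.map_of, EndAlg.map_of, endD_of, δ_map]
    | add x y hx hy => simp only [map_add, hx, hy]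

/-- An element of the direct sum has finitely many components, so they can be cobounded one by one.
-/
lemma mem_range_endD {x : EndAlg K} (h : ∀ k, ∃ u : EndDeg K (k - 1), δ (k - 1) k u = x k) :
    ∃ y, endD K y = x := by
  classical
  change x ∈ LinearMap.range (endD K)
  rw [← DirectSum.sum_support_of x]
  refine Submodule.sum_mem _ fun k _ => ?_
  obtain ⟨u, hu⟩ := h k
  refine ⟨DirectSum.of (EndDeg K) (k - 1) u, ?_⟩
  rw [endD_of, ← hu]
  exact EndAlg.of_eq K (sub_add_cancel k 1) _ _ fun p q hp hq => by
    simp [δ_v (k - 1) _ (sub_add_cancel k 1) u p q hq (q - 1) (p + 1) rfl rfl,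
      δ_v (k - 1) _ rfl u p q hp (q - 1) (p + 1) rfl rfl]

end EndMap

/-! ### The cohomology of the endomorphism DG-algebra of a resolution. -/

section EndResolution

open CochainComplex CochainComplex.HomComplex

universe w

section

variable {C : Type u} [Category.{w} C] [Preadditive C] (K : CochainComplex C ℤ)

lemma EndAlg.one_apply : (1 : EndAlg K) 0 = Cochain.ofHom (𝟙 K) := DirectSum.of_eq_same _ _

lemma endDG_cohOne_ne_zero [Linear ℂ C]
    (h : ∀ u : Cochain K K (-1), δ (-1) 0 u ≠ Cochain.ofHom (𝟙 K)) :
    (endDG K).cohOne ≠ 0 := by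
  intro h₁
  obtain ⟨y, hy⟩ := ((endDG K).cls_eq_zero_iff _).1 h₁
  refine h (y (-1)) ?_
  rw [← EndAlg.one_apply, ← hy]
  exact (endD_apply K y (by decide)).symm

end

variable {R : Type u} [Ring R] [Algebra ℂ R] {Q L : CochainComplex (ModuleCat.{u} R) ℤ} {ε : Q ⟶ L}

/-- The cohomology of the endomorphism DG-algebra of a resolution of a brick. -/
lemma unitPosSubmodule_endDG (hε : QuasiIso ε) (hL : ∀ q ≠ 0, Limits.IsZero (L.X q))
    (hQ : ∀ q : ℤ, 0 < q → Limits.IsZero (Q.X q)) {n : ℕ}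
    (hproj : ∀ k, Module.Projective R (Q.X k))
    (hzero : ∀ k : ℤ, ¬ (-(n : ℤ) < k ∧ k ≤ 0) → Limits.IsZero (Q.X k))
    (hend : ∀ f : L.X 0 ⟶ L.X 0, ∃ c : ℂ, f = c • 𝟙 _)
    (hint : DirectSum.IsInternal (endDG Q).cohGr) :
    unitPosSubmodule (endDG Q).cohGr (endDG Q).cohOne = ⊤ := by
  rw [eq_top_iff, ← hint.submodule_iSup_eq_top]
  refine iSup_le fun k => ?_
  rcases lt_or_ge 0 k with hk | hk
  · exact (le_iSup (fun k : {k : ℤ // 0 < k} => (endDG Q).cohGr k) ⟨k, hk⟩).trans le_sup_right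
  rintro _ ⟨⟨_, hz⟩, ⟨z, rfl⟩, rfl⟩
  have hz' : δ k (k + 1) z = 0 := by
    have h := endD_apply Q (DirectSum.of (EndDeg Q) k z) (rfl : k + 1 = k + 1)
    rw [DirectSum.of_eq_same] at h
    rw [← h]
    exact congrArg (fun x : EndAlg Q => x (k + 1)) hz
  have hz₀ : (endDG Q).d (DirectSum.of (EndDeg Q) k z) = 0 := hz
  refine Submodule.mem_sup_left ?_
  change (endDG Q).cls (DirectSum.of (EndDeg Q) k z) hz₀ ∈ _
  clear hz
  rcases hk.lt_or_eq with hk | rfl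
  · obtain ⟨u, hu⟩ := exists_δ_eq_of_neg hε hL hQ hproj hzero (sub_add_cancel k 1) hk z hz'
    have : (endDG Q).cls _ hz₀ = 0 := by
      rw [DGAlgebra.cls_eq_zero_iff]
      refine mem_range_endD Q fun j => ?_
      by_cases hj : j = k
      · subst hj
        exact ⟨u, hu.trans (DirectSum.of_eq_same _ _).symm⟩
      · exact ⟨0, (δ_zero _ _).trans (DirectSum.of_eq_of_ne _ _ _ hj).symm⟩
    rw [this]
    exact Submodule.zero_mem _
  · obtain ⟨c, u, hu⟩ := exists_δ_eq_sub_smul hε hL hQ hproj hzero hend z hz'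
    refine Submodule.mem_span_singleton.2 ⟨c, ?_⟩
    have h₁ : (endDG Q).d (c • (1 : EndAlg Q)) = 0 := by
      rw [map_smul, DGAlgebra.d_one, smul_zero]
    have : (endDG Q).cls (c • 1) h₁ = (endDG Q).cls _ hz₀ := by
      rw [DGAlgebra.cls_eq_cls_iff]
      -- The minus sign is needed because `u` cobounds `z - c • 1`, while the classes are compared
      -- in the opposite order.
      refine ⟨DirectSum.of (EndDeg Q) (-1) (-u), ?_⟩
      have h₂ : (1 : EndAlg Q) = DirectSum.of (EndDeg Q) 0 (Cochain.ofHom (𝟙 Q)) := rfl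
      have h₃ : c • (1 : EndAlg Q) = DirectSum.of (EndDeg Q) 0 (c • Cochain.ofHom (𝟙 Q)) :=
        (map_smul (DirectSum.lof ℂ ℤ (EndDeg Q) 0) c _).symm
      rw [h₃]
      refine (endD_of Q (-1) (-u)).trans ?_
      change DirectSum.of (EndDeg Q) 0 (δ (-1) 0 (-u)) = _ - DirectSum.of (EndDeg Q) 0 z
      rw [← map_sub, δ_neg, hu, neg_sub]
    exact this

end EndResolution

end

/-! ### The main theorem. -/

theorem theorem5 {A : Type u} [Ring A] [Algebra ℂ A] (e : A) (he : IsIdempotentElem e)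
    (S : Type u) [AddCommGroup S] [Module ℂ S] [Module Aᵐᵒᵖ S] [IsScalarTower ℂ Aᵐᵒᵖ S]
    (hSfin : FiniteDimensional ℂ S) (hSsimple : IsSimpleModule Aᵐᵒᵖ S)
    (hS : Nontrivial (IStar e S))
    (n : ℕ) (hn : 1 ≤ n)
    (Q : CochainComplex (ModuleCat.{u} Aᵐᵒᵖ) ℤ)
    (hQfin : ∀ k, Module.Finite Aᵐᵒᵖ (Q.X k))
    (hQproj : ∀ k, Module.Projective Aᵐᵒᵖ (Q.X k))
    (hQzero : ∀ k : ℤ, ¬ (-(n : ℤ) < k ∧ k ≤ 0) → Limits.IsZero (Q.X k))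
    (ε : Q ⟶ (CochainComplex.singleFunctor (ModuleCat.{u} Aᵐᵒᵖ) 0).obj (ModuleCat.of Aᵐᵒᵖ S))
    (hε : QuasiIso ε)
    (hP : ∀ j : ℤ, (j = 0 ∨ j = n - 1) →
      Nonempty ((iStarComplex e Q).homology (-j) ≅ (iStar e).obj (ModuleCat.of Aᵐᵒᵖ S)))
    (hP' : ∀ j : ℤ, ¬ (j = 0 ∨ j = n - 1) →
      Limits.IsZero ((iStarComplex e Q).homology (-j))) :
    Nonempty (endDG Q).MinimalModel ∧ Nonempty (endDG (iStarComplex e Q)).MinimalModel ∧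
    ∀ (M : (endDG Q).MinimalModel) (N : (endDG (iStarComplex e Q)).MinimalModel),
      ∃ F : AInfHom M.alg N.unitallyPositive, F.IsIso := by
  let L := (CochainComplex.singleFunctor (ModuleCat.{u} Aᵐᵒᵖ) 0).obj (ModuleCat.of Aᵐᵒᵖ S)
  let i : L.X 0 ≅ ModuleCat.of Aᵐᵒᵖ S := HomologicalComplex.singleObjXSelf (.up ℤ) 0 _
  have hL : ∀ q ≠ 0, Limits.IsZero (L.X q) := fun q hq =>
    HomologicalComplex.isZero_single_obj_X (.up ℤ) 0 _ q hq
  have hQ : ∀ q : ℤ, 0 < q → Limits.IsZero (Q.X q) := fun q hq => hQzero q (by omega)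
  have hi : Function.Injective i.hom.hom := (ModuleCat.mono_iff_injective i.hom).1 inferInstance
  have hi' : Function.Surjective i.hom.hom := (ModuleCat.epi_iff_surjective i.hom).1 inferInstance
  have hnt : Nontrivial (L.X 0) := by
    have := IsSimpleModule.nontrivial Aᵐᵒᵖ S
    exact hi'.nontrivial
  -- The augmentation maps `Q_0 · AeA` to `S · AeA`, a proper submodule of a simple module since
  -- `i^*S ≠ 0`, hence zero.
  have htr : ∀ x ∈ traceSubmodule e (Q.X 0), (ε.f 0).hom x = 0 := fun x hx => by
    have h := IStar.map_mem_traceSubmodule e (ε.f 0 ≫ i.hom).hom hx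
    rw [show traceSubmodule e (ModuleCat.of Aᵐᵒᵖ S) = ⊥ from
      IStar.traceSubmodule_eq_bot e (M := S), Submodule.mem_bot] at h
    exact hi (h.trans (map_zero i.hom.hom).symm)
  -- Schur's lemma for the finite dimensional simple module `S` over `ℂ`, transported along `i`.
  have hend : ∀ f : L.X 0 ⟶ L.X 0, ∃ c : ℂ, f = c • 𝟙 _ := fun f => by
    obtain ⟨c, hc⟩ := (IsSimpleModule.algebraMap_end_bijective_of_isAlgClosed (A := Aᵐᵒᵖ) (V := S)
      ℂ).2 (i.inv ≫ f ≫ i.hom).hom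
    refine ⟨c, ?_⟩
    rw [← cancel_mono i.hom, ← cancel_epi i.inv]
    refine ModuleCat.hom_ext (LinearMap.ext fun x => ?_)
    rw [← hc, Module.algebraMap_end_apply]
    change c • x = i.hom.hom (algebraMap ℂ Aᵐᵒᵖ c • i.inv.hom x)
    rw [map_smul, ← algebraMap_smul Aᵐᵒᵖ c x]
    congr 1
  have hmap : ∀ {j k : ℤ} (_ : j + 1 = k) (z : CochainComplex.HomComplex.Cochain Q Q k),
      CochainComplex.HomComplex.δ k (k + 1) z = 0 →
      ∀ y : CochainComplex.HomComplex.Cochain (iStarComplex e Q) (iStarComplex e Q) j,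
      CochainComplex.HomComplex.δ j k y = z.map (iStar e) →
      ∃ u : CochainComplex.HomComplex.Cochain Q Q j, CochainComplex.HomComplex.δ j k u = z :=
    fun hjk => CochainComplex.HomComplex.exists_δ_eq_of_map_iStar e hε hL hQ hQproj hQzero htr hjk
  have hid := CochainComplex.HomComplex.δ_ne_id hε hL hQ
  refine ⟨(endDG Q).nonempty_minimalModel (endDG_cohOne_ne_zero Q hid),
    (endDG _).nonempty_minimalModel (endDG_cohOne_ne_zero _ fun y hy => ?_), fun M N => ?_⟩
  -- If the identity of `P` were a coboundary, then by injectivity in cohomology so would be the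
  -- identity of `Q`.
  · obtain ⟨u, hu⟩ := hmap (by decide) (.ofHom (𝟙 Q))
      (CochainComplex.HomComplex.δ_ofHom _) y (by
        rw [CochainComplex.HomComplex.Cochain.map_ofHom, CategoryTheory.Functor.map_id]
        exact hy)
    exact hid u hu
  · refine (endMap (iStar e) Q).exists_isIso
      (unitPosSubmodule_endDG hε hL hQ hQproj hQzero hend M.alg.internal) (fun z hz h => ?_)
      (fun k hk z hz hdz => ?_) M N
    · obtain ⟨y, hy⟩ := h
      refine mem_range_endD Q fun k => hmap (sub_add_cancel k 1) _ ?_ (y (k - 1)) ?_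
      · rw [← endD_apply Q z rfl]
        exact congrArg (fun x : EndAlg Q => x (k + 1)) hz
      · rw [← endD_apply _ y (sub_add_cancel k 1), ← EndAlg.map_apply]
        exact congrArg (fun x : EndAlg (iStarComplex e Q) => x k) hy
    · obtain ⟨z, rfl⟩ := hz
      have hz' : CochainComplex.HomComplex.δ k (k + 1) z = 0 := by
        have h := endD_apply _ (DirectSum.of (EndDeg (iStarComplex e Q)) k z) (rfl : k + 1 = k + 1)
        rw [DirectSum.of_eq_same] at h
        rw [← h]
        exact congrArg (fun x : EndAlg (iStarComplex e Q) => x (k + 1)) hdz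
      obtain ⟨x, hx, rfl⟩ := CochainComplex.HomComplex.exists_map_iStar_eq e hε hL hQ hQproj hQzero
        htr (fun q hq hq₀ => by
          have := hP' (-q) (by omega)
          rwa [neg_neg] at this) hk z hz'
      refine ⟨DirectSum.of (EndDeg Q) k x, ?_, EndAlg.map_of (iStar e) Q k x⟩
      refine (endD_of Q k x).trans ?_
      rw [hx, map_zero]
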